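/- \textbf{Theorem (LDG $\theta$-scheme in one space dimension).} Let $k\ge 0$ be an integer, $\alpha,\beta>0$, $\sigma\ge k+2$, $a\in C^1([0,1])$, $b\in C([0,1])$ with $a\ge\alpha$ and $b-\tfrac12 a_x\ge\beta$ on $[0,1]$, and let $(K_{j,m})_{j,m\ge0}$ be real numbers. Then there is a constant $C>0$, depending only on these data, such that the following holds for all $T>0$, all $\theta\in[1/2,1]$, all integers $M\ge1$ (with $\Delta t=T/M$, $t^m=m\Delta t$), all even $N\ge2$ and all $\varepsilon\in(0,N^{-1}]$; in particular $C$ is independent of $\varepsilon$ and $N$. \emph{Continuous problem.} Let $f$ be continuous on $[0,1]\times[0,T]$ and let $u$ solve $$u_t-\varepsilon u_{xx}+a(x)u_x+b(x)u=f \text{ in }(0,1)\times(0,T],\qquad u(x,0)=u_0(x),\qquad u(0,t)=u(1,t)=0 \text{ for } t\in(0,T].$$ Assume $u=S+E$ with $S,E\in C^\infty([0,1]\times[0,T])$ and, for all $j,m\ge0$ and all $(x,t)\in[0,1]\times[0,T]$, $$|\partial_x^j\partial_t^mS(x,t)|\le K_{j,m},\qquad |\partial_x^j\partial_t^mE(x,t)|\le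 K_{j,m}\,\varepsilon^{-j}e^{-\alpha(1-x)/\varepsilon}.$$ Put $\boldsymbol w=(u,q)$ with $q=\varepsilon u_x$. \emph{Mesh.} Let $\varphi\in C^2([0,1/2])$ satisfy $\varphi(0)=0$, $\varphi'>0$, $\varphi''\ge0$ and either $\varphi(1/2)=\ln N$ (Shishkin type) or $\varphi(1/2)=\ln(1/\varepsilon)$ (Bakhvalov type); $\varphi$ may depend on $N$ and $\varepsilon$. Let $\psi=e^{-\varphi}$ and $\max|\psi'|=\max_{[0,1/2]}|\psi'|$. Assume $\tau:=\frac{\sigma\varepsilon}{\alpha}\varphi(1/2)\le\frac12$. The mesh points are $x_i=2(1-\tau)\,i/N$ for $0\le i\le N/2$ and $x_i=1-\frac{\sigma\varepsilon}{\alpha}\varphi(1-i/N)$ for $N/2\le i\le N$; $I_j=(x_{j-1},x_j)$, $h_j=x_j-x_{j-1}$. \emph{Scheme.} Let $\mathcal V_N=\{v\in L^2(0,1): v|_{I_j}\in\mathcal P^k(I_j),\ j=1,\dots,N\}$. For piecewise smooth $v$ let $v_j^\pm$ be its one-sided limits at $x_j$, $[v]_j=v_j^+-v_j^-$ for $1\le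 j\le N-1$, $[v]_0=v_0^+$, $[v]_N=-v_N^-$. Let $\langle\cdot,\cdot\rangle$ and $\|\cdot\|$ be the inner product and norm of $L^2(0,1)$ (derivatives taken elementwise), $a_j=a(x_j)$, $\lambda_N=\varepsilon/h_N$. For $\boldsymbol w=(u,q)$ and $\boldsymbol z=(v,r)$ set $$\begin{aligned}B(\boldsymbol w;\boldsymbol z)={}&\varepsilon^{-1}\langle q,r\rangle+\langle(b-a_x)u,v\rangle+\langle u,r_x\rangle+\sum_{j=1}^{N-1}u_j^-[r]_j+\langle q,v_x\rangle+\sum_{j=0}^{N-1}q_j^+[v]_j-q_N^-v_N^-\\&-\langle au,v_x\rangle-\sum_{j=1}^Na_ju_j^-[v]_j+\lambda_Nu_N^-v_N^-,\end{aligned}$$ $$|\!|\!|\boldsymbol w|\!|\!|^2=\varepsilon^{-1}\|q\|^2+\|(b-\tfrac12a_x)^{1/2}u\|^2+\sum_{j=0}^N\tfrac12a_j[u]_j^2+\lambda_N[u]_N^2 .$$ For a sequence or a function of time write $v^m=v(t^m)$ and $v^{m,\theta}=\theta v^m+(1-\theta)v^{m-1}$. Let $\boldsymbol W^m=(U^m,Q^m)\in\mathcal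 V_N^2$, $0\le m\le M$, where $U^0$ is the $L^2$ projection of $u_0$ onto $\mathcal V_N$ ($Q^0$ is arbitrary), satisfy for $m=1,\dots,M$ $$\Big\langle\frac{U^m-U^{m-1}}{\Delta t},v\Big\rangle+B(\boldsymbol W^{m,\theta};\boldsymbol z)=\langle f^{m,\theta},v\rangle\qquad\text{for all }\boldsymbol z=(v,r)\in\mathcal V_N^2 .$$ \emph{Conclusion.} With $\nu=2$ if $\theta=1/2$ and $\nu=1$ if $1/2<\theta\le1$, $$\|u(T)-U^M\|\le C(1+T)\big((\Delta t)^\nu+(N^{-1}\max|\psi'|)^{k+1}\big),$$ $$\Delta t\sum_{m=1}^M|\!|\!|(\boldsymbol w-\boldsymbol W)^{m,\theta}|\!|\!|\le C(1+T)\big((\Delta t)^\nu+(N^{-1}\max|\psi'|)^{k+1/2}\big).$$ -/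

import Mathlib

open Set

noncomputable section

namespace LDG

/-! ### Mesh -/

/-- Admissible functions `φ` on `[0, 1/2]`: twice continuously differentiable with
`φ 0 = 0`, `φ' > 0` and `φ'' ≥ 0`. -/
structure IsMeshGenerating (φ : ℝ → ℝ) : Prop where
  contDiffOn : ContDiffOn ℝ 2 φ (Icc 0 (1 / 2))
  zero : φ 0 = 0
  deriv_pos : ∀ t ∈ Icc (0 : ℝ) (1 / 2), 0 < derivWithin φ (Icc 0 (1 / 2)) t
  deriv_two_nonneg : ∀ t ∈ Icc (0 : ℝ) (1 / 2), 0 ≤ iteratedDerivWithin 2 φ (Icc 0 (1 / 2)) t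

/-- The mesh characterizing function `ψ = exp (-φ)`. -/
def meshPsi (φ : ℝ → ℝ) (t : ℝ) : ℝ := Real.exp (-φ t)

/-- `max |ψ'|` over `[0, 1/2]`. -/
def maxPsi' (φ : ℝ → ℝ) : ℝ :=
  sSup ((fun t => |derivWithin (meshPsi φ) (Icc 0 (1 / 2)) t|) '' Icc 0 (1 / 2))

/-- The transition parameter: the mesh is fine on `[1 - τ, 1]`. -/
def meshTau (σ ε α : ℝ) (φ : ℝ → ℝ) : ℝ := min (1 / 2) (σ * ε / α * φ (1 / 2))

/-- The mesh points `x_i`, `i = 0, …, N`, given by the mesh generating function evaluated at `i/N`. -/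
def meshPt (σ ε α : ℝ) (φ : ℝ → ℝ) (N i : ℕ) : ℝ :=
  if (i : ℝ) / N ≤ 1 / 2 then 2 * (1 - meshTau σ ε α φ) * ((i : ℝ) / N)
  else 1 - σ * ε / α * φ (1 - (i : ℝ) / N)

/-! ### Broken functions

A function on `(0,1)` that may jump at the mesh points `x 0 < x 1 < ⋯ < x N` is represented by the
family of its restrictions to the elements: for `1 ≤ j ≤ N` the function `v j` is the restriction
to `I_j = (x (j-1), x j)`, extended continuously to the end points.  Hence the left trace at `x j`
is `v j (x j)` and the right trace at `x j` is `v (j+1) (x j)`.  Indices `j` outside `1, …, N`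
are never used. -/

abbrev Broken := ℕ → ℝ → ℝ

/-- `v_j^-`, for `1 ≤ j ≤ N`. -/
def traceL (x : ℕ → ℝ) (v : Broken) (j : ℕ) : ℝ := v j (x j)

/-- `v_j^+`, for `0 ≤ j ≤ N - 1`. -/
def traceR (x : ℕ → ℝ) (v : Broken) (j : ℕ) : ℝ := v (j + 1) (x j)

/-- The jump `v_j^+ - v_j^-` at `x j`, where the missing outer traces at `j = 0` and `j = N`
are replaced by `0`. -/
def jump (x : ℕ → ℝ) (N : ℕ) (v : Broken) (j : ℕ) : ℝ :=
  if j = 0 then traceR x v 0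
  else if j = N then -traceL x v N
  else traceR x v j - traceL x v j

/-- `⟨v, w⟩ = ∑_j ∫_{I_j} v w`. -/
def ip (x : ℕ → ℝ) (N : ℕ) (v w : Broken) : ℝ :=
  ∑ j ∈ Finset.Icc 1 N, ∫ y in (x (j - 1))..(x j), v j y * w j y

/-- The `L²(0,1)` norm. -/
def l2norm (x : ℕ → ℝ) (N : ℕ) (v : Broken) : ℝ := Real.sqrt (ip x N v v)

/-- The finite element space: polynomials of degree at most `k` on each element. -/
def IsDiscrete (N k : ℕ) (v : Broken) : Prop :=
  ∀ j ∈ Finset.Icc 1 N, ∃ p : Polynomial ℝ, p.natDegree ≤ k ∧ ∀ y, v j y = p.eval y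

/-- The elementwise derivative. -/
def brokenDeriv (v : Broken) : Broken := fun j => deriv (v j)

/-! ### The LDG form and the energy norm -/

/-- The derivative `g_x` of a function on `[0,1]`, one-sided at the end points. -/
def dx (g : ℝ → ℝ) : ℝ → ℝ := derivWithin g (Icc 0 1)

/-- The penalty parameter `ε / h_N` at the outflow boundary, with `h_N = x_N - x_{N-1}`. -/
def penalty (x : ℕ → ℝ) (N : ℕ) (ε : ℝ) : ℝ := ε / (x N - x (N - 1))

/-- The LDG bilinear form `B((u,q); (v,r))`, summed over all elements, for the numerical fluxes
`û_j = u_j^-` for `1 ≤ j ≤ N-1`, `û_0 = û_N = 0` (diffusion),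
`q̂_j = q_j^+` for `0 ≤ j ≤ N-1`, `q̂_N = q_N^- - (ε/h_N) u_N^-`,
`ũ_j = u_j^-` for `1 ≤ j ≤ N`, `ũ_0 = 0` (convection). -/
def formB (x : ℕ → ℝ) (N : ℕ) (ε : ℝ) (a b : ℝ → ℝ) (u q v r : Broken) : ℝ :=
  (ε⁻¹ * ip x N q r + ip x N (fun j y => (b y - dx a y) * u j y) v)
  + (ip x N u (brokenDeriv r) + ∑ j ∈ Finset.Icc 1 (N - 1), traceL x u j * jump x N r j)
  + (ip x N q (brokenDeriv v) + ∑ j ∈ Finset.range N, traceR x q j * jump x N v j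
      - traceL x q N * traceL x v N)
  + (-ip x N (fun j y => a y * u j y) (brokenDeriv v)
      - ∑ j ∈ Finset.Icc 1 N, a (x j) * traceL x u j * jump x N v j
      + penalty x N ε * traceL x u N * traceL x v N)

/-- The energy norm of the pair `(u, q)`. -/
def energyNorm (x : ℕ → ℝ) (N : ℕ) (ε : ℝ) (a b : ℝ → ℝ) (u q : Broken) : ℝ :=
  Real.sqrt
    (ε⁻¹ * ip x N q q + ip x N (fun j y => (b y - dx a y / 2) * u j y) u
      + ∑ j ∈ Finset.range (N + 1), 1 / 2 * a (x j) * jump x N u j ^ 2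
      + penalty x N ε * jump x N u N ^ 2)

/-! ### The continuous problem -/

/-- `∂_x^j ∂_t^m g` on `[0,1] × [0,T]`, one-sided at the boundary. -/
def mixedDeriv (T : ℝ) (j m : ℕ) (g : ℝ → ℝ → ℝ) (x t : ℝ) : ℝ :=
  iteratedDerivWithin j (fun y => iteratedDerivWithin m (g y) (Icc 0 T) t) (Icc 0 1) x

/-- `u` is a classical solution of `u_t - ε u_xx + a u_x + b u = f` in `(0,1) × (0,T]`,
`u(x,0) = u₀(x)`, `u(0,t) = u(1,t) = 0`, with continuous right-hand side. -/
structure IsSolution (ε T : ℝ) (a b : ℝ → ℝ) (f : ℝ → ℝ → ℝ) (u₀ : ℝ → ℝ) (u : ℝ → ℝ → ℝ) :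
    Prop where
  continuousOn_rhs : ContinuousOn (fun z : ℝ × ℝ => f z.1 z.2) (Icc 0 1 ×ˢ Icc 0 T)
  pde : ∀ x ∈ Ioo (0 : ℝ) 1, ∀ t ∈ Ioc (0 : ℝ) T,
    mixedDeriv T 0 1 u x t - ε * mixedDeriv T 2 0 u x t + a x * mixedDeriv T 1 0 u x t
      + b x * u x t = f x t
  initial : ∀ x ∈ Icc (0 : ℝ) 1, u x 0 = u₀ x
  boundary : ∀ t ∈ Ioc (0 : ℝ) T, u 0 t = 0 ∧ u 1 t = 0

/-- `u = S + E` with a smooth part `S` and an exponential layer part `E` at `x = 1`; the number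
`K j m` is the constant in the bounds of the derivatives `∂_x^j ∂_t^m`. -/
def HasLayerDecomposition (ε α T : ℝ) (K : ℕ → ℕ → ℝ) (u : ℝ → ℝ → ℝ) : Prop :=
  ∃ S E : ℝ → ℝ → ℝ,
    ContDiffOn ℝ (⊤ : ℕ∞) (fun z : ℝ × ℝ => S z.1 z.2) (Icc 0 1 ×ˢ Icc 0 T) ∧
    ContDiffOn ℝ (⊤ : ℕ∞) (fun z : ℝ × ℝ => E z.1 z.2) (Icc 0 1 ×ˢ Icc 0 T) ∧
    ∀ x ∈ Icc (0 : ℝ) 1, ∀ t ∈ Icc (0 : ℝ) T,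
      u x t = S x t + E x t ∧
      ∀ j m : ℕ,
        |mixedDeriv T j m S x t| ≤ K j m ∧
        |mixedDeriv T j m E x t| ≤ K j m * (ε ^ j)⁻¹ * Real.exp (-α * (1 - x) / ε)

/-! ### The fully discrete scheme -/

/-- The time level `t^m = m Δt`. -/
def timePt (T : ℝ) (M m : ℕ) : ℝ := m * (T / M)

/-- `V^{m,θ} = θ V^m + (1-θ) V^{m-1}` for a sequence of broken functions. -/
def thetaAvg (θ : ℝ) (V : ℕ → Broken) (m : ℕ) : Broken :=
  fun j y => θ * V m j y + (1 - θ) * V (m - 1) j y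

/-- The values `g(·, t^m)` of a function on `[0,1] × [0,T]`, as broken functions. -/
def atTime (T : ℝ) (M : ℕ) (g : ℝ → ℝ → ℝ) (m : ℕ) : Broken :=
  fun _ y => g y (timePt T M m)

/-- `p` is the elementwise `L²` projection of `g` onto the finite element space. -/
def IsL2Projection (x : ℕ → ℝ) (N k : ℕ) (g : ℝ → ℝ) (p : Broken) : Prop :=
  IsDiscrete N k p ∧
  ∀ v, IsDiscrete N k v → ∀ j ∈ Finset.Icc 1 N,
    ∫ y in (x (j - 1))..(x j), p j y * v j y = ∫ y in (x (j - 1))..(x j), g y * v j y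

/-- `W^m = (U m, Q m)`, `0 ≤ m ≤ M`, is a solution of the LDG `θ`-scheme. -/
structure IsThetaScheme (x : ℕ → ℝ) (N k M : ℕ) (ε T θ : ℝ) (a b : ℝ → ℝ)
    (f : ℝ → ℝ → ℝ) (u₀ : ℝ → ℝ) (U Q : ℕ → Broken) : Prop where
  discrete : ∀ m ≤ M, IsDiscrete N k (U m) ∧ IsDiscrete N k (Q m)
  initial : IsL2Projection x N k u₀ (U 0)
  step : ∀ m ∈ Finset.Icc 1 M, ∀ v r : Broken, IsDiscrete N k v → IsDiscrete N k r →
    ip x N (fun j y => (U m j y - U (m - 1) j y) / (T / M)) v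
        + formB x N ε a b (thetaAvg θ U m) (thetaAvg θ Q m) v r
      = ip x N (thetaAvg θ (atTime T M f) m) v

end LDG

end

open Set

noncomputable section

namespace LDG

section

open Polynomial

/-! ### Dual bases of polynomial spaces -/

/-! The error is split by elementwise Gauss–Radau projections: `radauR`, which interpolates at right
end points, for `u`, and `radauL`, which interpolates at left end points, for `q = ε u_x`. These are
the interior traces taken by the numerical fluxes, and the projection errors are orthogonal to
derivatives of discrete functions. Hence almost every term of the form applied to the projection
error vanishes (`formB_projection_error`). What survives is the `L²` error of the flux, a reaction
term, the trace of the flux error at the outflow, and a convection term with `a - a(x_j)`, whose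
factor `h_j` pays for an inverse inequality. All of it is at most a bound of the projection errors
times the energy norm of the test function (`exists_formB_projection_bound`).

The difference between projection and discrete solution is estimated by energy. By consistency
(`formB_smooth`) it satisfies `error_equation`. Testing with its own `θ`-average, coercivity
(`formB_self`) produces the squared energy norm, and `θ ≥ 1/2` makes the time difference dominate a
telescoping difference of squared `L²` norms (`energy_step`). Since `β > 0`, the energy norm
controls the `L²` norm of the test function, so Young's inequality closes the argument without
Gronwall and the factor `1 + T` suffices (`energy_bounds`).

The projection errors are governed by the weight `s(y) = exp(-α(1-y)/(σε))`. As `σ ≥ k + 2`, the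
layer factor is at most `s^(k+2)`. On an element `(c,d)` of length `h`, stability and Taylor
expansion together give a layer error of order `(min(1, h/ε) s(d))^(k+1) s(d)`, and `min(1, h/ε)
s(d)` is at most a constant times `s(d) - s(c)` (`min_mul_layerWeight_le`). So a mesh only has to
keep its widths and the increments of `s` of order `δ`, which is the content of `LayerMesh`;
`layerMesh_meshPt` verifies this with `δ = min(1, N⁻¹ max|ψ'|)`. Pointwise errors are then of order
`δ^(k+1)` (`LayerMesh.interp_sup`). The squared jumps sum to order `δ^(2k+1)`, because one factor is
spent on a telescoping sum (`LayerMesh.interp_jump`); this is the half power missing in the energy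
estimate. The flux error loses nothing, because `∫ s²` is of order `ε` (`LayerMesh.interp_flux`).

In time, the difference quotient of `u` again splits into a smooth and a layer part, with constants
`K j 1`, so its projection error carries no factor `(Δt)⁻¹`; the truncation error of the `θ`-rule is
pointwise of order `(Δt)^ν` (`abs_theta_truncation_le`). -/

theorem exists_dual_polynomials (k : ℕ) (L : Fin (k + 1) → (ℝ[X] →ₗ[ℝ] ℝ))
    (hL : ∀ p : ℝ[X], p.natDegree ≤ k → (∀ i, L i p = 0) → p = 0) :
    ∃ e : Fin (k + 1) → ℝ[X], (∀ i, (e i).natDegree ≤ k) ∧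
      (∀ i j, L j (e i) = if i = j then 1 else 0) ∧
      ∀ p : ℝ[X], p.natDegree ≤ k → p = ∑ i, C (L i p) * e i := by
  have hdeg : ∀ p : ℝ[X], p ∈ degreeLT ℝ (k + 1) ↔ p.natDegree ≤ k := by
    intro p
    rw [mem_degreeLT, natDegree_le_iff_degree_le, degree_lt_iff_coeff_zero,
      degree_le_iff_coeff_zero]
    constructor
    · intro h m hm
      exact h m (by exact_mod_cast hm)
    · intro h m hm
      exact h m (by exact_mod_cast hm)
  -- The joint evaluation of the functionals is injective between spaces of the same dimension `k +
  -- 1`, hence surjective; preimages of the unit vectors form the dual basis.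
  let T : degreeLT ℝ (k + 1) →ₗ[ℝ] (Fin (k + 1) → ℝ) :=
    (LinearMap.pi L).comp (Submodule.subtype _)
  have hT : Function.Injective T := by
    rw [injective_iff_map_eq_zero]
    intro p hp
    apply Subtype.ext
    exact hL p ((hdeg p).1 p.2) fun i => congrFun hp i
  have : FiniteDimensional ℝ (degreeLT ℝ (k + 1)) :=
    LinearEquiv.finiteDimensional (degreeLTEquiv ℝ (k + 1)).symm
  have hfin : Module.finrank ℝ (degreeLT ℝ (k + 1)) = Module.finrank ℝ (Fin (k + 1) → ℝ) :=
    (degreeLTEquiv ℝ (k + 1)).finrank_eq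
  have hsurj : Function.Surjective T :=
    (LinearMap.injective_iff_surjective_of_finrank_eq_finrank hfin).1 hT
  choose e he using fun i : Fin (k + 1) => hsurj (Pi.single i 1)
  have hdual : ∀ i j, L j (e i : ℝ[X]) = if i = j then 1 else 0 := by
    intro i j
    have := congrFun (he i) j
    rw [Pi.single_apply] at this
    simpa [T, eq_comm] using this
  refine ⟨fun i => e i, fun i => (hdeg _).1 (e i).2, hdual, fun p hp => ?_⟩
  rw [← sub_eq_zero]
  refine hL _ ?_ fun j => ?_
  · refine (natDegree_sub_le_iff_left ?_).2 hp
    refine natDegree_sum_le_of_forall_le _ _ fun i _ => ?_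
    exact (natDegree_C_mul_le _ _).trans ((hdeg _).1 (e i).2)
  · simp only [map_sub, map_sum, ← smul_eq_C_mul, map_smul, hdual]
    simp

theorem polynomial_intervalIntegrable (p : ℝ[X]) (u v : ℝ) :
    IntervalIntegrable (fun y => p.eval y) MeasureTheory.volume u v :=
  p.continuous.intervalIntegrable _ _

/-- The integral over `(0,1)` of a nonnegative weight, positive inside, times the square of a
polynomial vanishes only for the zero polynomial. -/
theorem polynomial_eq_zero_of_integral_sq {w : ℝ → ℝ} (hw : Continuous w)
    (hpos : ∀ y ∈ Ioo (0 : ℝ) 1, 0 < w y) (p : ℝ[X])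
    (h : ∫ y in (0 : ℝ)..1, w y * p.eval y ^ 2 = 0) : p = 0 := by
  by_contra hp
  have hw0 : ∀ y ∈ Icc (0 : ℝ) 1, 0 ≤ w y := by
    intro y hy
    have hcl : y ∈ closure (Ioo (0 : ℝ) 1) := by rwa [closure_Ioo (by norm_num)]
    exact closure_minimal (fun z hz => (hpos z hz).le) (isClosed_Ici.preimage hw) hcl
  obtain ⟨c, hc, hcp⟩ : ∃ c ∈ Ioo (0 : ℝ) 1, p.eval c ≠ 0 := by
    by_contra! hcon
    exact hp (p.eq_zero_of_infinite_isRoot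
      ((Ioo_infinite (show (0 : ℝ) < 1 by norm_num)).mono fun y hy => hcon y hy))
  have := intervalIntegral.integral_pos (f := fun y => w y * p.eval y ^ 2)
    (show (0 : ℝ) < 1 by norm_num)
    (by fun_prop)
    (fun y hy => mul_nonneg (hw0 y ⟨hy.1.le, hy.2⟩) (sq_nonneg _))
    ⟨c, ⟨hc.1.le, hc.2.le⟩, mul_pos (hpos c hc) (by positivity)⟩
  exact this.ne' h

/-- The degree condition is phrased by coefficients so that `n = 0` means `r = 0`; a bound on
`natDegree` could not express this, and degree `k = 0` needs it. -/
theorem integral_mul_polynomial_eq_zero {g : ℝ → ℝ} {n : ℕ}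
    (hg : IntervalIntegrable g MeasureTheory.volume 0 1)
    (h : ∀ l < n, ∫ y in (0 : ℝ)..1, g y * y ^ l = 0) (r : ℝ[X])
    (hr : ∀ i, n ≤ i → r.coeff i = 0) :
    ∫ y in (0 : ℝ)..1, g y * r.eval y = 0 := by
  have hint : ∀ i : ℕ, IntervalIntegrable (fun y => g y * (r.coeff i * y ^ i))
      MeasureTheory.volume 0 1 := fun i =>
    hg.mul_continuousOn (by fun_prop)
  simp_rw [eval_eq_sum_range, Finset.mul_sum]
  rw [intervalIntegral.integral_finsetSum fun i _ => hint i]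
  refine Finset.sum_eq_zero fun i _ => ?_
  rcases lt_or_ge i n with hi | hi
  · have : ∀ y : ℝ, g y * (r.coeff i * y ^ i) = r.coeff i * (g y * y ^ i) := fun y => by ring
    simp_rw [this]
    rw [intervalIntegral.integral_const_mul, h i hi, mul_zero]
  · simp [hr i hi]

/-- The moment functional `p ↦ ∫₀¹ p y^l`. -/
def moment (l : ℕ) : ℝ[X] →ₗ[ℝ] ℝ where
  toFun p := ∫ y in (0 : ℝ)..1, p.eval y * y ^ l
  map_add' p q := by
    simp only [eval_add, add_mul]
    exact intervalIntegral.integral_add (Continuous.intervalIntegrable (by fun_prop) _ _)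
      (Continuous.intervalIntegrable (by fun_prop) _ _)
  map_smul' c p := by
    simp only [eval_smul, smul_eq_mul, mul_assoc, RingHom.id_apply]
    exact intervalIntegral.integral_const_mul _ _

/-- Moments are bounded by the `L¹` norm, so this expansion makes every linear quantity of a
polynomial of degree at most `k` controllable by that norm. It serves the inverse inequality. -/
theorem exists_moment_dual (k : ℕ) : ∃ e : Fin (k + 1) → ℝ[X],
    ∀ p : ℝ[X], p.natDegree ≤ k →
      p = ∑ i : Fin (k + 1), C (∫ y in (0 : ℝ)..1, p.eval y * y ^ (i : ℕ)) * e i := by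
  obtain ⟨e, -, -, he⟩ := exists_dual_polynomials k (fun i => moment i) (by
    intro p hp h
    refine polynomial_eq_zero_of_integral_sq (w := fun _ => 1) (by fun_prop)
      (fun _ _ => one_pos) p ?_
    have := integral_mul_polynomial_eq_zero (n := k + 1) (polynomial_intervalIntegrable p 0 1)
      (fun l hl => h ⟨l, hl⟩) p fun i hi => coeff_eq_zero_of_natDegree_lt (by omega)
    simpa [sq] using this)
  exact ⟨e, he⟩

/-! ### The Gauss–Radau projection on the reference element -/

/-- The functionals defining the Gauss–Radau projection on `[0,1]` with node `1`. -/
def radauFunctional (i : ℕ) (g : ℝ → ℝ) : ℝ :=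
  if i = 0 then g 1 else ∫ y in (0 : ℝ)..1, g y * y ^ (i - 1)

/-- Unisolvence: if all functionals vanish at `p`, then `p = (X - 1) r`, and `r` has degree below
`k`, so `p` is orthogonal to `r`. Thus `∫ (1 - y) r² = 0`, and the weight is positive inside
`(0,1)`. -/
theorem exists_radau_dual (k : ℕ) : ∃ e : Fin (k + 1) → ℝ[X], (∀ i, (e i).natDegree ≤ k) ∧
    (∀ i j : Fin (k + 1), radauFunctional j (fun y => (e i).eval y) = if i = j then 1 else 0) ∧
    ∀ p : ℝ[X], p.natDegree ≤ k →
      p = ∑ i : Fin (k + 1), C (radauFunctional i fun y => p.eval y) * e i := by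
  let L : Fin (k + 1) → (ℝ[X] →ₗ[ℝ] ℝ) := fun i =>
    if (i : ℕ) = 0 then leval 1 else moment (i - 1)
  have hLr : ∀ (i : Fin (k + 1)) (p : ℝ[X]), L i p = radauFunctional i fun y => p.eval y := by
    intro i p
    by_cases hi : (i : ℕ) = 0
    · simp only [L, if_pos hi, radauFunctional]; rfl
    · simp only [L, if_neg hi, radauFunctional]; rfl
  have := exists_dual_polynomials k L (by
    intro p hp h
    have h1 : p.eval 1 = 0 := by
      have := h 0
      rw [hLr] at this
      simpa [radauFunctional] using this
    obtain ⟨r, rfl⟩ := dvd_iff_isRoot.2 h1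
    have hm : ∀ l < k, ∫ y in (0 : ℝ)..1, ((X - C 1) * r).eval y * y ^ l = 0 := by
      intro l hl
      have := h ⟨l + 1, by omega⟩
      rw [hLr] at this
      simpa only [radauFunctional, Nat.add_eq_zero_iff, one_ne_zero, and_false, if_false,
        Nat.add_sub_cancel] using this
    by_cases hr : r = 0
    · simp [hr]
    have hdeg : r.natDegree + 1 ≤ k := by
      rw [natDegree_mul (X_sub_C_ne_zero 1) hr, natDegree_X_sub_C] at hp
      omega
    have h0 := integral_mul_polynomial_eq_zero (n := k)
      (polynomial_intervalIntegrable ((X - C 1) * r) 0 1) hm r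
      fun i hi => coeff_eq_zero_of_natDegree_lt (by omega)
    exfalso
    refine hr (polynomial_eq_zero_of_integral_sq (w := fun y => 1 - y) (by fun_prop)
      (fun y hy => by linarith [hy.2]) r ?_)
    have h2 : ∀ y : ℝ, (1 - y) * r.eval y ^ 2 = -(((X - C 1) * r).eval y * r.eval y) := by
      intro y
      simp only [eval_mul, eval_sub, eval_X, eval_C]
      ring
    simp_rw [h2]
    rw [intervalIntegral.integral_neg, h0, neg_zero])
  simpa only [hLr] using this

/-- The basis dual to the Gauss–Radau functionals. -/
def radauBasis (k : ℕ) : Fin (k + 1) → ℝ[X] := (exists_radau_dual k).choose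

/-- The Gauss–Radau projection of degree `k` on `[0,1]` with node `1`. -/
def radauRef (k : ℕ) (g : ℝ → ℝ) : ℝ[X] :=
  ∑ i : Fin (k + 1), C (radauFunctional i g) * radauBasis k i

theorem radauRef_natDegree_le (k : ℕ) (g : ℝ → ℝ) : (radauRef k g).natDegree ≤ k :=
  natDegree_sum_le_of_forall_le _ _ fun i _ =>
    (natDegree_C_mul_le _ _).trans ((exists_radau_dual k).choose_spec.1 i)

theorem radauRef_polynomial {k : ℕ} {p : ℝ[X]} (hp : p.natDegree ≤ k) :
    radauRef k (fun y => p.eval y) = p :=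
  ((exists_radau_dual k).choose_spec.2.2 p hp).symm

theorem radauFunctional_linear {g₁ g₂ : ℝ → ℝ} (h₁ : ContinuousOn g₁ (Icc 0 1))
    (h₂ : ContinuousOn g₂ (Icc 0 1)) (c₁ c₂ : ℝ) (i : ℕ) :
    radauFunctional i (fun y => c₁ * g₁ y + c₂ * g₂ y)
      = c₁ * radauFunctional i g₁ + c₂ * radauFunctional i g₂ := by
  unfold radauFunctional
  split_ifs
  · rfl
  · have hi : ∀ g : ℝ → ℝ, ContinuousOn g (Icc 0 1) →
        IntervalIntegrable (fun y => g y * y ^ (i - 1)) MeasureTheory.volume 0 1 := fun g hg =>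
      ContinuousOn.intervalIntegrable (by
        rw [uIcc_of_le zero_le_one]; exact hg.mul (by fun_prop))
    rw [← intervalIntegral.integral_const_mul, ← intervalIntegral.integral_const_mul,
      ← intervalIntegral.integral_add ((hi _ h₁).const_mul _) ((hi _ h₂).const_mul _)]
    congr 1
    ext y
    ring

theorem radauRef_linear {g₁ g₂ : ℝ → ℝ} (h₁ : ContinuousOn g₁ (Icc 0 1))
    (h₂ : ContinuousOn g₂ (Icc 0 1)) (k : ℕ) (c₁ c₂ : ℝ) :
    radauRef k (fun y => c₁ * g₁ y + c₂ * g₂ y)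
      = C c₁ * radauRef k g₁ + C c₂ * radauRef k g₂ := by
  simp only [radauRef, radauFunctional_linear h₁ h₂, C_add, C_mul, Finset.mul_sum,
    ← Finset.sum_add_distrib]
  exact Finset.sum_congr rfl fun i _ => by ring

theorem radauFunctional_radauRef (k : ℕ) (g : ℝ → ℝ) (j : Fin (k + 1)) :
    radauFunctional j (fun y => (radauRef k g).eval y) = radauFunctional j g := by
  have h := (exists_radau_dual k).choose_spec.2.1
  -- `radauFunctional` is additive only where the integrals exist, so it is not a bundled linear map
  -- and the sum is taken apart by induction.
  have hlin : ∀ s : Finset (Fin (k + 1)),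
      radauFunctional j (fun y => (∑ i ∈ s, C (radauFunctional i g) * radauBasis k i).eval y)
        = ∑ i ∈ s, radauFunctional i g * if i = j then 1 else 0 := by
    intro s
    induction s using Finset.induction_on with
    | empty => simp [radauFunctional]
    | insert i s hi ih =>
      rw [Finset.sum_insert hi, Finset.sum_insert hi, ← ih, ← h i j]
      have := radauFunctional_linear (g₁ := fun y => (radauBasis k i).eval y)
        (g₂ := fun y => (∑ i ∈ s, C (radauFunctional i g) * radauBasis k i).eval y)
        (Polynomial.continuous _).continuousOn (Polynomial.continuous _).continuousOn
        (radauFunctional i g) 1 j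
      simp only [one_mul] at this
      rw [← radauBasis, ← this]
      simp only [eval_add, eval_mul, eval_C]
  rw [radauRef, hlin]
  simp

theorem radauRef_eval_one (k : ℕ) (g : ℝ → ℝ) : (radauRef k g).eval 1 = g 1 := by
  simpa [radauFunctional] using radauFunctional_radauRef k g 0

theorem radauRef_orthogonal {g : ℝ → ℝ} (hg : ContinuousOn g (Icc 0 1)) (k : ℕ) (r : ℝ[X])
    (hr : ∀ i, k ≤ i → r.coeff i = 0) :
    ∫ y in (0 : ℝ)..1, (g y - (radauRef k g).eval y) * r.eval y = 0 := by
  have hgi : IntervalIntegrable g MeasureTheory.volume 0 1 :=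
    ContinuousOn.intervalIntegrable (by rwa [uIcc_of_le zero_le_one])
  refine integral_mul_polynomial_eq_zero (n := k) (hgi.sub (polynomial_intervalIntegrable _ _ _))
    (fun l hl => ?_) r hr
  have h := radauFunctional_radauRef k g ⟨l + 1, by omega⟩
  simp only [radauFunctional, Nat.add_eq_zero_iff, one_ne_zero, and_false, if_false,
    Nat.add_sub_cancel] at h
  simp only [sub_mul]
  rw [intervalIntegral.integral_sub (hgi.mul_continuousOn (by fun_prop))
    (Continuous.intervalIntegrable (by fun_prop) _ _), h, sub_self]

theorem polynomial_bounded_Icc (p : ℝ[X]) :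
    ∃ B : ℝ, 0 ≤ B ∧ ∀ s ∈ Icc (0 : ℝ) 1, |p.eval s| ≤ B := by
  obtain ⟨B, hB⟩ := isCompact_Icc.exists_bound_of_continuousOn
    (p.continuous.continuousOn (s := Icc (0 : ℝ) 1))
  exact ⟨B, (norm_nonneg _).trans (hB 0 (by simp)), hB⟩

theorem abs_integral_mul_pow_le {g : ℝ → ℝ} (hg : IntervalIntegrable g MeasureTheory.volume 0 1)
    (l : ℕ) : |∫ y in (0 : ℝ)..1, g y * y ^ l| ≤ ∫ y in (0 : ℝ)..1, |g y| := by
  refine (intervalIntegral.abs_integral_le_integral_abs zero_le_one).trans ?_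
  refine intervalIntegral.integral_mono_on zero_le_one
    (hg.mul_continuousOn (by fun_prop)).abs hg.abs fun y hy => ?_
  rw [abs_mul]
  refine mul_le_of_le_one_right (abs_nonneg _) ?_
  rw [abs_of_nonneg (pow_nonneg hy.1 _)]
  exact pow_le_one₀ hy.1 hy.2

/-- The bound uses the nodal value and the `L¹` norm rather than the maximum: in the `L²` estimate
for the flux, the node sits where the layer is smallest on the element, and a maximum would lose
this. -/
theorem radauRef_bound (k : ℕ) : ∃ B : ℝ, 0 ≤ B ∧ ∀ g : ℝ → ℝ, ContinuousOn g (Icc 0 1) →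
    ∀ s ∈ Icc (0 : ℝ) 1, |(radauRef k g).eval s| ≤ B * (|g 1| + ∫ y in (0 : ℝ)..1, |g y|) := by
  choose B hB0 hB using fun i => polynomial_bounded_Icc (radauBasis k i)
  refine ⟨∑ i, B i, Finset.sum_nonneg fun i _ => hB0 i, fun g hg s hs => ?_⟩
  have hgi : IntervalIntegrable g MeasureTheory.volume 0 1 :=
    ContinuousOn.intervalIntegrable (by rwa [uIcc_of_le zero_le_one])
  have hI : 0 ≤ ∫ y in (0 : ℝ)..1, |g y| :=
    intervalIntegral.integral_nonneg zero_le_one fun _ _ => abs_nonneg _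
  have hf : ∀ i : ℕ, |radauFunctional i g| ≤ |g 1| + ∫ y in (0 : ℝ)..1, |g y| := by
    intro i
    unfold radauFunctional
    split_ifs
    · linarith
    · linarith [abs_integral_mul_pow_le hgi (i - 1), abs_nonneg (g 1)]
  rw [radauRef, eval_finsetSum, Finset.sum_mul]
  refine (Finset.abs_sum_le_sum_abs _ _).trans (Finset.sum_le_sum fun i _ => ?_)
  rw [eval_mul, eval_C, abs_mul, mul_comm]
  exact mul_le_mul (hB i s hs) (hf i) (abs_nonneg _) (hB0 i)

/-- Equivalence of norms on a finite-dimensional space, made explicit by expanding `p` in the basis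
dual to the moments. -/
theorem derivative_bound_ref (k : ℕ) : ∃ B : ℝ, 0 ≤ B ∧ ∀ p : ℝ[X], p.natDegree ≤ k →
    ∀ s ∈ Icc (0 : ℝ) 1, |(derivative p).eval s| ≤ B * ∫ y in (0 : ℝ)..1, |p.eval y| := by
  obtain ⟨e, he⟩ := exists_moment_dual k
  choose B hB0 hB using fun i => polynomial_bounded_Icc (derivative (e i))
  refine ⟨∑ i, B i, Finset.sum_nonneg fun i _ => hB0 i, fun p hp s hs => ?_⟩
  have h := congrArg (fun q : ℝ[X] => (derivative q).eval s) (he p hp)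
  simp only [derivative_sum, derivative_C_mul, eval_finsetSum, eval_mul, eval_C] at h
  rw [h, Finset.sum_mul]
  refine (Finset.abs_sum_le_sum_abs _ _).trans (Finset.sum_le_sum fun i _ => ?_)
  rw [abs_mul, mul_comm]
  exact mul_le_mul (hB i s hs) (abs_integral_mul_pow_le (polynomial_intervalIntegrable p 0 1) i)
    (abs_nonneg _) (hB0 i)

/-! ### The Gauss–Radau projection on an interval -/

/-- The Gauss–Radau projection of degree `k` on the interval with end points `e` and `z`,
with node `z`. -/
def radauOn (k : ℕ) (e z : ℝ) (g : ℝ → ℝ) : ℝ[X] :=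
  (radauRef k fun s => g (e + (z - e) * s)).comp (C (z - e)⁻¹ * (X - C e))

/-- The map reverses orientation when `z < e`. Working with `uIcc` treats projections with left and
right nodes at once. -/
theorem affine_mem_uIcc (e z : ℝ) {s : ℝ} (hs : s ∈ Icc (0 : ℝ) 1) :
    e + (z - e) * s ∈ uIcc e z := by
  rcases le_total e z with h | h
  · rw [uIcc_of_le h]
    constructor <;> nlinarith [hs.1, hs.2]
  · rw [uIcc_of_ge h]
    constructor <;> nlinarith [hs.1, hs.2]

theorem exists_affine_of_mem_uIcc {e z y : ℝ} (h : e ≠ z) (hy : y ∈ uIcc e z) :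
    ∃ s ∈ Icc (0 : ℝ) 1, y = e + (z - e) * s ∧ (z - e)⁻¹ * (y - e) = s := by
  have h0 : z - e ≠ 0 := sub_ne_zero.2 h.symm
  refine ⟨(z - e)⁻¹ * (y - e), ?_, by field_simp; ring, rfl⟩
  rw [← div_eq_inv_mul]
  rcases lt_or_gt_of_ne h with h | h
  · rw [uIcc_of_le h.le] at hy
    have : 0 < z - e := sub_pos.2 h
    exact ⟨div_nonneg (by linarith [hy.1]) this.le, (div_le_one this).2 (by linarith [hy.2])⟩
  · rw [uIcc_of_ge h.le] at hy
    have : z - e < 0 := sub_neg.2 h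
    exact ⟨div_nonneg_of_nonpos (by linarith [hy.2]) this.le,
      (div_le_one_of_neg this).2 (by linarith [hy.1])⟩

theorem continuousOn_affine {e z : ℝ} {g : ℝ → ℝ} (hg : ContinuousOn g (uIcc e z)) :
    ContinuousOn (fun s => g (e + (z - e) * s)) (Icc 0 1) :=
  hg.comp (by fun_prop) fun _ hs => affine_mem_uIcc e z hs

theorem integral_affine (e z : ℝ) (F : ℝ → ℝ) :
    ∫ y in e..z, F y = (z - e) * ∫ s in (0 : ℝ)..1, F (e + (z - e) * s) := by
  have := intervalIntegral.smul_integral_comp_add_mul F (z - e) e (a := 0) (b := 1)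
  simp only [smul_eq_mul, mul_zero, add_zero, mul_one, add_sub_cancel] at this
  exact this.symm

theorem radauOn_eval {e z : ℝ} (k : ℕ) (g : ℝ → ℝ) (y : ℝ) :
    (radauOn k e z g).eval y
      = (radauRef k fun s => g (e + (z - e) * s)).eval ((z - e)⁻¹ * (y - e)) := by
  simp [radauOn]

theorem radauOn_natDegree_le (k : ℕ) (e z : ℝ) (g : ℝ → ℝ) : (radauOn k e z g).natDegree ≤ k := by
  refine natDegree_comp_le.trans ?_
  refine (Nat.mul_le_mul (radauRef_natDegree_le k _)
    ((natDegree_C_mul_le _ _).trans (natDegree_X_sub_C e).le)).trans (by simp)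

theorem radauOn_eval_node {e z : ℝ} (h : e ≠ z) (k : ℕ) (g : ℝ → ℝ) :
    (radauOn k e z g).eval z = g z := by
  have h0 : z - e ≠ 0 := sub_ne_zero.2 h.symm
  rw [radauOn_eval, inv_mul_cancel₀ h0, radauRef_eval_one]
  simp

theorem radauOn_linear {e z : ℝ} {g₁ g₂ : ℝ → ℝ} (h₁ : ContinuousOn g₁ (uIcc e z))
    (h₂ : ContinuousOn g₂ (uIcc e z)) (k : ℕ) (c₁ c₂ y : ℝ) :
    (radauOn k e z fun y => c₁ * g₁ y + c₂ * g₂ y).eval y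
      = c₁ * (radauOn k e z g₁).eval y + c₂ * (radauOn k e z g₂).eval y := by
  simp only [radauOn_eval]
  rw [radauRef_linear (continuousOn_affine h₁) (continuousOn_affine h₂)]
  simp

theorem radauRef_congr {g₁ g₂ : ℝ → ℝ} (h : EqOn g₁ g₂ (Icc 0 1)) (k : ℕ) :
    radauRef k g₁ = radauRef k g₂ := by
  refine Finset.sum_congr rfl fun i _ => ?_
  congr 2
  unfold radauFunctional
  split_ifs
  · exact h (by simp)
  · refine intervalIntegral.integral_congr fun y hy => ?_
    rw [uIcc_of_le zero_le_one] at hy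
    simp only [h hy]

theorem radauOn_congr {e z : ℝ} {g₁ g₂ : ℝ → ℝ} (h : EqOn g₁ g₂ (uIcc e z)) (k : ℕ) :
    radauOn k e z g₁ = radauOn k e z g₂ := by
  rw [radauOn, radauOn, radauRef_congr fun s hs => h (affine_mem_uIcc e z hs)]

theorem radauOn_polynomial {e z : ℝ} (h : e ≠ z) {k : ℕ} {p : ℝ[X]} (hp : p.natDegree ≤ k) :
    radauOn k e z (fun y => p.eval y) = p := by
  have h0 : z - e ≠ 0 := sub_ne_zero.2 h.symm
  have h1 : (fun s => p.eval (e + (z - e) * s))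
      = fun s => (p.comp (C e + C (z - e) * X)).eval s := by
    ext s
    simp
  have h2 : (C e + C (z - e) * X).comp (C (z - e)⁻¹ * (X - C e)) = X := by
    simp only [add_comp, C_comp, mul_comp, X_comp]
    rw [← mul_assoc, ← C_mul, mul_inv_cancel₀ h0]
    simp
  rw [radauOn, h1, radauRef_polynomial, comp_assoc, h2, comp_X]
  · refine natDegree_comp_le.trans ((Nat.mul_le_mul hp ?_).trans (mul_one k).le)
    compute_degree

/-- The error is orthogonal to polynomials of degree below `k`; derivatives of discrete functions
are exactly the test functions met in the bilinear form. -/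
theorem radauOn_orthogonal {e z : ℝ} {g : ℝ → ℝ} (hg : ContinuousOn g (uIcc e z))
    {k : ℕ} {p : ℝ[X]} (hp : p.natDegree ≤ k) :
    ∫ y in e..z, (g y - (radauOn k e z g).eval y) * (derivative p).eval y = 0 := by
  rcases eq_or_ne e z with rfl | h
  · simp
  have h0 : z - e ≠ 0 := sub_ne_zero.2 h.symm
  rw [integral_affine]
  simp only [radauOn_eval, add_sub_cancel_left, inv_mul_cancel_left₀ h0]
  have := radauRef_orthogonal (continuousOn_affine hg) k
    ((derivative p).comp (C e + C (z - e) * X)) fun i hi => by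
      -- For `k = 0` the derivative is zero, whereas the truncated `k - 1` would only give degree at
      -- most `0`.
      rcases Nat.eq_zero_or_pos k with rfl | hk
      · have : p.natDegree = 0 := by omega
        rw [natDegree_eq_zero] at this
        obtain ⟨c, rfl⟩ := this
        simp
      · refine coeff_eq_zero_of_natDegree_lt (lt_of_le_of_lt ?_ (lt_of_lt_of_le (?_ : k - 1 < k) hi))
        · refine natDegree_comp_le.trans ((Nat.mul_le_mul ((natDegree_derivative_le p).trans
            (Nat.sub_le_sub_right hp 1)) ?_).trans (mul_one _).le)
          compute_degree
        · omega
  simp only [eval_comp, eval_add, eval_mul, eval_C, eval_X] at this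
  rw [this, mul_zero]

/-! ### Stability, approximation and inverse estimates on one interval -/

theorem sq_integral_abs_le {g : ℝ → ℝ} (hg : ContinuousOn g (Icc 0 1)) :
    (∫ y in (0 : ℝ)..1, |g y|) ^ 2 ≤ ∫ y in (0 : ℝ)..1, g y ^ 2 := by
  set m := ∫ y in (0 : ℝ)..1, |g y| with hm
  rw [← uIcc_of_le (zero_le_one' ℝ)] at hg
  have h1 : IntervalIntegrable (fun y => |g y|) MeasureTheory.volume 0 1 :=
    hg.abs.intervalIntegrable
  have h2 : IntervalIntegrable (fun y => g y ^ 2) MeasureTheory.volume 0 1 :=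
    (hg.pow 2).intervalIntegrable
  -- Jensen's inequality, read off from `(|g| - m)² ≥ 0`.
  have h : 0 ≤ ∫ y in (0 : ℝ)..1, (g y ^ 2 - 2 * m * |g y| + m ^ 2) := by
    refine intervalIntegral.integral_nonneg zero_le_one fun y _ => ?_
    nlinarith [sq_nonneg (|g y| - m), sq_abs (g y)]
  rw [intervalIntegral.integral_add (h2.sub (h1.const_mul _)) intervalIntegrable_const,
    intervalIntegral.integral_sub h2 (h1.const_mul _), intervalIntegral.integral_const_mul,
    ← hm] at h
  simp only [intervalIntegral.integral_const, sub_zero, smul_eq_mul, one_mul] at h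
  nlinarith

/-- The stability constant of the Gauss–Radau projection. -/
def radauConst (k : ℕ) : ℝ := (radauRef_bound k).choose

theorem radauConst_nonneg (k : ℕ) : 0 ≤ radauConst k := (radauRef_bound k).choose_spec.1

theorem radauOn_stable {e z : ℝ} (h : e ≠ z) {g : ℝ → ℝ} (hg : ContinuousOn g (uIcc e z))
    (k : ℕ) {y : ℝ} (hy : y ∈ uIcc e z) :
    |(radauOn k e z g).eval y|
      ≤ radauConst k * (|g z| + ∫ s in (0 : ℝ)..1, |g (e + (z - e) * s)|) := by
  obtain ⟨s, hs, -, hys⟩ := exists_affine_of_mem_uIcc h hy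
  rw [radauOn_eval, hys]
  have := (radauRef_bound k).choose_spec.2 _ (continuousOn_affine hg) s hs
  rwa [mul_one, add_sub_cancel] at this

theorem radauOn_error_le_sup {e z : ℝ} (h : e ≠ z) {g : ℝ → ℝ} (hg : ContinuousOn g (uIcc e z))
    (k : ℕ) {A : ℝ} (hA : ∀ y ∈ uIcc e z, |g y| ≤ A) {y : ℝ} (hy : y ∈ uIcc e z) :
    |g y - (radauOn k e z g).eval y| ≤ (1 + 2 * radauConst k) * A := by
  have h1 : ∫ s in (0 : ℝ)..1, |g (e + (z - e) * s)| ≤ A := by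
    have : ∫ s in (0 : ℝ)..1, |g (e + (z - e) * s)| ≤ ∫ s in (0 : ℝ)..1, A := by
      refine intervalIntegral.integral_mono_on zero_le_one ?_ intervalIntegrable_const
        fun s hs => hA _ (affine_mem_uIcc e z hs)
      refine ContinuousOn.intervalIntegrable ?_
      rw [uIcc_of_le zero_le_one]
      exact (continuousOn_affine hg).abs
    simpa using this
  have h2 := radauOn_stable h hg k hy
  have h3 := mul_le_mul_of_nonneg_left (add_le_add (hA z right_mem_uIcc) h1) (radauConst_nonneg k)
  have h4 := abs_sub (g y) ((radauOn k e z g).eval y)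
  linarith [hA y hy]

/-- The node is the left end `c`, where the monotone majorant `W` is smallest. Hence the nodal value
satisfies `(d - c) W(c)² ≤ ∫ W²`, and the projection is as good as `L²`-stable with respect to `W`.
A node at `d` would not allow this. -/
theorem integral_radauOn_error_sq_le {c d : ℝ} (h : c < d) {g W : ℝ → ℝ}
    (hg : ContinuousOn g (Icc c d)) (hW : ContinuousOn W (Icc c d)) (hmono : MonotoneOn W (Icc c d))
    (hgW : ∀ y ∈ Icc c d, |g y| ≤ W y) (k : ℕ) :
    ∫ y in c..d, (g y - (radauOn k d c g).eval y) ^ 2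
      ≤ (2 + 8 * radauConst k ^ 2) * ∫ y in c..d, W y ^ 2 := by
  set B := radauConst k
  have hB : 0 ≤ B := radauConst_nonneg k
  have hu : uIcc d c = Icc c d := uIcc_of_ge h.le
  have hu' : uIcc c d = Icc c d := uIcc_of_le h.le
  have hg' : ContinuousOn g (uIcc d c) := by rwa [hu]
  have hcW : (0 : ℝ) ≤ W c := (abs_nonneg _).trans (hgW c (left_mem_Icc.2 h.le))
  have hWi : IntervalIntegrable (fun y => W y ^ 2) MeasureTheory.volume c d :=
    ContinuousOn.intervalIntegrable (by rw [hu']; exact hW.pow 2)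
  have hgi : IntervalIntegrable (fun y => g y ^ 2) MeasureTheory.volume c d :=
    ContinuousOn.intervalIntegrable (by rw [hu']; exact hg.pow 2)
  have hgW2 : ∀ y ∈ Icc c d, g y ^ 2 ≤ W y ^ 2 := fun y hy => by
    rw [← sq_abs]
    exact pow_le_pow_left₀ (abs_nonneg _) (hgW y hy) 2
  set J := ∫ s in (0 : ℝ)..1, |g (d + (c - d) * s)|
  have hJ : 0 ≤ J := intervalIntegral.integral_nonneg zero_le_one fun _ _ => abs_nonneg _
  have hIW : ∫ y in c..d, g y ^ 2 ≤ ∫ y in c..d, W y ^ 2 :=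
    intervalIntegral.integral_mono_on h.le hgi hWi hgW2
  have hJ2 : (d - c) * J ^ 2 ≤ ∫ y in c..d, W y ^ 2 := by
    refine le_trans ?_ hIW
    rw [intervalIntegral.integral_symm, integral_affine d c]
    have := sq_integral_abs_le (continuousOn_affine hg')
    nlinarith
  have hc2 : (d - c) * W c ^ 2 ≤ ∫ y in c..d, W y ^ 2 := by
    have : ∫ y in c..d, W c ^ 2 ≤ ∫ y in c..d, W y ^ 2 := by
      refine intervalIntegral.integral_mono_on h.le intervalIntegrable_const hWi fun y hy => ?_
      exact pow_le_pow_left₀ hcW (hmono (left_mem_Icc.2 h.le) hy hy.1) 2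
    simpa using this
  have hpt : ∀ y ∈ Icc c d, (g y - (radauOn k d c g).eval y) ^ 2
      ≤ 2 * W y ^ 2 + 4 * B ^ 2 * (W c ^ 2 + J ^ 2) := by
    intro y hy
    have h1 := radauOn_stable h.ne' hg' k (hu.symm ▸ hy)
    have h2 : |(radauOn k d c g).eval y| ≤ B * (W c + J) :=
      h1.trans (mul_le_mul_of_nonneg_left
        (add_le_add (hgW c (left_mem_Icc.2 h.le)) le_rfl) hB)
    have h3 : (radauOn k d c g).eval y ^ 2 ≤ B ^ 2 * (W c + J) ^ 2 := by
      rw [← sq_abs, ← mul_pow]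
      exact pow_le_pow_left₀ (abs_nonneg _) h2 2
    nlinarith [hgW2 y hy, sq_nonneg (g y + (radauOn k d c g).eval y),
      mul_nonneg (sq_nonneg B) (sq_nonneg (W c - J))]
  have hmain : ∫ y in c..d, (g y - (radauOn k d c g).eval y) ^ 2
      ≤ ∫ y in c..d, (2 * W y ^ 2 + 4 * B ^ 2 * (W c ^ 2 + J ^ 2)) := by
    refine intervalIntegral.integral_mono_on h.le (ContinuousOn.intervalIntegrable ?_)
      ((hWi.const_mul 2).add intervalIntegrable_const) hpt
    rw [hu']
    exact (hg.sub (Polynomial.continuous _).continuousOn).pow 2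
  rw [intervalIntegral.integral_add (hWi.const_mul 2) intervalIntegrable_const,
    intervalIntegral.integral_const_mul, intervalIntegral.integral_const, smul_eq_mul] at hmain
  nlinarith [mul_nonneg (sq_nonneg B) (sub_nonneg.2 hJ2), mul_nonneg (sq_nonneg B) (sub_nonneg.2 hc2)]

/-- Taylor's theorem on an element uses derivatives within that element, while the hypotheses bound
derivatives within `[0,1]`. -/
theorem iteratedDerivWithin_mono_set {n : ℕ} {f : ℝ → ℝ} {s t : Set ℝ} (hst : s ⊆ t)
    (hs : UniqueDiffOn ℝ s) (ht : UniqueDiffOn ℝ t) (hf : ContDiffOn ℝ n f t) {x : ℝ}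
    (hx : x ∈ s) : iteratedDerivWithin n f s x = iteratedDerivWithin n f t x := by
  rw [iteratedDerivWithin_eq_iteratedFDerivWithin, iteratedDerivWithin_eq_iteratedFDerivWithin,
    iteratedFDerivWithin_subset hst hs ht hf hx]

theorem exists_taylor_polynomial {c d : ℝ} (h : c < d) (hcd : Icc c d ⊆ Icc 0 1) {k : ℕ}
    {g : ℝ → ℝ} (hg : ContDiffOn ℝ (k + 1) g (Icc 0 1)) {A : ℝ}
    (hA : ∀ y ∈ Icc c d, |iteratedDerivWithin (k + 1) g (Icc 0 1) y| ≤ A) :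
    ∃ p : ℝ[X], p.natDegree ≤ k ∧ ∀ y ∈ Icc c d, |g y - p.eval y| ≤ (d - c) ^ (k + 1) * A := by
  refine ⟨∑ i ∈ Finset.range (k + 1),
    C ((i.factorial : ℝ)⁻¹ * iteratedDerivWithin i g (Icc c d) c) * (X - C c) ^ i, ?_, ?_⟩
  · refine natDegree_sum_le_of_forall_le _ _ fun i hi => ?_
    refine (natDegree_C_mul_le _ _).trans (natDegree_pow_le.trans ?_)
    rw [natDegree_X_sub_C, mul_one]
    exact Nat.lt_succ_iff.1 (Finset.mem_range.1 hi)
  · intro y hy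
    have hA0 : 0 ≤ A := (abs_nonneg _).trans (hA y hy)
    have hu := uniqueDiffOn_Icc h
    have hb := taylor_mean_remainder_bound h.le (n := k) (C := A) (f := g)
      (by exact_mod_cast hg.mono hcd) hy (fun z hz => by
        rw [iteratedDerivWithin_mono_set hcd hu (uniqueDiffOn_Icc zero_lt_one)
          (by exact_mod_cast hg) hz]
        exact hA z hz)
    rw [Real.norm_eq_abs, taylor_within_apply] at hb
    have he : (∑ i ∈ Finset.range (k + 1),
        C ((i.factorial : ℝ)⁻¹ * iteratedDerivWithin i g (Icc c d) c) * (X - C c) ^ i).eval y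
        = ∑ i ∈ Finset.range (k + 1),
          ((i.factorial : ℝ)⁻¹ * (y - c) ^ i) • iteratedDerivWithin i g (Icc c d) c := by
      simp only [eval_finsetSum, eval_mul, eval_C, eval_pow, eval_sub, eval_X, smul_eq_mul]
      exact Finset.sum_congr rfl fun i _ => by ring
    rw [he]
    refine hb.trans ?_
    have h1 : (y - c) ^ (k + 1) ≤ (d - c) ^ (k + 1) :=
      pow_le_pow_left₀ (by linarith [hy.1]) (by linarith [hy.2]) _
    have h2 : (1 : ℝ) ≤ (k.factorial : ℝ) := by exact_mod_cast k.factorial_pos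
    refine (div_le_self (mul_nonneg hA0 (pow_nonneg (by linarith [hy.1]) _)) h2).trans ?_
    rw [mul_comm]
    exact mul_le_mul_of_nonneg_right h1 hA0

/-- The projection reproduces the Taylor polynomial, so it only acts on the Taylor remainder, where
stability in the maximum norm applies. -/
theorem radauOn_error_le {e z : ℝ} (h : e ≠ z) (hcd : uIcc e z ⊆ Icc 0 1) {k : ℕ}
    {g : ℝ → ℝ} (hg : ContDiffOn ℝ (k + 1) g (Icc 0 1)) {A : ℝ}
    (hA : ∀ y ∈ uIcc e z, |iteratedDerivWithin (k + 1) g (Icc 0 1) y| ≤ A) {y : ℝ}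
    (hy : y ∈ uIcc e z) :
    |g y - (radauOn k e z g).eval y| ≤ (1 + 2 * radauConst k) * (|z - e| ^ (k + 1) * A) := by
  have hlt : min e z < max e z := min_lt_max.2 h
  obtain ⟨p, hp, hb⟩ := exists_taylor_polynomial hlt hcd hg hA
  have hgc : ContinuousOn g (uIcc e z) := hg.continuousOn.mono hcd
  have hpc : ContinuousOn (fun y => p.eval y) (uIcc e z) := p.continuous.continuousOn
  rw [max_sub_min_eq_abs] at hb
  have h1 := radauOn_error_le_sup h (hgc.sub hpc) k hb hy
  have h2 := radauOn_linear hgc hpc k 1 (-1) y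
  rw [radauOn_polynomial h hp] at h2
  have h3 : (fun y => 1 * g y + -1 * p.eval y) = fun y => g y - p.eval y := by ext; ring
  rw [h3] at h2
  simp only [Pi.sub_def] at h1
  rw [h2] at h1
  convert h1 using 2
  ring

theorem polynomial_derivative_bound (k : ℕ) : ∃ B : ℝ, 0 ≤ B ∧ ∀ (c d : ℝ) (p : ℝ[X]), c < d →
    p.natDegree ≤ k →
      (d - c) ^ 2 * ∫ y in c..d, (derivative p).eval y ^ 2 ≤ B * ∫ y in c..d, p.eval y ^ 2 := by
  obtain ⟨B, hB, hB'⟩ := derivative_bound_ref k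
  refine ⟨B ^ 2, sq_nonneg _, fun c d p hcd hp => ?_⟩
  have h0 : 0 < d - c := sub_pos.2 hcd
  set q := p.comp (C c + C (d - c) * X) with hq
  have hqd : q.natDegree ≤ k := natDegree_comp_le.trans ((Nat.mul_le_mul hp
    (by compute_degree : _ ≤ 1)).trans (mul_one k).le)
  have hqe : ∀ s, q.eval s = p.eval (c + (d - c) * s) := fun s => by simp [hq]
  have hde : ∀ s, (derivative q).eval s = (d - c) * (derivative p).eval (c + (d - c) * s) := by
    intro s
    simp [hq, derivative_comp]
  rw [integral_affine c d, integral_affine c d]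
  have h1 : ∫ s in (0 : ℝ)..1, (derivative q).eval s ^ 2
      ≤ B ^ 2 * ∫ s in (0 : ℝ)..1, q.eval s ^ 2 := by
    have h2 : ∫ s in (0 : ℝ)..1, (derivative q).eval s ^ 2
        ≤ ∫ s in (0 : ℝ)..1, (B * ∫ y in (0 : ℝ)..1, |q.eval y|) ^ 2 := by
      refine intervalIntegral.integral_mono_on zero_le_one
        (Continuous.intervalIntegrable (by fun_prop) _ _) intervalIntegrable_const fun s hs => ?_
      rw [← sq_abs]
      exact pow_le_pow_left₀ (abs_nonneg _) (hB' q hqd s hs) 2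
    rw [intervalIntegral.integral_const, sub_zero, one_smul, mul_pow] at h2
    exact h2.trans (mul_le_mul_of_nonneg_left
      (sq_integral_abs_le q.continuous.continuousOn) (sq_nonneg _))
  simp only [hde, hqe, mul_pow, intervalIntegral.integral_const_mul] at h1
  nlinarith

/-! ### Layer-adapted meshes -/

/-- The layer weight `exp (-ω (1 - y))`. -/
def layerWeight (ω y : ℝ) : ℝ := Real.exp (-(ω * (1 - y)))

/-- The properties of a mesh of `[0,1]` on which the interpolation errors of a boundary layer of
width `ω⁻¹` at `1` are controlled by powers of `δ`. -/
structure LayerMesh (x : ℕ → ℝ) (N : ℕ) (ω δ C₀ : ℝ) : Prop where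
  delta_pos : 0 < δ
  delta_le_one : δ ≤ 1
  left : x 0 = 0
  right : x N = 1
  lt : ∀ j ∈ Finset.Icc 1 N, x (j - 1) < x j
  width : ∀ j ∈ Finset.Icc 1 N, x j - x (j - 1) ≤ C₀ * δ
  incr : ∀ j ∈ Finset.Icc 1 N, layerWeight ω (x j) - layerWeight ω (x (j - 1)) ≤ δ

namespace LayerMesh

variable {x : ℕ → ℝ} {N : ℕ} {ω δ C₀ : ℝ}

theorem mem_Icc (h : LayerMesh x N ω δ C₀) {j : ℕ} (hj : j ≤ N) : x j ∈ Icc (0 : ℝ) 1 := by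
  have hmono : ∀ i j, i ≤ j → j ≤ N → x i ≤ x j := by
    intro i j hij
    induction j, hij using Nat.le_induction with
    | base => exact fun _ => le_rfl
    | succ j hij ih =>
      intro hj
      exact (ih (by omega)).trans (h.lt (j + 1) (Finset.mem_Icc.2 ⟨by omega, hj⟩)).le
  exact ⟨h.left ▸ hmono 0 j (Nat.zero_le _) hj, h.right ▸ hmono j N hj le_rfl⟩

theorem Icc_subset (h : LayerMesh x N ω δ C₀) {j : ℕ} (hj : j ∈ Finset.Icc 1 N) :
    Icc (x (j - 1)) (x j) ⊆ Icc 0 1 := by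
  rw [Finset.mem_Icc] at hj
  exact Icc_subset_Icc (h.mem_Icc (j := j - 1) (by omega)).1 (h.mem_Icc hj.2).2

theorem sum_telescope (F : ℕ → ℝ) (N : ℕ) :
    ∑ j ∈ Finset.Icc 1 N, (F j - F (j - 1)) = F N - F 0 := by
  induction N with
  | zero => simp
  | succ n ih =>
    rw [Finset.sum_Icc_succ_top (by omega), ih]
    simp

theorem const_nonneg (h : LayerMesh x N ω δ C₀) (hN : 1 ≤ N) : 0 ≤ C₀ := by
  have h1 := h.lt 1 (Finset.mem_Icc.2 ⟨le_rfl, hN⟩)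
  have h2 := h.width 1 (Finset.mem_Icc.2 ⟨le_rfl, hN⟩)
  have h3 := h.delta_pos
  by_contra! hC
  nlinarith

end LayerMesh

theorem layerWeight_pos (ω y : ℝ) : 0 < layerWeight ω y := Real.exp_pos _

theorem layerWeight_le_one {ω y : ℝ} (hω : 0 ≤ ω) (hy : y ≤ 1) : layerWeight ω y ≤ 1 := by
  rw [layerWeight, Real.exp_le_one_iff]
  nlinarith

theorem layerWeight_mono {ω : ℝ} (hω : 0 ≤ ω) : Monotone (layerWeight ω) := by
  intro y z hyz
  rw [layerWeight, layerWeight, Real.exp_le_exp]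
  nlinarith

namespace IsMeshGenerating

variable {φ : ℝ → ℝ}

theorem strictMonoOn (h : IsMeshGenerating φ) : StrictMonoOn φ (Icc 0 (1 / 2)) := by
  refine strictMonoOn_of_deriv_pos (convex_Icc _ _) h.contDiffOn.continuousOn fun t ht => ?_
  rw [← derivWithin_of_mem_nhds (mem_interior_iff_mem_nhds.1 ht)]
  exact h.deriv_pos t (interior_subset ht)

theorem abs_derivWithin_le_maxPsi' (h : IsMeshGenerating φ) {t : ℝ} (ht : t ∈ Icc (0 : ℝ) (1 / 2)) :
    |derivWithin (meshPsi φ) (Icc 0 (1 / 2)) t| ≤ maxPsi' φ := by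
  have hψ : ContDiffOn ℝ 2 (meshPsi φ) (Icc 0 (1 / 2)) := h.contDiffOn.neg.exp
  have hc : ContinuousOn (fun t => |derivWithin (meshPsi φ) (Icc 0 (1 / 2)) t|) (Icc 0 (1 / 2)) :=
    (hψ.continuousOn_derivWithin (uniqueDiffOn_Icc (by norm_num)) (by norm_num)).abs
  exact le_csSup (isCompact_Icc.image_of_continuousOn hc).bddAbove (mem_image_of_mem _ ht)

/-- On the fine part of the mesh the layer weight takes the values of `ψ`, so this bounds its
increment over an element by `N⁻¹ max|ψ'|`. -/
theorem meshPsi_sub_le (h : IsMeshGenerating φ) {s t : ℝ} (hs : s ∈ Icc (0 : ℝ) (1 / 2))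
    (ht : t ∈ Icc (0 : ℝ) (1 / 2)) : meshPsi φ s - meshPsi φ t ≤ maxPsi' φ * |s - t| := by
  have hψ : ContDiffOn ℝ 2 (meshPsi φ) (Icc 0 (1 / 2)) := h.contDiffOn.neg.exp
  refine (le_abs_self _).trans ?_
  exact (convex_Icc (0 : ℝ) (1 / 2)).norm_image_sub_le_of_norm_derivWithin_le
    (hψ.differentiableOn (by norm_num)) (fun t ht => h.abs_derivWithin_le_maxPsi' ht) ht hs

/-- `ψ` falls from `1` to at most `1/2` over a length of `1/2`, so its slope reaches `1`.
Consequently `N⁻¹ ≤ N⁻¹ max|ψ'|`, and coarse mesh widths are admissible. -/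
theorem one_le_maxPsi' (h : IsMeshGenerating φ) {n : ℝ} (hn : 2 ≤ n)
    (hφ : Real.log n ≤ φ (1 / 2)) : 1 ≤ maxPsi' φ := by
  have h1 := h.meshPsi_sub_le (s := 0) (t := 1 / 2) (by norm_num) (by norm_num)
  have h2 : meshPsi φ (1 / 2) ≤ 1 / 2 := by
    have : meshPsi φ (1 / 2) ≤ Real.exp (-Real.log n) := Real.exp_le_exp.2 (neg_le_neg hφ)
    rw [Real.exp_neg, Real.exp_log (by linarith)] at this
    exact this.trans (by rw [one_div]; exact inv_anti₀ two_pos hn)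
  have h3 : meshPsi φ 0 = 1 := by simp [meshPsi, h.zero]
  rw [h3] at h1
  norm_num at h1
  linarith

end IsMeshGenerating

/-! ### Verification of the layer conditions for Shishkin and Bakhvalov type meshes -/

section MeshPt

variable {σ ε α : ℝ} {φ : ℝ → ℝ} {N : ℕ}

theorem meshPt_of_two_mul_le (hτ : σ * ε / α * φ (1 / 2) ≤ 1 / 2) (hN : 0 < N) {i : ℕ}
    (hi : 2 * i ≤ N) :
    meshPt σ ε α φ N i = 2 * (1 - σ * ε / α * φ (1 / 2)) * ((i : ℝ) / N) := by
  have hN' : (0 : ℝ) < N := by exact_mod_cast hN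
  have : (i : ℝ) / N ≤ 1 / 2 := by
    rw [div_le_iff₀ hN']
    have : (2 : ℝ) * i ≤ N := by exact_mod_cast hi
    linarith
  rw [meshPt, if_pos this, meshTau, min_eq_right hτ]

theorem meshPt_of_le_two_mul (hτ : σ * ε / α * φ (1 / 2) ≤ 1 / 2) (hN : 0 < N) {i : ℕ}
    (hi : N ≤ 2 * i) :
    meshPt σ ε α φ N i = 1 - σ * ε / α * φ (1 - (i : ℝ) / N) := by
  have hN' : (0 : ℝ) < N := by exact_mod_cast hN
  have h1 : (1 : ℝ) / 2 ≤ (i : ℝ) / N := by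
    rw [le_div_iff₀ hN']
    have : (N : ℝ) ≤ 2 * i := by exact_mod_cast hi
    linarith
  -- At `i = N/2` the definition selects the coarse branch; both formulas give `1 - τ` there.
  rcases h1.eq_or_lt with h | h
  · rw [meshPt, ← h, if_pos le_rfl, meshTau, min_eq_right hτ,
      show (1 : ℝ) - 1 / 2 = 1 / 2 by norm_num]
    ring
  · rw [meshPt, if_neg (not_le.2 h)]

/-- With `ω = α/(σε)` the weight undoes the logarithmic mesh map, so at the fine mesh points it
equals `ψ`. -/
theorem layerWeight_meshPt (hσ : 0 < σ) (hε : 0 < ε) (hα : 0 < α) (r : ℝ) :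
    layerWeight (α / (σ * ε)) (1 - σ * ε / α * r) = Real.exp (-r) := by
  rw [layerWeight]
  congr 2
  field_simp
  ring

/-- Shishkin and Bakhvalov type meshes are layer-adapted. -/
theorem layerMesh_meshPt (hσ : 0 < σ) (hα : 0 < α) (hN : 2 ≤ N) (hNe : Even N) (hε : 0 < ε)
    (hεN : ε ≤ (N : ℝ)⁻¹) (hφ : IsMeshGenerating φ)
    (hφN : φ (1 / 2) = Real.log N ∨ φ (1 / 2) = Real.log (1 / ε))
    (hτ : σ * ε / α * φ (1 / 2) ≤ 1 / 2) :
    LayerMesh (meshPt σ ε α φ N) N (α / (σ * ε)) (min 1 ((N : ℝ)⁻¹ * maxPsi' φ))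
      (2 + 2 * σ / α) := by
  have hN2 : (2 : ℝ) ≤ N := by exact_mod_cast hN
  have hN0 : (0 : ℝ) < N := by linarith
  have hNpos : 0 < N := by omega
  have hNε : (N : ℝ) ≤ 1 / ε := by
    rw [le_div_iff₀ hε]
    calc (N : ℝ) * ε ≤ N * (N : ℝ)⁻¹ := by gcongr
      _ = 1 := mul_inv_cancel₀ hN0.ne'
  have hlow : Real.log N ≤ φ (1 / 2) := by
    rcases hφN with h | h
    · exact h.ge
    · exact h ▸ Real.log_le_log hN0 hNε
  have hupp : φ (1 / 2) ≤ Real.log (1 / ε) := by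
    rcases hφN with h | h
    · exact h ▸ Real.log_le_log hN0 hNε
    · exact h.le
  have hmax := hφ.one_le_maxPsi' hN2 hlow
  have hNinv : (N : ℝ)⁻¹ ≤ 1 := inv_le_one_of_one_le₀ (by linarith)
  set δ' := (N : ℝ)⁻¹ * maxPsi' φ with hδ'
  have hNδ' : (N : ℝ)⁻¹ ≤ δ' := le_mul_of_one_le_right (inv_nonneg.2 hN0.le) hmax
  have hNδ : (N : ℝ)⁻¹ ≤ min 1 δ' := le_min hNinv hNδ'
  have hδ0 : 0 < min 1 δ' := (inv_pos.2 hN0).trans_le hNδ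
  have hω : 0 < α / (σ * ε) := by positivity
  have hφ12 : 0 < φ (1 / 2) := by
    have := hφ.strictMonoOn (by norm_num) (by norm_num) (show (0 : ℝ) < 1 / 2 by norm_num)
    rwa [hφ.zero] at this
  have hσα : 0 < σ / α := by positivity
  set c := σ * ε / α with hc
  have hc0 : 0 < c := by positivity
  have hcε : c = σ / α * ε := by rw [hc]; ring
  have hC₀ : 2 + 2 * σ / α = 2 + 2 * (σ / α) := by ring
  -- the two kinds of elements
  have hcase : ∀ j ∈ Finset.Icc 1 N,
      (2 * j ≤ N ∧ 2 * (j - 1) ≤ N) ∨ (N ≤ 2 * j ∧ N ≤ 2 * (j - 1)) := by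
    intro j hj
    rw [Finset.mem_Icc] at hj
    obtain ⟨n, hn⟩ := hNe
    omega
  have ht : ∀ i : ℕ, i ≤ N → N ≤ 2 * i → 1 - (i : ℝ) / N ∈ Icc (0 : ℝ) (1 / 2) := by
    intro i hi hi2
    have h1 : (i : ℝ) ≤ N := by exact_mod_cast hi
    have h2 : (N : ℝ) ≤ 2 * i := by exact_mod_cast hi2
    have h3 : (i : ℝ) / N ≤ 1 := (div_le_one hN0).2 h1
    have h4 : (1 : ℝ) / 2 ≤ (i : ℝ) / N := by
      rw [le_div_iff₀ hN0]; linarith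
    constructor <;> linarith
  -- The argument `1 - i/N` decreases in `i`, so the right end of the element belongs to the smaller
  -- parameter `s`.
  have hfine : ∀ j ∈ Finset.Icc 1 N, N ≤ 2 * j → N ≤ 2 * (j - 1) →
      ∃ s ∈ Icc (0 : ℝ) (1 / 2), ∃ t ∈ Icc (0 : ℝ) (1 / 2), s < t ∧ |s - t| = (N : ℝ)⁻¹ ∧
        meshPt σ ε α φ N j = 1 - c * φ s ∧ meshPt σ ε α φ N (j - 1) = 1 - c * φ t := by
    intro j hj h1 h2
    have hj' := Finset.mem_Icc.1 hj
    have hcast : ((j - 1 : ℕ) : ℝ) = j - 1 := by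
      rw [Nat.cast_sub hj'.1, Nat.cast_one]
    have hinv : 0 < (N : ℝ)⁻¹ := inv_pos.2 hN0
    have hdiff : 1 - (j : ℝ) / N - (1 - ((j - 1 : ℕ) : ℝ) / N) = -(N : ℝ)⁻¹ := by
      rw [hcast]
      field_simp
      ring
    refine ⟨_, ht j hj'.2 h1, _, ht (j - 1) (by omega) h2, by linarith, ?_,
      meshPt_of_le_two_mul hτ hNpos h1, meshPt_of_le_two_mul hτ hNpos h2⟩
    rw [hdiff, abs_neg, abs_of_pos hinv]
  refine ⟨hδ0, min_le_left _ _, ?_, ?_, ?_, ?_, ?_⟩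
  · rw [meshPt_of_two_mul_le hτ hNpos (by omega)]
    simp
  · rw [meshPt_of_le_two_mul hτ hNpos (by omega), div_self hN0.ne', sub_self, hφ.zero]
    simp
  · intro j hj
    rcases hcase j hj with ⟨h1, h2⟩ | ⟨h1, h2⟩
    · rw [meshPt_of_two_mul_le hτ hNpos h1, meshPt_of_two_mul_le hτ hNpos h2]
      have : ((j - 1 : ℕ) : ℝ) < j := by
        have := (Finset.mem_Icc.1 hj).1
        exact_mod_cast (by omega : j - 1 < j)
      refine mul_lt_mul_of_pos_left ?_ (by linarith)
      gcongr
    · obtain ⟨s, hs, t, ht, hst, -, e1, e2⟩ := hfine j hj h1 h2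
      rw [e1, e2]
      have := mul_lt_mul_of_pos_left (hφ.strictMonoOn hs ht hst) hc0
      linarith
  · intro j hj
    have hσ2 : 0 ≤ 2 * (σ / α) := by positivity
    rw [hC₀]
    rcases hcase j hj with ⟨h1, h2⟩ | ⟨h1, h2⟩
    · rw [meshPt_of_two_mul_le hτ hNpos h1, meshPt_of_two_mul_le hτ hNpos h2]
      have hcast : ((j - 1 : ℕ) : ℝ) = j - 1 := by
        rw [Nat.cast_sub (Finset.mem_Icc.1 hj).1, Nat.cast_one]
      rw [hcast]
      have : 2 * (1 - c * φ (1 / 2)) * ((j : ℝ) / N)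
          - 2 * (1 - c * φ (1 / 2)) * (((j : ℝ) - 1) / N)
          = 2 * (1 - c * φ (1 / 2)) * (N : ℝ)⁻¹ := by
        field_simp
        ring
      rw [this]
      have h3 : 0 ≤ c * φ (1 / 2) := by positivity
      have h4 : 0 ≤ (N : ℝ)⁻¹ := by positivity
      nlinarith
    · obtain ⟨s, hs, t, ht, hst, hN', e1, e2⟩ := hfine j hj h1 h2
      rw [e1, e2]
      have hφst := hφ.strictMonoOn hs ht hst
      have hφt : φ t ≤ φ (1 / 2) := hφ.strictMonoOn.monotoneOn ht (by norm_num) ht.2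
      have hφs : 0 ≤ φ s := by
        have := hφ.strictMonoOn.monotoneOn (a := 0) (by norm_num) hs hs.1
        rwa [hφ.zero] at this
      have hψ := hφ.meshPsi_sub_le hs ht
      rw [hN', mul_comm, ← hδ', meshPsi, meshPsi] at hψ
      have hle1 : c * (φ t - φ s) ≤ 1 := by
        have h3 : c * (φ t - φ s) ≤ c * φ (1 / 2) := by
          gcongr
          linarith
        linarith
      -- If `ψ(s) ≤ 2δ'`, then `φ(t) - φ(s) ≤ ln(1/ε) + ln(2δ') ≤ 2δ'/ε`, and the factor `ε` in `c`
      -- cancels. Otherwise `ψ(s) - ψ(t) ≤ δ'` forces `ψ(s) < 2ψ(t)`, so `φ` grows by at most `1`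
      -- because `e > 2`, and the width is at most `c ≤ (σ/α) δ'`.
      have hleδ : c * (φ t - φ s) ≤ 2 * (σ / α) * δ' := by
        rcases le_or_gt (Real.exp (-φ s)) (2 * δ') with h | h
        · have hδ'0 : 0 < δ' := (inv_pos.2 hN0).trans_le hNδ'
          have h3 : -φ s ≤ Real.log (2 * δ') := (Real.le_log_iff_exp_le (by positivity)).2 h
          have h4 : φ t - φ s ≤ Real.log (1 / ε * (2 * δ')) := by
            rw [Real.log_mul (by positivity) (by positivity)]
            linarith
          have h5 : φ t - φ s ≤ 1 / ε * (2 * δ') := by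
            refine h4.trans ((Real.log_le_sub_one_of_pos (by positivity)).trans ?_)
            linarith
          calc c * (φ t - φ s) ≤ c * (1 / ε * (2 * δ')) := by gcongr
            _ = 2 * (σ / α) * δ' := by rw [hcε]; field_simp
        · have h3 : Real.exp (-φ s) ≤ 2 * Real.exp (-φ t) := by linarith
          have h4 : φ t - φ s ≤ 1 := by
            by_contra! h5
            have h6 : Real.exp (-φ t) * Real.exp 1 ≤ Real.exp (-φ s) := by
              rw [← Real.exp_add]
              exact Real.exp_le_exp.2 (by linarith)
            have h7 := Real.add_one_lt_exp (one_ne_zero (α := ℝ))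
            nlinarith [Real.exp_pos (-φ t)]
          have h5 : σ / α * ε ≤ σ / α * δ' := by
            gcongr
            exact hεN.trans hNδ'
          rw [← hcε] at h5
          nlinarith
      have : (1 - c * φ s) - (1 - c * φ t) = c * (φ t - φ s) := by ring
      rw [this, mul_min_of_nonneg _ _ (by positivity)]
      refine le_min (by linarith) (hleδ.trans ?_)
      have hδ'0 : 0 < δ' := (inv_pos.2 hN0).trans_le hNδ'
      gcongr
      linarith
  · intro j hj
    rcases hcase j hj with ⟨h1, h2⟩ | ⟨h1, h2⟩
    -- On the whole coarse part the weight itself is at most `ψ(1/2) ≤ N⁻¹`, so its increments need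
    -- no cancellation.
    · have h3 : meshPt σ ε α φ N j ≤ 1 - c * φ (1 / 2) := by
        rw [meshPt_of_two_mul_le hτ hNpos h1]
        have h4 : (j : ℝ) / N ≤ 1 / 2 := by
          rw [div_le_iff₀ hN0]
          have : (2 : ℝ) * j ≤ N := by exact_mod_cast h1
          linarith
        have h5 : 0 ≤ 1 - c * φ (1 / 2) := by linarith
        nlinarith
      have h4 := layerWeight_mono hω.le h3
      rw [layerWeight_meshPt hσ hε hα] at h4
      have h5 : Real.exp (-φ (1 / 2)) ≤ (N : ℝ)⁻¹ := by
        refine (Real.exp_le_exp.2 (neg_le_neg hlow)).trans ?_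
        rw [Real.exp_neg, Real.exp_log hN0]
      linarith [layerWeight_pos (α / (σ * ε)) (meshPt σ ε α φ N (j - 1))]
    · obtain ⟨s, hs, t, ht, hst, hN', e1, e2⟩ := hfine j hj h1 h2
      rw [e1, e2, layerWeight_meshPt hσ hε hα, layerWeight_meshPt hσ hε hα]
      refine le_min ?_ ?_
      · have : Real.exp (-φ s) ≤ 1 := by
          rw [Real.exp_le_one_iff]
          have := hφ.strictMonoOn.monotoneOn (a := 0) (by norm_num) hs hs.1
          rw [hφ.zero] at this
          linarith
        linarith [Real.exp_pos (-φ t)]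
      · have hψ := hφ.meshPsi_sub_le hs ht
        rwa [hN', mul_comm, ← hδ', meshPsi, meshPsi] at hψ

end MeshPt

/-! ### Functions with a boundary layer -/

/-- `g` is the sum of a function with bounded derivatives and a layer function on `[0,1]`. -/
def HasSplit (n : ℕ) (ε α κ₁ κ₂ : ℝ) (g : ℝ → ℝ) : Prop :=
  ∃ s e : ℝ → ℝ, ContDiffOn ℝ n s (Icc 0 1) ∧ ContDiffOn ℝ n e (Icc 0 1) ∧
    ∀ y ∈ Icc (0 : ℝ) 1, g y = s y + e y ∧ ∀ j ≤ n,
      |iteratedDerivWithin j s (Icc 0 1) y| ≤ κ₁ ∧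
      |iteratedDerivWithin j e (Icc 0 1) y| ≤ κ₂ * (ε ^ j)⁻¹ * Real.exp (-α * (1 - y) / ε)

namespace HasSplit

variable {n : ℕ} {ε α κ₁ κ₂ : ℝ} {g : ℝ → ℝ}

theorem contDiffOn (h : HasSplit n ε α κ₁ κ₂ g) : ContDiffOn ℝ n g (Icc 0 1) := by
  obtain ⟨s, e, hs, he, hb⟩ := h
  exact (hs.add he).congr fun y hy => (hb y hy).1

/-- The factor `ε` exactly compensates the extra `ε⁻¹` from differentiating the layer, and the
smooth part keeps it as a gain. That gain absorbs the factor `ε⁻¹` in the norm of the flux. -/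
theorem scaled_dx (h : HasSplit (n + 1) ε α κ₁ κ₂ g) (hε : 0 < ε) :
    HasSplit n ε α (ε * κ₁) κ₂ (fun y => ε * dx g y) := by
  obtain ⟨s, e, hs, he, hb⟩ := h
  have hu : UniqueDiffOn ℝ (Icc (0 : ℝ) 1) := uniqueDiffOn_Icc zero_lt_one
  have hd : ∀ f : ℝ → ℝ, ContDiffOn ℝ (n + 1 : ℕ) f (Icc 0 1) →
      ContDiffOn ℝ n (derivWithin f (Icc 0 1)) (Icc 0 1) := fun f hf =>
    hf.derivWithin hu (by norm_cast)
  have hit : ∀ f : ℝ → ℝ, ContDiffOn ℝ (n + 1 : ℕ) f (Icc 0 1) → ∀ j ≤ n, ∀ y ∈ Icc (0 : ℝ) 1,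
      iteratedDerivWithin j (fun y => ε * derivWithin f (Icc 0 1) y) (Icc 0 1) y
        = ε * iteratedDerivWithin (j + 1) f (Icc 0 1) y := by
    intro f hf j hj y hy
    rw [iteratedDerivWithin_succ']
    exact iteratedDerivWithin_const_mul hy hu ε
      (((hd f hf).of_le (by exact_mod_cast hj)).contDiffWithinAt hy)
  refine ⟨fun y => ε * derivWithin s (Icc 0 1) y, fun y => ε * derivWithin e (Icc 0 1) y,
    contDiffOn_const.mul (hd s hs), contDiffOn_const.mul (hd e he), fun y hy => ⟨?_, ?_⟩⟩
  · have h1 : dx g y = derivWithin (fun y => s y + e y) (Icc 0 1) y :=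
      derivWithin_congr (fun z hz => (hb z hz).1) (hb y hy).1
    beta_reduce
    rw [h1, derivWithin_fun_add (hs.differentiableOn (by simp) y hy)
      (he.differentiableOn (by simp) y hy), mul_add]
  · intro j hj
    obtain ⟨h1, h2⟩ := (hb y hy).2 (j + 1) (by omega)
    rw [hit s hs j hj y hy, hit e he j hj y hy, abs_mul, abs_mul, abs_of_pos hε]
    refine ⟨mul_le_mul_of_nonneg_left h1 hε.le, (mul_le_mul_of_nonneg_left h2 hε.le).trans ?_⟩
    rw [pow_succ, mul_inv]
    apply le_of_eq
    field_simp

end HasSplit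

/-- The exponential is `s^σ` with `s ≤ 1`. Used with `m = k + 2`: the first `k + 1` powers pay for
the rate, the last one for integrating over the layer. -/
theorem exp_le_layerWeight_pow {σ ε α y : ℝ} {m : ℕ} (hσ : (m : ℝ) ≤ σ) (hσ0 : 0 < σ)
    (hε : 0 < ε) (hα : 0 < α) (hy : y ≤ 1) :
    Real.exp (-α * (1 - y) / ε) ≤ layerWeight (α / (σ * ε)) y ^ m := by
  rw [layerWeight, ← Real.exp_nat_mul, Real.exp_le_exp]
  have h1 : -α * (1 - y) / ε = -(σ * (α / (σ * ε) * (1 - y))) := by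
    field_simp
  have h2 : 0 ≤ α / (σ * ε) * (1 - y) := mul_nonneg (by positivity) (by linarith)
  rw [h1]
  nlinarith

/-- `ρ s(d) ≤ C (s(d) - s(c))` for the layer weight `s` and `ρ = min 1 ((d - c)/ε)`. -/
theorem min_mul_layerWeight_le {σ ε α c d : ℝ} (hσ : 0 < σ) (hε : 0 < ε) (hα : 0 < α)
    (h : c ≤ d) :
    min 1 ((d - c) / ε) * layerWeight (α / (σ * ε)) d
      ≤ 2 * (1 + σ / α) * (layerWeight (α / (σ * ε)) d - layerWeight (α / (σ * ε)) c) := by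
  set ω := α / (σ * ε) with hω
  have hω0 : 0 < ω := by positivity
  set D := ω * (d - c) with hD
  have hD0 : 0 ≤ D := mul_nonneg hω0.le (by linarith)
  have hc : layerWeight ω c = layerWeight ω d * Real.exp (-D) := by
    rw [layerWeight, layerWeight, ← Real.exp_add]
    congr 1
    rw [hD]
    ring
  have hexp : Real.exp (-D) ≤ (1 + D)⁻¹ := by
    rw [Real.exp_neg]
    exact inv_anti₀ (by linarith) (by linarith [Real.add_one_le_exp D])
  have hq : (d - c) / ε = σ / α * D := by
    rw [hD, hω]
    field_simp
  have hr : 0 < σ / α := by positivity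
  -- By `1 - e^(-D) ≥ D/(1 + D)` it suffices that `min(1, (σ/α) D)(1 + D) ≤ 2(1 + σ/α) D`: use `1 +
  -- D ≤ 2` for `D ≤ 1` and `1 + D ≤ 2D` for `D ≥ 1`.
  have key : min 1 ((d - c) / ε) ≤ 2 * (1 + σ / α) * (1 - Real.exp (-D)) := by
    have h1 : 1 - (1 + D)⁻¹ = D / (1 + D) := by field_simp; ring
    have h2 : D / (1 + D) ≤ 1 - Real.exp (-D) := by linarith
    refine le_trans ?_ (mul_le_mul_of_nonneg_left h2 (by positivity))
    rw [mul_div_assoc', le_div_iff₀ (by linarith), hq]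
    rcases le_total D 1 with hD1 | hD1
    · have h3 : min 1 (σ / α * D) ≤ σ / α * D := min_le_right _ _
      nlinarith [mul_nonneg hr.le hD0]
    · have h3 : min 1 (σ / α * D) ≤ 1 := min_le_left _ _
      nlinarith [mul_nonneg hr.le hD0]
  rw [hc]
  have := mul_le_mul_of_nonneg_right key (layerWeight_pos ω d).le
  linarith

/-- `s²/(2ω)` is an antiderivative of `s²`. With `ω = α/(σε)` the bound is of order `ε`, which
compensates the `ε⁻¹` in front of the flux norm. -/
theorem integral_layerWeight_sq_le {ω : ℝ} (hω : 0 < ω) :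
    ∫ y in (0 : ℝ)..1, layerWeight ω y ^ 2 ≤ (2 * ω)⁻¹ := by
  have hd : ∀ y ∈ uIcc (0 : ℝ) 1,
      HasDerivAt (fun y => (2 * ω)⁻¹ * layerWeight ω y ^ 2) (layerWeight ω y ^ 2) y := by
    intro y _
    have h1 : HasDerivAt (fun y : ℝ => -(ω * (1 - y))) ω y := by
      have := (((hasDerivAt_id y).const_sub 1).const_mul ω).fun_neg
      simpa using this
    have h2 := ((h1.exp.pow 2).const_mul (2 * ω)⁻¹)
    refine h2.congr_deriv ?_
    simp only [layerWeight]
    field_simp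
    norm_num
  have hc : Continuous fun y => layerWeight ω y ^ 2 := by
    unfold layerWeight
    fun_prop
  rw [intervalIntegral.integral_eq_sub_of_hasDerivAt hd (hc.intervalIntegrable _ _)]
  have h1 : layerWeight ω 1 = 1 := by simp [layerWeight]
  have h2 : 0 ≤ (2 * ω)⁻¹ := by positivity
  rw [h1]
  nlinarith [sq_nonneg (layerWeight ω 0)]

/-! ### Interpolation on one element -/

section Element

variable {k : ℕ} {ε α σ κ₁ κ₂ c d : ℝ} {g : ℝ → ℝ}

/-- The constant in the pointwise interpolation bound for layer functions. -/
def layerConst (σ α : ℝ) : ℝ := 2 * (1 + σ / α)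

/-- The layer weight associated with the mesh parameters. -/
abbrev wt (σ ε α : ℝ) : ℝ → ℝ := layerWeight (α / (σ * ε))

/-- Stability gives the bound with the factor `1`, Taylor expansion the one with `((d -
c)/ε)^(k+1)`; the minimum covers both. The last factor of the weight is kept apart because the `L²`
estimate needs it. -/
theorem layer_radauOn_error_le (hσ : (k : ℝ) + 2 ≤ σ) (hε : 0 < ε) (hα : 0 < α)
    (hsub : Icc c d ⊆ Icc 0 1) {e : ℝ → ℝ} (hκ : 0 ≤ κ₂)
    (he : ContDiffOn ℝ (k + 1 : ℕ) e (Icc 0 1))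
    (hb : ∀ y ∈ Icc (0 : ℝ) 1, ∀ j ≤ k + 1, |iteratedDerivWithin j e (Icc 0 1) y|
      ≤ κ₂ * (ε ^ j)⁻¹ * Real.exp (-α * (1 - y) / ε)) {p z : ℝ} (hpz : p ≠ z)
    (hu : uIcc p z = Icc c d) (hl : |z - p| = d - c) {y : ℝ} (hy : y ∈ Icc c d) :
    |e y - (radauOn k p z e).eval y| ≤ (1 + 2 * radauConst k) *
      (κ₂ * (min 1 ((d - c) / ε) * wt σ ε α d) ^ (k + 1) * wt σ ε α d) := by
  have hσ0 : 0 < σ := by linarith [Nat.cast_nonneg (α := ℝ) k]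
  have hω : 0 < α / (σ * ε) := by positivity
  have hB : 0 ≤ 1 + 2 * radauConst k := by linarith [radauConst_nonneg k]
  have hw : ∀ z ∈ Icc c d, Real.exp (-α * (1 - z) / ε) ≤ wt σ ε α d ^ (k + 2) := by
    intro z hz
    refine (exp_le_layerWeight_pow (m := k + 2) (by push_cast; exact hσ) hσ0 hε hα
      (hsub hz).2).trans ?_
    exact pow_le_pow_left₀ (layerWeight_pos _ _).le (layerWeight_mono hω.le hz.2) _
  have hw0 : 0 < wt σ ε α d := layerWeight_pos _ _
  have h1 : |e y - (radauOn k p z e).eval y| ≤ (1 + 2 * radauConst k) *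
      (κ₂ * wt σ ε α d ^ (k + 2)) := by
    refine radauOn_error_le_sup hpz (he.continuousOn.mono (hu ▸ hsub)) k (fun z hz => ?_)
      (hu.symm ▸ hy)
    rw [hu] at hz
    have := hb z (hsub hz) 0 (by omega)
    simp only [iteratedDerivWithin_zero, pow_zero, inv_one, mul_one] at this
    exact this.trans (mul_le_mul_of_nonneg_left (hw z hz) hκ)
  have h2 : |e y - (radauOn k p z e).eval y| ≤ (1 + 2 * radauConst k) *
      ((d - c) ^ (k + 1) * (κ₂ * (ε ^ (k + 1))⁻¹ * wt σ ε α d ^ (k + 2))) := by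
    rw [← hl]
    refine radauOn_error_le hpz (hu ▸ hsub) (by exact_mod_cast he) (fun z hz => ?_) (hu.symm ▸ hy)
    rw [hu] at hz
    exact (hb z (hsub hz) (k + 1) le_rfl).trans
      (mul_le_mul_of_nonneg_left (hw z hz) (by positivity))
  rcases le_total 1 ((d - c) / ε) with h | h
  · rw [min_eq_left h]
    refine h1.trans (le_of_eq ?_)
    ring
  · rw [min_eq_right h]
    refine h2.trans (le_of_eq ?_)
    rw [mul_pow, div_pow]
    ring

theorem HasSplit.const_nonneg {n : ℕ} (h : HasSplit n ε α κ₁ κ₂ g) : 0 ≤ κ₁ ∧ 0 ≤ κ₂ := by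
  obtain ⟨s, e, -, -, hb⟩ := h
  obtain ⟨h1, h2⟩ := (hb 0 (by simp)).2 0 (Nat.zero_le _)
  refine ⟨(abs_nonneg _).trans h1, ?_⟩
  rw [pow_zero, inv_one, mul_one] at h2
  exact nonneg_of_mul_nonneg_left ((abs_nonneg _).trans h2) (Real.exp_pos _)

theorem HasSplit.radauOn_error_le (hg : HasSplit (k + 1) ε α κ₁ κ₂ g) (hσ : (k : ℝ) + 2 ≤ σ)
    (hε : 0 < ε) (hα : 0 < α) (hcd : c < d) (hsub : Icc c d ⊆ Icc 0 1)
    {p z : ℝ} (hpz : p ≠ z) (hu : uIcc p z = Icc c d) (hl : |z - p| = d - c) {y : ℝ}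
    (hy : y ∈ Icc c d) :
    |g y - (radauOn k p z g).eval y| ≤ (1 + 2 * radauConst k) *
      ((d - c) ^ (k + 1) * κ₁
        + κ₂ * (layerConst σ α * (wt σ ε α d - wt σ ε α c)) ^ (k + 1)) := by
  obtain ⟨-, hκ₂⟩ := hg.const_nonneg
  obtain ⟨s, e, hs, he, hb⟩ := hg
  have hσ0 : 0 < σ := by linarith [Nat.cast_nonneg (α := ℝ) k]
  have hω : 0 < α / (σ * ε) := by positivity
  have hB : 0 ≤ 1 + 2 * radauConst k := by linarith [radauConst_nonneg k]
  have h1 := LDG.radauOn_error_le hpz (hu ▸ hsub) (k := k) (g := s) (by exact_mod_cast hs)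
    (A := κ₁) (fun z hz => ((hb z (hsub (hu ▸ hz))).2 (k + 1) le_rfl).1) (hu.symm ▸ hy)
  have h2 := layer_radauOn_error_le hσ hε hα hsub hκ₂ he
    (fun y hy j hj => ((hb y hy).2 j hj).2) hpz hu hl hy
  have h3 := radauOn_linear (e := p) (z := z) (hs.continuousOn.mono (hu ▸ hsub))
    (he.continuousOn.mono (hu ▸ hsub)) k 1 1 y
  simp only [one_mul] at h3
  have h4 : radauOn k p z g = radauOn k p z fun y => s y + e y :=
    radauOn_congr (fun y hy => (hb y (hsub (hu ▸ hy))).1) k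
  rw [h4, h3, (hb y (hsub hy)).1]
  have h5 := min_mul_layerWeight_le hσ0 hε hα hcd.le
  have h6 : 0 ≤ min 1 ((d - c) / ε) :=
    le_min zero_le_one (div_nonneg (by linarith) hε.le)
  have hw0 : 0 < wt σ ε α d := layerWeight_pos _ _
  have hw1 : wt σ ε α d ≤ 1 := layerWeight_le_one hω.le (hsub (right_mem_Icc.2 hcd.le)).2
  -- In the maximum norm the spare factor of the weight is dropped, and the rest becomes an
  -- increment of the weight.
  have h7 : (min 1 ((d - c) / ε) * wt σ ε α d) ^ (k + 1) * wt σ ε α d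
      ≤ (layerConst σ α * (wt σ ε α d - wt σ ε α c)) ^ (k + 1) := by
    refine (mul_le_of_le_one_right (by positivity) hw1).trans ?_
    exact pow_le_pow_left₀ (by positivity) h5 _
  have h8 := mul_le_mul_of_nonneg_left h7 hκ₂
  rw [← mul_assoc] at h8
  have h9 := mul_le_mul_of_nonneg_left h8 hB
  rw [hl] at h1
  have h10 : s y + e y - ((radauOn k p z s).eval y + (radauOn k p z e).eval y)
      = (s y - (radauOn k p z s).eval y) + (e y - (radauOn k p z e).eval y) := by ring
  rw [h10, mul_add]
  exact (abs_add_le _ _).trans (add_le_add h1 (h2.trans h9))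

/-- The constant in the `L²` interpolation bound for the flux. -/
def fluxConst (k : ℕ) (σ α : ℝ) : ℝ :=
  (2 + 8 * radauConst k ^ 2) + ((1 + 2 * radauConst k) * Real.exp (α / σ)) ^ 2

/-- The spare power of the weight survives as `∫ s²`. On a long element, `d - c ≥ ε`, the weight is
a monotone majorant and the left node gives `L²` stability; on a short one, the weight varies at
most by the factor `e^(α/σ)`, so the pointwise bound can be integrated. -/
theorem integral_layer_error_sq_le (hσ : (k : ℝ) + 2 ≤ σ) (hε : 0 < ε) (hα : 0 < α)
    (hcd : c < d) (hsub : Icc c d ⊆ Icc 0 1) {e : ℝ → ℝ} (hκ : 0 ≤ κ₂)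
    (he : ContDiffOn ℝ (k + 1 : ℕ) e (Icc 0 1))
    (hb : ∀ y ∈ Icc (0 : ℝ) 1, ∀ j ≤ k + 1, |iteratedDerivWithin j e (Icc 0 1) y|
      ≤ κ₂ * (ε ^ j)⁻¹ * Real.exp (-α * (1 - y) / ε)) {δ : ℝ}
    (hδ : wt σ ε α d - wt σ ε α c ≤ δ) :
    ∫ y in c..d, (e y - (radauOn k d c e).eval y) ^ 2
      ≤ fluxConst k σ α * (κ₂ * (layerConst σ α * δ) ^ (k + 1)) ^ 2 *
        ∫ y in c..d, wt σ ε α y ^ 2 := by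
  have hσ0 : 0 < σ := by linarith [Nat.cast_nonneg (α := ℝ) k]
  have hω : 0 < α / (σ * ε) := by positivity
  have hB : 0 ≤ 1 + 2 * radauConst k := by linarith [radauConst_nonneg k]
  have hρ := min_mul_layerWeight_le hσ0 hε hα hcd.le
  have hL : 0 < layerConst σ α := by unfold layerConst; positivity
  have hρδ : min 1 ((d - c) / ε) * wt σ ε α d ≤ layerConst σ α * δ :=
    hρ.trans (mul_le_mul_of_nonneg_left hδ hL.le)
  have hρ0 : 0 ≤ min 1 ((d - c) / ε) := le_min zero_le_one (div_nonneg (by linarith) hε.le)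
  have hw0 : ∀ y, 0 < wt σ ε α y := fun y => layerWeight_pos _ _
  have hwc : Continuous (wt σ ε α) := by
    unfold wt layerWeight
    fun_prop
  have hwi : IntervalIntegrable (fun y => wt σ ε α y ^ 2) MeasureTheory.volume c d :=
    (hwc.pow 2).intervalIntegrable _ _
  have hI : 0 ≤ ∫ y in c..d, wt σ ε α y ^ 2 :=
    intervalIntegral.integral_nonneg hcd.le fun _ _ => by positivity
  have hec : ContinuousOn e (Icc c d) := he.continuousOn.mono hsub
  set P := κ₂ * (layerConst σ α * δ) ^ (k + 1) with hP
  have hρw : (min 1 ((d - c) / ε) * wt σ ε α d) ^ (k + 1) ≤ (layerConst σ α * δ) ^ (k + 1) :=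
    pow_le_pow_left₀ (mul_nonneg hρ0 (hw0 d).le) hρδ _
  have hP0 : 0 ≤ P := mul_nonneg hκ ((pow_nonneg (mul_nonneg hρ0 (hw0 d).le) _).trans hρw)
  have hfin : ∀ A : ℝ, A ≤ fluxConst k σ α →
      A * (P ^ 2 * ∫ y in c..d, wt σ ε α y ^ 2)
        ≤ fluxConst k σ α * P ^ 2 * ∫ y in c..d, wt σ ε α y ^ 2 := by
    intro A hA
    rw [mul_assoc]
    exact mul_le_mul_of_nonneg_right hA (mul_nonneg (sq_nonneg _) hI)
  rcases le_total 1 ((d - c) / ε) with h | h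
  · rw [min_eq_left h, one_mul] at hρw
    have h1 := integral_radauOn_error_sq_le hcd hec (W := fun y => κ₂ * wt σ ε α y ^ (k + 2))
      (by fun_prop)
      (fun y _ z _ hyz => mul_le_mul_of_nonneg_left
        (pow_le_pow_left₀ (hw0 y).le (layerWeight_mono hω.le hyz) _) hκ)
      (fun y hy => by
        have := hb y (hsub hy) 0 (by omega)
        simp only [iteratedDerivWithin_zero, pow_zero, inv_one, mul_one] at this
        exact this.trans (mul_le_mul_of_nonneg_left (exp_le_layerWeight_pow (m := k + 2)
          (by push_cast; exact hσ) hσ0 hε hα (hsub hy).2) hκ)) k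
    refine h1.trans (le_trans ?_ (hfin (2 + 8 * radauConst k ^ 2) (by
      unfold fluxConst
      linarith [sq_nonneg ((1 + 2 * radauConst k) * Real.exp (α / σ))])))
    refine mul_le_mul_of_nonneg_left ?_ (by positivity)
    rw [← intervalIntegral.integral_const_mul]
    refine intervalIntegral.integral_mono_on hcd.le
      (Continuous.intervalIntegrable (by fun_prop) _ _) (hwi.const_mul _) fun y hy => ?_
    rw [← mul_pow]
    refine pow_le_pow_left₀ (mul_nonneg hκ (pow_nonneg (hw0 y).le _)) ?_ 2
    rw [pow_succ, ← mul_assoc, hP]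
    refine mul_le_mul_of_nonneg_right (mul_le_mul_of_nonneg_left ?_ hκ) (hw0 y).le
    exact (pow_le_pow_left₀ (hw0 y).le (layerWeight_mono hω.le hy.2) _).trans hρw
  · have hdw : ∀ y ∈ Icc c d, wt σ ε α d ≤ Real.exp (α / σ) * wt σ ε α y := by
      intro y hy
      unfold wt layerWeight
      rw [← Real.exp_add, Real.exp_le_exp]
      have h1 : α / (σ * ε) * (d - y) ≤ α / (σ * ε) * ε := by
        gcongr
        rw [div_le_one hε] at h
        linarith [hy.1]
      have h2 : α / (σ * ε) * ε = α / σ := by field_simp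
      linarith
    refine le_trans ?_ (hfin (((1 + 2 * radauConst k) * Real.exp (α / σ)) ^ 2) (by
      unfold fluxConst
      linarith [sq_nonneg (radauConst k)]))
    rw [← mul_assoc, ← intervalIntegral.integral_const_mul]
    refine intervalIntegral.integral_mono_on hcd.le (ContinuousOn.intervalIntegrable ?_)
      (hwi.const_mul _) fun y hy => ?_
    · rw [uIcc_of_le hcd.le]
      exact (hec.sub (Polynomial.continuous _).continuousOn).pow 2
    rw [← mul_pow, ← mul_pow, ← sq_abs]
    refine pow_le_pow_left₀ (abs_nonneg _) ?_ 2
    refine (layer_radauOn_error_le hσ hε hα hsub hκ he hb hcd.ne' (uIcc_of_ge hcd.le)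
      (by rw [abs_sub_comm, abs_of_pos (sub_pos.2 hcd)]) hy).trans ?_
    have h3 : κ₂ * (min 1 ((d - c) / ε) * wt σ ε α d) ^ (k + 1) * wt σ ε α d
        ≤ P * (Real.exp (α / σ) * wt σ ε α y) :=
      mul_le_mul (mul_le_mul_of_nonneg_left hρw hκ) (hdw y hy) (hw0 d).le hP0
    refine (mul_le_mul_of_nonneg_left h3 hB).trans (le_of_eq ?_)
    ring

end Element

/-! ### Interpolation on layer-adapted meshes -/

/-- The elementwise Gauss–Radau projection with nodes at the right end points. -/
def radauR (x : ℕ → ℝ) (k : ℕ) (g : ℝ → ℝ) : Broken :=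
  fun j y => (radauOn k (x (j - 1)) (x j) g).eval y

/-- The elementwise Gauss–Radau projection with nodes at the left end points. -/
def radauL (x : ℕ → ℝ) (k : ℕ) (g : ℝ → ℝ) : Broken :=
  fun j y => (radauOn k (x j) (x (j - 1)) g).eval y

theorem isDiscrete_radauR (x : ℕ → ℝ) (N k : ℕ) (g : ℝ → ℝ) : IsDiscrete N k (radauR x k g) :=
  fun _ _ => ⟨_, radauOn_natDegree_le _ _ _ _, fun _ => rfl⟩

theorem isDiscrete_radauL (x : ℕ → ℝ) (N k : ℕ) (g : ℝ → ℝ) : IsDiscrete N k (radauL x k g) :=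
  fun _ _ => ⟨_, radauOn_natDegree_le _ _ _ _, fun _ => rfl⟩

/-- The constant in the pointwise interpolation bounds. -/
def interpConst (k : ℕ) (σ α C₀ : ℝ) : ℝ :=
  (1 + 2 * radauConst k) * (C₀ + layerConst σ α + 1) ^ (k + 1)

section Interp

variable {k N : ℕ} {σ α ε δ C₀ κ κ₁ κ₂ : ℝ} {x : ℕ → ℝ} {g : ℝ → ℝ}

theorem layerConst_nonneg (hσ : (k : ℝ) + 2 ≤ σ) (hα : 0 < α) : 0 ≤ layerConst σ α := by
  have hσ0 : 0 < σ := by linarith [Nat.cast_nonneg (α := ℝ) k]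
  unfold layerConst
  positivity

/-- Pointwise interpolation error on an element, in terms of `h_j` and the increment of the
layer weight. -/
theorem LayerMesh.interp_local (hx : LayerMesh x N (α / (σ * ε)) δ C₀) (hσ : (k : ℝ) + 2 ≤ σ)
    (hα : 0 < α) (hε : 0 < ε) (hg : HasSplit (k + 1) ε α κ₁ κ₂ g) (h₁ : κ₁ ≤ κ) (h₂ : κ₂ ≤ κ)
    {j : ℕ} (hj : j ∈ Finset.Icc 1 N) {y : ℝ} (hy : y ∈ Icc (x (j - 1)) (x j)) :
    |g y - radauR x k g j y| ≤ (1 + 2 * radauConst k) * (κ * ((x j - x (j - 1)) ^ (k + 1)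
        + (layerConst σ α * (wt σ ε α (x j) - wt σ ε α (x (j - 1)))) ^ (k + 1))) ∧
    |g y - radauL x k g j y| ≤ (1 + 2 * radauConst k) * (κ * ((x j - x (j - 1)) ^ (k + 1)
        + (layerConst σ α * (wt σ ε α (x j) - wt σ ε α (x (j - 1)))) ^ (k + 1))) := by
  have hlt := hx.lt j hj
  have hσ0 : 0 < σ := by linarith [Nat.cast_nonneg (α := ℝ) k]
  have hω : 0 < α / (σ * ε) := by positivity
  have hB : 0 ≤ 1 + 2 * radauConst k := by linarith [radauConst_nonneg k]
  have hL := layerConst_nonneg hσ hα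
  have hinc : 0 ≤ wt σ ε α (x j) - wt σ ε α (x (j - 1)) :=
    sub_nonneg.2 (layerWeight_mono hω.le hlt.le)
  have hh : 0 ≤ x j - x (j - 1) := by linarith
  have hle : (1 + 2 * radauConst k) * ((x j - x (j - 1)) ^ (k + 1) * κ₁
      + κ₂ * (layerConst σ α * (wt σ ε α (x j) - wt σ ε α (x (j - 1)))) ^ (k + 1))
      ≤ (1 + 2 * radauConst k) * (κ * ((x j - x (j - 1)) ^ (k + 1)
        + (layerConst σ α * (wt σ ε α (x j) - wt σ ε α (x (j - 1)))) ^ (k + 1))) := by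
    refine mul_le_mul_of_nonneg_left ?_ hB
    rw [mul_add, mul_comm _ κ₁]
    exact add_le_add (mul_le_mul_of_nonneg_right h₁ (by positivity))
      (mul_le_mul_of_nonneg_right h₂ (by positivity))
  exact ⟨(hg.radauOn_error_le hσ hε hα hlt (hx.Icc_subset hj) hlt.ne (uIcc_of_le hlt.le)
      (abs_of_pos (sub_pos.2 hlt)) hy).trans hle,
    (hg.radauOn_error_le hσ hε hα hlt (hx.Icc_subset hj) hlt.ne' (uIcc_of_ge hlt.le)
      (by rw [abs_sub_comm, abs_of_pos (sub_pos.2 hlt)]) hy).trans hle⟩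

theorem LayerMesh.interp_sup (hx : LayerMesh x N (α / (σ * ε)) δ C₀) (hσ : (k : ℝ) + 2 ≤ σ)
    (hα : 0 < α) (hε : 0 < ε) (hg : HasSplit (k + 1) ε α κ₁ κ₂ g) (h₁ : κ₁ ≤ κ) (h₂ : κ₂ ≤ κ)
    {j : ℕ} (hj : j ∈ Finset.Icc 1 N) {y : ℝ} (hy : y ∈ Icc (x (j - 1)) (x j)) :
    |g y - radauR x k g j y| ≤ 2 * interpConst k σ α C₀ * κ * δ ^ (k + 1) ∧
    |g y - radauL x k g j y| ≤ 2 * interpConst k σ α C₀ * κ * δ ^ (k + 1) := by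
  have hlt := hx.lt j hj
  have hσ0 : 0 < σ := by linarith [Nat.cast_nonneg (α := ℝ) k]
  have hω : 0 < α / (σ * ε) := by positivity
  have hB : 0 ≤ 1 + 2 * radauConst k := by linarith [radauConst_nonneg k]
  have hL := layerConst_nonneg hσ hα
  have hN : 1 ≤ N := (Finset.mem_Icc.1 hj).1.trans (Finset.mem_Icc.1 hj).2
  have hC₀ := hx.const_nonneg hN
  have hδ := hx.delta_pos
  have hκ : 0 ≤ κ := hg.const_nonneg.1.trans h₁
  have hinc : 0 ≤ wt σ ε α (x j) - wt σ ε α (x (j - 1)) :=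
    sub_nonneg.2 (layerWeight_mono hω.le hlt.le)
  have e1 : (x j - x (j - 1)) ^ (k + 1) ≤ ((C₀ + layerConst σ α + 1) * δ) ^ (k + 1) := by
    refine pow_le_pow_left₀ (by linarith) ((hx.width j hj).trans ?_) _
    gcongr
    linarith
  have e2 : (layerConst σ α * (wt σ ε α (x j) - wt σ ε α (x (j - 1)))) ^ (k + 1)
      ≤ ((C₀ + layerConst σ α + 1) * δ) ^ (k + 1) := by
    refine pow_le_pow_left₀ (by positivity)
      ((mul_le_mul_of_nonneg_left (hx.incr j hj) hL).trans ?_) _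
    gcongr
    linarith
  have hle : (1 + 2 * radauConst k) * (κ * ((x j - x (j - 1)) ^ (k + 1)
        + (layerConst σ α * (wt σ ε α (x j) - wt σ ε α (x (j - 1)))) ^ (k + 1)))
      ≤ 2 * interpConst k σ α C₀ * κ * δ ^ (k + 1) := by
    refine (mul_le_mul_of_nonneg_left (mul_le_mul_of_nonneg_left (add_le_add e1 e2) hκ) hB).trans
      (le_of_eq ?_)
    rw [interpConst, mul_pow]
    ring
  have h := hx.interp_local hσ hα hε hg h₁ h₂ hj hy
  exact ⟨h.1.trans hle, h.2.trans hle⟩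

/-- Each squared error is of the form `t^(2k+2)` with `t ≤ P δ`. All powers but one are bounded by
`P δ`, and the remaining `t`, a width or a multiple of an increment of the weight, telescopes over
the mesh. This avoids a factor `N`. -/
theorem LayerMesh.interp_jump (hx : LayerMesh x N (α / (σ * ε)) δ C₀) (hσ : (k : ℝ) + 2 ≤ σ)
    (hα : 0 < α) (hε : 0 < ε) (hg : HasSplit (k + 1) ε α κ₁ κ₂ g) (h₁ : κ₁ ≤ κ) (h₂ : κ₂ ≤ κ) :
    ∑ j ∈ Finset.Icc 1 N, (g (x (j - 1)) - radauR x k g j (x (j - 1))) ^ 2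
      ≤ 4 * interpConst k σ α C₀ ^ 2 * κ ^ 2 * δ ^ (2 * k + 1) := by
  rcases Nat.eq_zero_or_pos N with rfl | hN
  · have := hx.delta_pos
    simp
    positivity
  have hσ0 : 0 < σ := by linarith [Nat.cast_nonneg (α := ℝ) k]
  have hω : 0 < α / (σ * ε) := by positivity
  have hB : 0 ≤ 1 + 2 * radauConst k := by linarith [radauConst_nonneg k]
  have hL := layerConst_nonneg hσ hα
  have hC₀ := hx.const_nonneg hN
  have hδ := hx.delta_pos
  have hκ : 0 ≤ κ := hg.const_nonneg.1.trans h₁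
  set B := 1 + 2 * radauConst k
  set P := C₀ + layerConst σ α + 1 with hP
  have hP1 : 1 ≤ P := by linarith
  -- One factor `t` is left over for the summation.
  have hpow : ∀ t : ℝ, 0 ≤ t → t ≤ P * δ → (t ^ (k + 1)) ^ 2 ≤ (P * δ) ^ (2 * k + 1) * t := by
    intro t ht0 ht
    rw [← pow_mul, show (k + 1) * 2 = (2 * k + 1) + 1 by ring, pow_succ]
    exact mul_le_mul_of_nonneg_right (pow_le_pow_left₀ ht0 ht _) ht0
  have hterm : ∀ j ∈ Finset.Icc 1 N, (g (x (j - 1)) - radauR x k g j (x (j - 1))) ^ 2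
      ≤ 2 * B ^ 2 * κ ^ 2 * (P * δ) ^ (2 * k + 1) * ((x j - x (j - 1))
        + layerConst σ α * (wt σ ε α (x j) - wt σ ε α (x (j - 1)))) := by
    intro j hj
    have hlt := hx.lt j hj
    have hinc : 0 ≤ wt σ ε α (x j) - wt σ ε α (x (j - 1)) :=
      sub_nonneg.2 (layerWeight_mono hω.le hlt.le)
    have h := (hx.interp_local hσ hα hε hg h₁ h₂ hj (left_mem_Icc.2 hlt.le)).1
    set t₁ := x j - x (j - 1) with ht₁
    set t₂ := layerConst σ α * (wt σ ε α (x j) - wt σ ε α (x (j - 1)))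
    have ht1 : 0 ≤ t₁ := by linarith
    have ht2 : 0 ≤ t₂ := mul_nonneg hL hinc
    have h1 := hpow t₁ ht1 ((hx.width j hj).trans (by gcongr; linarith))
    have h2 := hpow t₂ ht2 ((mul_le_mul_of_nonneg_left (hx.incr j hj) hL).trans
      (by gcongr; linarith))
    rw [← sq_abs]
    refine (pow_le_pow_left₀ (abs_nonneg _) h 2).trans ?_
    have h3 : (t₁ ^ (k + 1) + t₂ ^ (k + 1)) ^ 2 ≤ 2 * ((P * δ) ^ (2 * k + 1) * (t₁ + t₂)) := by
      nlinarith [sq_nonneg (t₁ ^ (k + 1) - t₂ ^ (k + 1))]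
    have h4 := mul_le_mul_of_nonneg_left h3 (mul_nonneg (sq_nonneg B) (sq_nonneg κ))
    refine le_trans (le_of_eq ?_) (h4.trans (le_of_eq ?_)) <;> ring
  refine (Finset.sum_le_sum hterm).trans ?_
  rw [← Finset.mul_sum, Finset.sum_add_distrib, ← Finset.mul_sum,
    LayerMesh.sum_telescope (fun j => x j), LayerMesh.sum_telescope (fun j => wt σ ε α (x j)),
    hx.left, hx.right]
  have hw1 : wt σ ε α 1 ≤ 1 := layerWeight_le_one hω.le le_rfl
  have hw0 : 0 < wt σ ε α 0 := layerWeight_pos _ _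
  have hS : 1 - 0 + layerConst σ α * (wt σ ε α 1 - wt σ ε α 0) ≤ P := by
    nlinarith
  calc _ ≤ 2 * B ^ 2 * κ ^ 2 * (P * δ) ^ (2 * k + 1) * P := by gcongr
    _ = 2 * (interpConst k σ α C₀ ^ 2 * κ ^ 2 * δ ^ (2 * k + 1)) := by
      rw [interpConst, mul_pow, mul_pow, ← pow_mul, show (k + 1) * 2 = 2 * k + 1 + 1 by ring,
        pow_succ P]
      ring
    _ ≤ _ := by
      have : 0 ≤ interpConst k σ α C₀ ^ 2 * κ ^ 2 * δ ^ (2 * k + 1) := by positivity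
      linarith

/-- The constant in the interpolation bound for the flux. -/
def fluxInterpConst (k : ℕ) (σ α C₀ : ℝ) : ℝ :=
  2 * (interpConst k σ α C₀ ^ 2 + fluxConst k σ α * layerConst σ α ^ (2 * k + 2) * (σ / (2 * α)))

/-- The smooth part carries a factor `ε`, hence `ε²` in the square. The layer part is integrated
against `s²`, which gives `ε`. Either way the prefactor `ε⁻¹` is absorbed and the full order
`δ^(2k+2)` remains. -/
theorem LayerMesh.interp_flux (hx : LayerMesh x N (α / (σ * ε)) δ C₀) (hσ : (k : ℝ) + 2 ≤ σ)
    (hα : 0 < α) (hε : 0 < ε) (hε1 : ε ≤ 1) (hg : HasSplit (k + 1) ε α (ε * κ) κ g) :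
    ε⁻¹ * ∑ j ∈ Finset.Icc 1 N, ∫ y in (x (j - 1))..(x j), (g y - radauL x k g j y) ^ 2
      ≤ fluxInterpConst k σ α C₀ * κ ^ 2 * δ ^ (2 * k + 2) := by
  have hδ := hx.delta_pos
  have hσ0 : 0 < σ := by linarith [Nat.cast_nonneg (α := ℝ) k]
  have hω : 0 < α / (σ * ε) := by positivity
  have hB : 0 ≤ 1 + 2 * radauConst k := by linarith [radauConst_nonneg k]
  have hL := layerConst_nonneg hσ hα
  have hF : 0 ≤ fluxConst k σ α := by unfold fluxConst; positivity
  rcases Nat.eq_zero_or_pos N with rfl | hN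
  · simp only [Finset.Icc_eq_empty_of_lt zero_lt_one, Finset.sum_empty, mul_zero]
    unfold fluxInterpConst
    positivity
  have hC₀ := hx.const_nonneg hN
  have hκ := hg.const_nonneg.2
  obtain ⟨s, e, hs, he, hb⟩ := hg
  set P := C₀ + layerConst σ α + 1 with hP
  set B := 1 + 2 * radauConst k with hBd
  have hwc : Continuous fun y => wt σ ε α y ^ 2 := by
    unfold wt layerWeight
    fun_prop
  have hterm : ∀ j ∈ Finset.Icc 1 N,
      ∫ y in (x (j - 1))..(x j), (g y - radauL x k g j y) ^ 2
      ≤ 2 * (B * P ^ (k + 1) * δ ^ (k + 1) * (ε * κ)) ^ 2 * (x j - x (j - 1))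
        + 2 * (fluxConst k σ α * (κ * (layerConst σ α * δ) ^ (k + 1)) ^ 2) *
          ∫ y in (x (j - 1))..(x j), wt σ ε α y ^ 2 := by
    intro j hj
    have hlt := hx.lt j hj
    have hsub := hx.Icc_subset hj
    have hu : uIcc (x j) (x (j - 1)) = Icc (x (j - 1)) (x j) := uIcc_of_ge hlt.le
    have hsc : ContinuousOn s (Icc (x (j - 1)) (x j)) := hs.continuousOn.mono hsub
    have hec : ContinuousOn e (Icc (x (j - 1)) (x j)) := he.continuousOn.mono hsub
    have h1 := integral_layer_error_sq_le hσ hε hα hlt hsub hκ he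
      (fun y hy i hi => ((hb y hy).2 i hi).2) (hx.incr j hj)
    have h2 : ∀ y ∈ Icc (x (j - 1)) (x j), (s y - (radauOn k (x j) (x (j - 1)) s).eval y) ^ 2
        ≤ (B * P ^ (k + 1) * δ ^ (k + 1) * (ε * κ)) ^ 2 := by
      intro y hy
      rw [← sq_abs]
      refine pow_le_pow_left₀ (abs_nonneg _) ?_ 2
      refine (radauOn_error_le hlt.ne' (hu ▸ hsub) (k := k) (g := s) (by exact_mod_cast hs)
        (A := ε * κ) (fun z hz => ((hb z (hsub (hu ▸ hz))).2 (k + 1) le_rfl).1)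
        (hu.symm ▸ hy)).trans ?_
      rw [abs_sub_comm, abs_of_pos (sub_pos.2 hlt)]
      have e1 : (x j - x (j - 1)) ^ (k + 1) ≤ P ^ (k + 1) * δ ^ (k + 1) := by
        rw [← mul_pow]
        refine pow_le_pow_left₀ (by linarith) ((hx.width j hj).trans ?_) _
        gcongr
        linarith
      calc B * ((x j - x (j - 1)) ^ (k + 1) * (ε * κ))
          ≤ B * (P ^ (k + 1) * δ ^ (k + 1) * (ε * κ)) := by gcongr
        _ = _ := by ring
    have h3 : ∀ y ∈ Icc (x (j - 1)) (x j), (g y - radauL x k g j y) ^ 2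
        ≤ 2 * (B * P ^ (k + 1) * δ ^ (k + 1) * (ε * κ)) ^ 2
          + 2 * (e y - (radauOn k (x j) (x (j - 1)) e).eval y) ^ 2 := by
      intro y hy
      have h4 := radauOn_linear (e := x j) (z := x (j - 1)) (hu.symm ▸ hsc) (hu.symm ▸ hec) k 1 1 y
      simp only [one_mul] at h4
      have h5 : radauOn k (x j) (x (j - 1)) g = radauOn k (x j) (x (j - 1)) fun y => s y + e y :=
        radauOn_congr (fun y hy => (hb y (hsub (hu ▸ hy))).1) k
      rw [radauL, h5, h4, (hb y (hsub hy)).1]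
      nlinarith [h2 y hy, sq_nonneg ((s y - (radauOn k (x j) (x (j - 1)) s).eval y)
        - (e y - (radauOn k (x j) (x (j - 1)) e).eval y))]
    have hgc : ContinuousOn g (Icc (x (j - 1)) (x j)) :=
      (hsc.add hec).congr fun y hy => (hb y (hsub hy)).1
    have hei : IntervalIntegrable (fun y => (e y - (radauOn k (x j) (x (j - 1)) e).eval y) ^ 2)
        MeasureTheory.volume (x (j - 1)) (x j) := by
      refine ContinuousOn.intervalIntegrable ?_
      rw [uIcc_of_le hlt.le]
      exact (hec.sub (Polynomial.continuous _).continuousOn).pow 2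
    have h6 := intervalIntegral.integral_mono_on hlt.le (ContinuousOn.intervalIntegrable (by
      rw [uIcc_of_le hlt.le]
      exact (hgc.sub (Polynomial.continuous _).continuousOn).pow 2))
      (intervalIntegrable_const.add (hei.const_mul 2)) h3
    rw [intervalIntegral.integral_add intervalIntegrable_const (hei.const_mul 2),
      intervalIntegral.integral_const, smul_eq_mul, intervalIntegral.integral_const_mul] at h6
    refine h6.trans ?_
    nlinarith
  have hsumw : ∑ j ∈ Finset.Icc 1 N, ∫ y in (x (j - 1))..(x j), wt σ ε α y ^ 2
      = ∫ y in (0 : ℝ)..1, wt σ ε α y ^ 2 := by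
    have h := LayerMesh.sum_telescope (fun j => ∫ y in (x 0)..(x j), wt σ ε α y ^ 2) N
    simp only [intervalIntegral.integral_same, sub_zero] at h
    rw [hx.left, hx.right] at h
    rw [← h]
    refine Finset.sum_congr rfl fun j _ => ?_
    rw [intervalIntegral.integral_interval_sub_left (hwc.intervalIntegrable _ _)
      (hwc.intervalIntegrable _ _)]
  have hsum := Finset.sum_le_sum hterm
  rw [Finset.sum_add_distrib, ← Finset.mul_sum, ← Finset.mul_sum, hsumw,
    LayerMesh.sum_telescope (fun j => x j), hx.left, hx.right] at hsum
  have hI := integral_layerWeight_sq_le hω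
  have hεi : 0 < ε⁻¹ := inv_pos.2 hε
  refine (mul_le_mul_of_nonneg_left (hsum.trans (add_le_add le_rfl
    (mul_le_mul_of_nonneg_left hI (by positivity)))) hεi.le).trans ?_
  have hq : (2 * (α / (σ * ε)))⁻¹ = ε * (σ / (2 * α)) := by field_simp
  have hp : (δ ^ (k + 1)) ^ 2 = δ ^ (2 * k + 2) := by rw [← pow_mul]; ring
  have hp' : (layerConst σ α ^ (k + 1)) ^ 2 = layerConst σ α ^ (2 * k + 2) := by
    rw [← pow_mul]; ring
  have hq2 : ε⁻¹ * (2 * (B * P ^ (k + 1) * δ ^ (k + 1) * (ε * κ)) ^ 2 * (1 - 0)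
      + 2 * (fluxConst k σ α * (κ * (layerConst σ α * δ) ^ (k + 1)) ^ 2) *
        (2 * (α / (σ * ε)))⁻¹)
      = 2 * (ε * (B * P ^ (k + 1)) ^ 2 + fluxConst k σ α * layerConst σ α ^ (2 * k + 2) *
        (σ / (2 * α))) * κ ^ 2 * δ ^ (2 * k + 2) := by
    rw [hq, ← hp, ← hp', mul_pow (layerConst σ α)]
    field_simp
    ring
  rw [hq2, fluxInterpConst, interpConst, ← hP, ← hBd]
  have h7 : ε * (B * P ^ (k + 1)) ^ 2 ≤ (B * P ^ (k + 1)) ^ 2 :=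
    mul_le_of_le_one_left (sq_nonneg _) hε1
  gcongr

end Interp

/-! ### Elementwise continuous functions -/

/-- Continuity on each closed element. -/
def ElementwiseContinuous (x : ℕ → ℝ) (N : ℕ) (v : Broken) : Prop :=
  ∀ j ∈ Finset.Icc 1 N, ContinuousOn (v j) (Icc (x (j - 1)) (x j))

section Ip

variable {x : ℕ → ℝ} {N k : ℕ} {u v w u' v' : Broken}

namespace ElementwiseContinuous

theorem add (hu : ElementwiseContinuous x N u) (hv : ElementwiseContinuous x N v) :
    ElementwiseContinuous x N (fun j y => u j y + v j y) :=
  fun j hj => (hu j hj).add (hv j hj)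

theorem sub (hu : ElementwiseContinuous x N u) (hv : ElementwiseContinuous x N v) :
    ElementwiseContinuous x N (fun j y => u j y - v j y) :=
  fun j hj => (hu j hj).sub (hv j hj)

theorem mul (hu : ElementwiseContinuous x N u) (hv : ElementwiseContinuous x N v) :
    ElementwiseContinuous x N (fun j y => u j y * v j y) :=
  fun j hj => (hu j hj).mul (hv j hj)

theorem const_mul (c : ℝ) (hv : ElementwiseContinuous x N v) :
    ElementwiseContinuous x N (fun j y => c * v j y) :=
  fun j hj => continuousOn_const.mul (hv j hj)

theorem comb (c d : ℝ) (hu : ElementwiseContinuous x N u) (hv : ElementwiseContinuous x N v) :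
    ElementwiseContinuous x N (fun j y => c * u j y + d * v j y) :=
  (hu.const_mul c).add (hv.const_mul d)

end ElementwiseContinuous

theorem elementwiseContinuous_of_continuousOn {g : ℝ → ℝ} (hg : ContinuousOn g (Icc 0 1))
    (hsub : ∀ j ∈ Finset.Icc 1 N, Icc (x (j - 1)) (x j) ⊆ Icc 0 1) :
    ElementwiseContinuous x N (fun _ => g) := fun j hj => hg.mono (hsub j hj)

theorem IsDiscrete.elementwiseContinuous (hv : IsDiscrete N k v) :
    ElementwiseContinuous x N v := by
  intro j hj
  obtain ⟨p, -, hp⟩ := hv j hj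
  rw [show v j = fun y => p.eval y from funext hp]
  exact p.continuous.continuousOn

theorem IsDiscrete.exists_polynomial (hv : IsDiscrete N k v) {j : ℕ} (hj : j ∈ Finset.Icc 1 N) :
    ∃ p : ℝ[X], p.natDegree ≤ k ∧ v j = (fun y => p.eval y) ∧
      brokenDeriv v j = fun y => (derivative p).eval y := by
  obtain ⟨p, hpk, hp⟩ := hv j hj
  refine ⟨p, hpk, funext hp, ?_⟩
  rw [brokenDeriv, show v j = fun y => p.eval y from funext hp]
  exact funext fun y => p.deriv

theorem IsDiscrete.elementwiseContinuous_deriv (hv : IsDiscrete N k v) :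
    ElementwiseContinuous x N (brokenDeriv v) := by
  intro j hj
  obtain ⟨p, -, -, hp⟩ := hv.exists_polynomial hj
  rw [hp]
  exact (derivative p).continuous.continuousOn

theorem IsDiscrete.comb (hu : IsDiscrete N k u) (hv : IsDiscrete N k v) (c d : ℝ) :
    IsDiscrete N k (fun j y => c * u j y + d * v j y) := by
  intro j hj
  obtain ⟨p, hpk, hp⟩ := hu j hj
  obtain ⟨q, hqk, hq⟩ := hv j hj
  refine ⟨C c * p + C d * q, natDegree_add_le_of_degree_le ((natDegree_C_mul_le _ _).trans hpk)
    ((natDegree_C_mul_le _ _).trans hqk), fun y => ?_⟩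
  simp [hp, hq]

theorem IsDiscrete.sub (hu : IsDiscrete N k u) (hv : IsDiscrete N k v) :
    IsDiscrete N k (fun j y => u j y - v j y) := by
  convert hu.comb hv 1 (-1) using 3
  ring

/-! ### The elementwise inner product -/

theorem ElementwiseContinuous.intervalIntegrable (hx : ∀ j ∈ Finset.Icc 1 N, x (j - 1) ≤ x j)
    (hu : ElementwiseContinuous x N u) {j : ℕ} (hj : j ∈ Finset.Icc 1 N) :
    IntervalIntegrable (u j) MeasureTheory.volume (x (j - 1)) (x j) :=
  ContinuousOn.intervalIntegrable (by rw [uIcc_of_le (hx j hj)]; exact hu j hj)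

theorem ip_congr (hx : ∀ j ∈ Finset.Icc 1 N, x (j - 1) ≤ x j)
    (h : ∀ j ∈ Finset.Icc 1 N, ∀ y ∈ Icc (x (j - 1)) (x j), u j y * v j y = u' j y * v' j y) :
    ip x N u v = ip x N u' v' := by
  refine Finset.sum_congr rfl fun j hj => intervalIntegral.integral_congr fun y hy => ?_
  rw [uIcc_of_le (hx j hj)] at hy
  exact h j hj y hy

/-- The differential equation holds only inside `(0,1)`, so integrands are compared on open
elements. -/
theorem ip_congr_ae (hx : ∀ j ∈ Finset.Icc 1 N, x (j - 1) ≤ x j)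
    (h : ∀ j ∈ Finset.Icc 1 N, ∀ y ∈ Ioo (x (j - 1)) (x j), u j y * v j y = u' j y * v' j y) :
    ip x N u v = ip x N u' v' := by
  refine Finset.sum_congr rfl fun j hj => ?_
  rw [intervalIntegral.integral_of_le (hx j hj), intervalIntegral.integral_of_le (hx j hj),
    MeasureTheory.integral_Ioc_eq_integral_Ioo, MeasureTheory.integral_Ioc_eq_integral_Ioo]
  exact MeasureTheory.setIntegral_congr_fun measurableSet_Ioo (h j hj)

theorem ip_comm (u v : Broken) : ip x N u v = ip x N v u := by
  simp only [ip, mul_comm]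

theorem ip_comb_left (hx : ∀ j ∈ Finset.Icc 1 N, x (j - 1) ≤ x j)
    (hu : ElementwiseContinuous x N u) (hv : ElementwiseContinuous x N v)
    (hw : ElementwiseContinuous x N w) (c d : ℝ) :
    ip x N (fun j y => c * u j y + d * v j y) w = c * ip x N u w + d * ip x N v w := by
  simp only [ip, Finset.mul_sum, ← Finset.sum_add_distrib]
  refine Finset.sum_congr rfl fun j hj => ?_
  have h1 := (hu.mul hw).intervalIntegrable hx hj
  have h2 := (hv.mul hw).intervalIntegrable hx hj
  rw [← intervalIntegral.integral_const_mul, ← intervalIntegral.integral_const_mul,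
    ← intervalIntegral.integral_add (h1.const_mul c) (h2.const_mul d)]
  congr 1
  ext y
  ring

theorem ip_comb_right (hx : ∀ j ∈ Finset.Icc 1 N, x (j - 1) ≤ x j)
    (hu : ElementwiseContinuous x N u) (hv : ElementwiseContinuous x N v)
    (hw : ElementwiseContinuous x N w) (c d : ℝ) :
    ip x N w (fun j y => c * u j y + d * v j y) = c * ip x N w u + d * ip x N w v := by
  rw [ip_comm, ip_comb_left hx hu hv hw, ip_comm u, ip_comm v]

theorem ip_sub_left (hx : ∀ j ∈ Finset.Icc 1 N, x (j - 1) ≤ x j)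
    (hu : ElementwiseContinuous x N u) (hv : ElementwiseContinuous x N v)
    (hw : ElementwiseContinuous x N w) :
    ip x N (fun j y => u j y - v j y) w = ip x N u w - ip x N v w := by
  have := ip_comb_left hx hu hv hw 1 (-1)
  simp only [one_mul, neg_mul, ← sub_eq_add_neg] at this
  exact this

theorem ip_mono (hx : ∀ j ∈ Finset.Icc 1 N, x (j - 1) ≤ x j)
    (hu : ElementwiseContinuous x N u) (hv : ElementwiseContinuous x N v)
    (hu' : ElementwiseContinuous x N u') (hv' : ElementwiseContinuous x N v')
    (h : ∀ j ∈ Finset.Icc 1 N, ∀ y ∈ Icc (x (j - 1)) (x j), u j y * v j y ≤ u' j y * v' j y) :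
    ip x N u v ≤ ip x N u' v' :=
  Finset.sum_le_sum fun j hj => intervalIntegral.integral_mono_on (hx j hj)
    ((hu.mul hv).intervalIntegrable hx hj) ((hu'.mul hv').intervalIntegrable hx hj) (h j hj)

theorem ip_nonneg (hx : ∀ j ∈ Finset.Icc 1 N, x (j - 1) ≤ x j)
    (h : ∀ j ∈ Finset.Icc 1 N, ∀ y ∈ Icc (x (j - 1)) (x j), 0 ≤ u j y * v j y) :
    0 ≤ ip x N u v :=
  Finset.sum_nonneg fun j hj => intervalIntegral.integral_nonneg (hx j hj) (h j hj)

theorem ip_self_nonneg (hx : ∀ j ∈ Finset.Icc 1 N, x (j - 1) ≤ x j) (u : Broken) :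
    0 ≤ ip x N u u :=
  ip_nonneg hx fun _ _ _ _ => mul_self_nonneg _

theorem sq_l2norm (hx : ∀ j ∈ Finset.Icc 1 N, x (j - 1) ≤ x j) (u : Broken) :
    l2norm x N u ^ 2 = ip x N u u := Real.sq_sqrt (ip_self_nonneg hx u)

/-- Cauchy–Schwarz from the discriminant of `t ↦ ‖t u + v‖²`, a quadratic that is never negative. -/
theorem abs_ip_le (hx : ∀ j ∈ Finset.Icc 1 N, x (j - 1) ≤ x j)
    (hu : ElementwiseContinuous x N u) (hv : ElementwiseContinuous x N v) :
    |ip x N u v| ≤ l2norm x N u * l2norm x N v := by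
  have key : ∀ t : ℝ, 0 ≤ ip x N u u * (t * t) + 2 * ip x N u v * t + ip x N v v := by
    intro t
    have h := ip_self_nonneg hx (fun j y => t * u j y + 1 * v j y)
    rw [ip_comb_left hx hu hv (hu.comb t 1 hv), ip_comb_right hx hu hv hu,
      ip_comb_right hx hu hv hv, ip_comm v u] at h
    linarith
  have hd := discrim_le_zero key
  rw [discrim] at hd
  rw [l2norm, l2norm, ← Real.sqrt_mul (ip_self_nonneg hx u)]
  refine Real.abs_le_sqrt ?_
  nlinarith

theorem l2norm_le_of_sup (hx : ∀ j ∈ Finset.Icc 1 N, x (j - 1) ≤ x j) (h01 : x N - x 0 ≤ 1)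
    (hu : ElementwiseContinuous x N u) {A : ℝ} (hA : 0 ≤ A)
    (h : ∀ j ∈ Finset.Icc 1 N, ∀ y ∈ Icc (x (j - 1)) (x j), |u j y| ≤ A) :
    l2norm x N u ≤ A := by
  refine Real.sqrt_le_iff.2 ⟨hA, ?_⟩
  have h1 : ip x N u u ≤ ∑ j ∈ Finset.Icc 1 N, A ^ 2 * (x j - x (j - 1)) := by
    refine Finset.sum_le_sum fun j hj => ?_
    have := intervalIntegral.integral_mono_on (hx j hj) ((hu.mul hu).intervalIntegrable hx hj)
      (intervalIntegrable_const (c := A ^ 2)) fun y hy => by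
        have := h j hj y hy
        rw [← abs_mul_abs_self, sq]
        exact mul_self_le_mul_self (abs_nonneg _) this
    rw [intervalIntegral.integral_const, smul_eq_mul, mul_comm] at this
    exact this
  rw [← Finset.mul_sum, LayerMesh.sum_telescope] at h1
  exact h1.trans (mul_le_of_le_one_right (sq_nonneg A) h01)

/-- Elementwise integration by parts against a discrete function. -/
theorem ip_brokenDeriv (hx : ∀ j ∈ Finset.Icc 1 N, x (j - 1) ≤ x j) {G dG : Broken}
    (hG : ElementwiseContinuous x N G) (hdG : ElementwiseContinuous x N dG)
    (hd : ∀ j ∈ Finset.Icc 1 N, ∀ y ∈ Ioo (x (j - 1)) (x j), HasDerivAt (G j) (dG j y) y)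
    (hv : IsDiscrete N k v) :
    ip x N G (brokenDeriv v) + ip x N dG v
      = ∑ j ∈ Finset.Icc 1 N, (G j (x j) * v j (x j) - G j (x (j - 1)) * v j (x (j - 1))) := by
  rw [ip, ip, ← Finset.sum_add_distrib]
  refine Finset.sum_congr rfl fun j hj => ?_
  have h1 := (hG.mul (hv.elementwiseContinuous_deriv (x := x))).intervalIntegrable hx hj
  have h2 := (hdG.mul (hv.elementwiseContinuous (x := x))).intervalIntegrable hx hj
  rw [← intervalIntegral.integral_add h1 h2]
  refine intervalIntegral.integral_eq_sub_of_hasDerivAt_of_le (f := fun y => G j y * v j y)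
    (hx j hj) ((hG.mul hv.elementwiseContinuous) j hj) (fun y hy => ?_) (h1.add h2)
  obtain ⟨p, -, hp, hp'⟩ := hv.exists_polynomial hj
  have h3 := (hd j hj y hy).mul (p.hasDerivAt y)
  rw [hp, hp']
  refine h3.congr_deriv ?_
  ring

theorem sum_Icc_eq_first (F : ℕ → ℝ) (n : ℕ) :
    ∑ j ∈ Finset.Icc 1 (n + 1), F j = F 1 + ∑ j ∈ Finset.Icc 1 n, F (j + 1) := by
  induction n with
  | zero => simp
  | succ n ih =>
    rw [Finset.sum_Icc_succ_top (by omega), ih, Finset.sum_Icc_succ_top (by omega)]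
    ring

theorem sum_range_eq_Icc (F : ℕ → ℝ) (n : ℕ) :
    ∑ j ∈ Finset.range (n + 1), F j = F 0 + ∑ j ∈ Finset.Icc 1 n, F j := by
  induction n with
  | zero => simp
  | succ n ih =>
    rw [Finset.sum_range_succ, ih, Finset.sum_Icc_succ_top (by omega)]
    ring

/-- Regroups element boundary terms by nodes, as needed to compare them with the jump terms: `F`
holds right ends, `G` left ends. -/
theorem sum_element_boundary (F G : ℕ → ℝ) (n : ℕ) :
    ∑ j ∈ Finset.Icc 1 (n + 1), (F j - G j)
      = F (n + 1) - G 1 + ∑ j ∈ Finset.Icc 1 n, (F j - G (j + 1)) := by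
  rw [Finset.sum_sub_distrib, Finset.sum_Icc_succ_top (by omega), sum_Icc_eq_first,
    Finset.sum_sub_distrib]
  ring

/-! ### Jumps -/

theorem jump_zero (x : ℕ → ℝ) (N : ℕ) (v : Broken) : jump x N v 0 = v 1 (x 0) := by
  simp [jump, traceR]

theorem jump_last (x : ℕ → ℝ) (n : ℕ) (v : Broken) :
    jump x (n + 1) v (n + 1) = -v (n + 1) (x (n + 1)) := by
  simp [jump, traceL]

theorem jump_interior (x : ℕ → ℝ) {n j : ℕ} (v : Broken) (hj : j ∈ Finset.Icc 1 n) :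
    jump x (n + 1) v j = v (j + 1) (x j) - v j (x j) := by
  rw [Finset.mem_Icc] at hj
  rw [jump, if_neg (by omega), if_neg (by omega), traceR, traceL]

/-- The bilinear form with all interface terms written as traces. -/
theorem formB_eq (x : ℕ → ℝ) (n : ℕ) (ε : ℝ) (a b : ℝ → ℝ) (u q v r : Broken) :
    formB x (n + 1) ε a b u q v r =
      ε⁻¹ * ip x (n + 1) q r + ip x (n + 1) (fun j y => (b y - dx a y) * u j y) v
      + (ip x (n + 1) u (brokenDeriv r)
        + ∑ j ∈ Finset.Icc 1 n, u j (x j) * (r (j + 1) (x j) - r j (x j)))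
      + (ip x (n + 1) q (brokenDeriv v) + q 1 (x 0) * v 1 (x 0)
        + ∑ j ∈ Finset.Icc 1 n, q (j + 1) (x j) * (v (j + 1) (x j) - v j (x j))
        - q (n + 1) (x (n + 1)) * v (n + 1) (x (n + 1)))
      + (-ip x (n + 1) (fun j y => a y * u j y) (brokenDeriv v)
        - ∑ j ∈ Finset.Icc 1 n, a (x j) * u j (x j) * (v (j + 1) (x j) - v j (x j))
        + a (x (n + 1)) * u (n + 1) (x (n + 1)) * v (n + 1) (x (n + 1))
        + penalty x (n + 1) ε * u (n + 1) (x (n + 1)) * v (n + 1) (x (n + 1))) := by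
  have h1 : ∀ c : ℕ → ℝ, ∀ w : Broken, ∑ j ∈ Finset.Icc 1 n, c j * jump x (n + 1) w j
      = ∑ j ∈ Finset.Icc 1 n, c j * (w (j + 1) (x j) - w j (x j)) := fun c w =>
    Finset.sum_congr rfl fun j hj => by rw [jump_interior x w hj]
  simp only [formB, Nat.add_sub_cancel]
  -- The convective sum includes `j = N`, where the jump is `-v_N^-`; split off, it appears with a
  -- plus sign. The flux sum includes `j = 0`, where the jump is `v_0^+`.
  rw [sum_range_eq_Icc, h1 (fun j => traceL x u j), h1 (fun j => traceR x q j),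
    Finset.sum_Icc_succ_top (by omega), h1 (fun j => a (x j) * traceL x u j), jump_zero, jump_last]
  simp only [traceL, traceR, zero_add]
  ring

theorem sum_jump_sq_eq (x : ℕ → ℝ) (n : ℕ) (a : ℝ → ℝ) (u : Broken) :
    ∑ j ∈ Finset.range (n + 1 + 1), 1 / 2 * a (x j) * jump x (n + 1) u j ^ 2
      = 1 / 2 * a (x 0) * u 1 (x 0) ^ 2
        + ∑ j ∈ Finset.Icc 1 n, 1 / 2 * a (x j) * (u (j + 1) (x j) - u j (x j)) ^ 2
        + 1 / 2 * a (x (n + 1)) * u (n + 1) (x (n + 1)) ^ 2 := by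
  rw [Finset.sum_range_succ, sum_range_eq_Icc, jump_zero, jump_last, neg_sq]
  congr 2
  exact Finset.sum_congr rfl fun j hj => by rw [jump_interior x u hj]

/-- The square of the energy norm. -/
def energySq (x : ℕ → ℝ) (N : ℕ) (ε : ℝ) (a b : ℝ → ℝ) (u q : Broken) : ℝ :=
  ε⁻¹ * ip x N q q + ip x N (fun j y => (b y - dx a y / 2) * u j y) u
    + ∑ j ∈ Finset.range (N + 1), 1 / 2 * a (x j) * jump x N u j ^ 2
    + penalty x N ε * jump x N u N ^ 2

theorem energyNorm_eq (x : ℕ → ℝ) (N : ℕ) (ε : ℝ) (a b : ℝ → ℝ) (u q : Broken) :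
    energyNorm x N ε a b u q = Real.sqrt (energySq x N ε a b u q) := rfl

end Ip

/-! ### Coercivity, consistency and linearity of the bilinear form -/

section Form

variable {x : ℕ → ℝ} {n k : ℕ} {ε : ℝ} {a b : ℝ → ℝ}

theorem continuousOn_dx {g : ℝ → ℝ} (hg : ContDiffOn ℝ 1 g (Icc 0 1)) :
    ContinuousOn (dx g) (Icc 0 1) :=
  hg.continuousOn_derivWithin (uniqueDiffOn_Icc zero_lt_one) le_rfl

theorem hasDerivAt_dx {g : ℝ → ℝ} (hg : ContDiffOn ℝ 1 g (Icc 0 1)) {y : ℝ}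
    (hy : y ∈ Ioo (0 : ℝ) 1) : HasDerivAt g (dx g y) y :=
  ((hg.differentiableOn one_ne_zero y (Ioo_subset_Icc_self hy)).hasDerivWithinAt).hasDerivAt
    (Icc_mem_nhds hy.1 hy.2)

/-- The elements cover a part of `[0,1]` in increasing order. -/
structure IsMesh (x : ℕ → ℝ) (N : ℕ) : Prop where
  le : ∀ j ∈ Finset.Icc 1 N, x (j - 1) ≤ x j
  sub : ∀ j ∈ Finset.Icc 1 N, Icc (x (j - 1)) (x j) ⊆ Icc 0 1

theorem IsMesh.subset_Ioo {N : ℕ} (hx : IsMesh x N) {j : ℕ} (hj : j ∈ Finset.Icc 1 N) :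
    Ioo (x (j - 1)) (x j) ⊆ Ioo 0 1 := by
  have h1 := (hx.sub j hj (left_mem_Icc.2 (hx.le j hj))).1
  have h2 := (hx.sub j hj (right_mem_Icc.2 (hx.le j hj))).2
  exact Ioo_subset_Ioo h1 h2

/-- The coercivity identity `B(w; w) = |||w|||²`. -/
theorem formB_self (hx : IsMesh x (n + 1)) (ha : ContDiffOn ℝ 1 a (Icc 0 1))
    (hb : ContinuousOn b (Icc 0 1)) {u q : Broken} (hu : IsDiscrete (n + 1) k u)
    (hq : IsDiscrete (n + 1) k q) :
    formB x (n + 1) ε a b u q u q = energySq x (n + 1) ε a b u q := by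
  have huc : ElementwiseContinuous x (n + 1) u := hu.elementwiseContinuous
  have huc' : ElementwiseContinuous x (n + 1) (brokenDeriv u) := hu.elementwiseContinuous_deriv
  have hac : ElementwiseContinuous x (n + 1) (fun _ => a) :=
    elementwiseContinuous_of_continuousOn ha.continuousOn hx.sub
  have hac' : ElementwiseContinuous x (n + 1) (fun _ => dx a) :=
    elementwiseContinuous_of_continuousOn (continuousOn_dx ha) hx.sub
  have hbc : ElementwiseContinuous x (n + 1) (fun _ => b) :=
    elementwiseContinuous_of_continuousOn hb hx.sub
  have hder : ∀ w : Broken, IsDiscrete (n + 1) k w → ∀ j ∈ Finset.Icc 1 (n + 1), ∀ y,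
      HasDerivAt (w j) (brokenDeriv w j y) y := by
    intro w hw j hj y
    obtain ⟨p, -, h1, h2⟩ := hw.exists_polynomial hj
    rw [h1, h2]
    exact p.hasDerivAt y
  -- The diffusion terms cancel after this integration by parts, since the fluxes for `u` and `q`
  -- take opposite traces.
  have e1 := ip_brokenDeriv hx.le huc huc' (fun j hj y _ => hder u hu j hj y) hq
  -- Half of this identity turns `b - a_x` into `b - a_x/2`.
  have e2 := ip_brokenDeriv hx.le (G := fun j y => a y * u j y)
    (dG := fun j y => dx a y * u j y + a y * brokenDeriv u j y) (hac.mul huc)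
    ((hac'.mul huc).add (hac.mul huc')) (fun j hj y hy =>
      (hasDerivAt_dx ha (hx.subset_Ioo hj hy)).mul (hder u hu j hj y)) hu
  rw [sum_element_boundary (fun j => u j (x j) * q j (x j))
    (fun j => u j (x (j - 1)) * q j (x (j - 1)))] at e1
  rw [sum_element_boundary (fun j => a (x j) * u j (x j) * u j (x j))
    (fun j => a (x (j - 1)) * u j (x (j - 1)) * u j (x (j - 1)))] at e2
  simp only [Nat.add_sub_cancel, Nat.sub_self] at e1 e2
  have e3 := ip_comb_left hx.le (hac'.mul huc) (hac.mul huc') huc 1 1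
  simp only [one_mul] at e3
  have e4 : ip x (n + 1) (fun j y => a y * brokenDeriv u j y) u
      = ip x (n + 1) (fun j y => a y * u j y) (brokenDeriv u) :=
    ip_congr hx.le fun j _ y _ => by ring
  have e5 := ip_comb_left hx.le ((hbc.sub hac').mul huc) (hac'.mul huc) huc 1 (1 / 2)
  have e6 : ip x (n + 1) (fun j y => 1 * ((b y - dx a y) * u j y) + 1 / 2 * (dx a y * u j y)) u
      = ip x (n + 1) (fun j y => (b y - dx a y / 2) * u j y) u :=
    ip_congr hx.le fun j _ y _ => by ring
  rw [formB_eq, energySq, sum_jump_sq_eq, jump_last]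
  rw [ip_comm (brokenDeriv u) q] at e1
  have s1 : ∑ j ∈ Finset.Icc 1 n, u j (x j) * (q (j + 1) (x j) - q j (x j))
      + ∑ j ∈ Finset.Icc 1 n, q (j + 1) (x j) * (u (j + 1) (x j) - u j (x j))
      + ∑ j ∈ Finset.Icc 1 n, (u j (x j) * q j (x j) - u (j + 1) (x j) * q (j + 1) (x j)) = 0 := by
    rw [← Finset.sum_add_distrib, ← Finset.sum_add_distrib]
    exact Finset.sum_eq_zero fun j _ => by ring
  -- The upwind terms and the boundary terms of the integration by parts complete the square `½ a_j
  -- [u]_j²`.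
  have s2 : ∑ j ∈ Finset.Icc 1 n, a (x j) * u j (x j) * (u (j + 1) (x j) - u j (x j))
      + 1 / 2 * ∑ j ∈ Finset.Icc 1 n, (a (x j) * u j (x j) * u j (x j)
        - a (x j) * u (j + 1) (x j) * u (j + 1) (x j))
      + ∑ j ∈ Finset.Icc 1 n, 1 / 2 * a (x j) * (u (j + 1) (x j) - u j (x j)) ^ 2 = 0 := by
    rw [Finset.mul_sum, ← Finset.sum_add_distrib, ← Finset.sum_add_distrib]
    exact Finset.sum_eq_zero fun j _ => by ring
  linear_combination e1 - 1 / 2 * e2 + 1 / 2 * e3 + 1 / 2 * e4 - e5 + e6 + s1 - s2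

/-- Consistency of the bilinear form. -/
theorem formB_smooth (hx : IsMesh x (n + 1)) (hx0 : x 0 = 0) (hx1 : x (n + 1) = 1) (hε : ε ≠ 0)
    (ha : ContDiffOn ℝ 1 a (Icc 0 1)) (hb : ContinuousOn b (Icc 0 1)) {g p : ℝ → ℝ}
    (hg : ContDiffOn ℝ 1 g (Icc 0 1)) (hp : ContDiffOn ℝ 1 p (Icc 0 1))
    (hpg : ∀ y ∈ Icc (0 : ℝ) 1, p y = ε * dx g y)
    (hg0 : g 0 = 0) (hg1 : g 1 = 0) {v r : Broken}
    (hv : IsDiscrete (n + 1) k v) (hr : IsDiscrete (n + 1) k r) :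
    formB x (n + 1) ε a b (fun _ => g) (fun _ => p) v r
      = ip x (n + 1) (fun _ y => -dx p y + a y * dx g y + b y * g y) v := by
  have hvc : ElementwiseContinuous x (n + 1) v := hv.elementwiseContinuous
  have hc : ∀ f : ℝ → ℝ, ContinuousOn f (Icc 0 1) → ElementwiseContinuous x (n + 1) (fun _ => f) :=
    fun f hf => elementwiseContinuous_of_continuousOn hf hx.sub
  have hac := hc a ha.continuousOn
  have hac' := hc _ (continuousOn_dx ha)
  have hbc := hc b hb
  have hgc := hc g hg.continuousOn
  have hgc' := hc _ (continuousOn_dx hg)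
  have hpc := hc p hp.continuousOn
  have hpc' := hc _ (continuousOn_dx hp)
  have e1 := ip_brokenDeriv hx.le hgc hgc'
    (fun j hj y hy => hasDerivAt_dx hg (hx.subset_Ioo hj hy)) hr
  have e2 := ip_brokenDeriv hx.le hpc hpc'
    (fun j hj y hy => hasDerivAt_dx hp (hx.subset_Ioo hj hy)) hv
  have e3 := ip_brokenDeriv hx.le (G := fun _ y => a y * g y)
    (dG := fun _ y => dx a y * g y + a y * dx g y) (hac.mul hgc)
    ((hac'.mul hgc).add (hac.mul hgc')) (fun j hj y hy =>
      (hasDerivAt_dx ha (hx.subset_Ioo hj hy)).mul (hasDerivAt_dx hg (hx.subset_Ioo hj hy))) hv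
  rw [sum_element_boundary (fun j => g (x j) * r j (x j))
    (fun j => g (x (j - 1)) * r j (x (j - 1)))] at e1
  rw [sum_element_boundary (fun j => p (x j) * v j (x j))
    (fun j => p (x (j - 1)) * v j (x (j - 1)))] at e2
  rw [sum_element_boundary (fun j => a (x j) * g (x j) * v j (x j))
    (fun j => a (x (j - 1)) * g (x (j - 1)) * v j (x (j - 1)))] at e3
  simp only [Nat.add_sub_cancel, Nat.sub_self, hx0, hx1, hg0, hg1, mul_zero, zero_mul,
    sub_zero] at e1 e2 e3
  -- The relation `p = ε g_x` makes this term cancel the one from integrating `⟨g, r_x⟩` by parts.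
  have e4 : ε⁻¹ * ip x (n + 1) (fun _ => p) r = ip x (n + 1) (fun _ => dx g) r := by
    have h := ip_comb_left hx.le hpc hpc (hr.elementwiseContinuous (x := x)) ε⁻¹ 0
    simp only [zero_mul, add_zero] at h
    rw [← h]
    refine ip_congr hx.le fun j hj y hy => ?_
    rw [hpg y (hx.sub j hj hy), inv_mul_cancel_left₀ hε]
  have e5 := ip_comb_left hx.le ((hbc.sub hac').mul hgc)
    ((hac'.mul hgc).add (hac.mul hgc')) hvc 1 1
  have e6 := ip_comb_left hx.le (((hbc.sub hac').mul hgc).comb 1 1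
    ((hac'.mul hgc).add (hac.mul hgc'))) hpc' hvc 1 (-1)
  have e7 : ip x (n + 1) (fun _ y => -dx p y + a y * dx g y + b y * g y) v
      = ip x (n + 1) (fun j y => 1 * (1 * ((b y - dx a y) * g y)
        + 1 * (dx a y * g y + a y * dx g y)) + -1 * dx p y) v :=
    ip_congr hx.le fun j _ y _ => by ring
  rw [formB_eq, e4, e7, e6, e5]
  simp only [hx0, hx1, hg1]
  have s1 : ∑ j ∈ Finset.Icc 1 n, g (x j) * (r (j + 1) (x j) - r j (x j))
      + ∑ j ∈ Finset.Icc 1 n, (g (x j) * r j (x j) - g (x j) * r (j + 1) (x j)) = 0 := by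
    rw [← Finset.sum_add_distrib]
    exact Finset.sum_eq_zero fun j _ => by ring
  have s2 : ∑ j ∈ Finset.Icc 1 n, p (x j) * (v (j + 1) (x j) - v j (x j))
      + ∑ j ∈ Finset.Icc 1 n, (p (x j) * v j (x j) - p (x j) * v (j + 1) (x j)) = 0 := by
    rw [← Finset.sum_add_distrib]
    exact Finset.sum_eq_zero fun j _ => by ring
  have s3 : ∑ j ∈ Finset.Icc 1 n, a (x j) * g (x j) * (v (j + 1) (x j) - v j (x j))
      + ∑ j ∈ Finset.Icc 1 n, (a (x j) * g (x j) * v j (x j)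
        - a (x j) * g (x j) * v (j + 1) (x j)) = 0 := by
    rw [← Finset.sum_add_distrib]
    exact Finset.sum_eq_zero fun j _ => by ring
  linear_combination e1 + e2 - e3 + s1 + s2 - s3

/-- Linearity of the bilinear form in its first argument. -/
theorem formB_comb (hx : IsMesh x (n + 1)) (ha : ContDiffOn ℝ 1 a (Icc 0 1))
    (hb : ContinuousOn b (Icc 0 1)) {u₁ u₂ q₁ q₂ v r : Broken}
    (hu₁ : ElementwiseContinuous x (n + 1) u₁) (hu₂ : ElementwiseContinuous x (n + 1) u₂)
    (hq₁ : ElementwiseContinuous x (n + 1) q₁) (hq₂ : ElementwiseContinuous x (n + 1) q₂)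
    (hv : IsDiscrete (n + 1) k v) (hr : IsDiscrete (n + 1) k r) (c d : ℝ) :
    formB x (n + 1) ε a b (fun j y => c * u₁ j y + d * u₂ j y)
        (fun j y => c * q₁ j y + d * q₂ j y) v r
      = c * formB x (n + 1) ε a b u₁ q₁ v r + d * formB x (n + 1) ε a b u₂ q₂ v r := by
  have hvc : ElementwiseContinuous x (n + 1) v := hv.elementwiseContinuous
  have hvc' : ElementwiseContinuous x (n + 1) (brokenDeriv v) := hv.elementwiseContinuous_deriv
  have hrc : ElementwiseContinuous x (n + 1) r := hr.elementwiseContinuous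
  have hrc' : ElementwiseContinuous x (n + 1) (brokenDeriv r) := hr.elementwiseContinuous_deriv
  have hac : ElementwiseContinuous x (n + 1) (fun _ => a) :=
    elementwiseContinuous_of_continuousOn ha.continuousOn hx.sub
  have hA : ElementwiseContinuous x (n + 1) (fun _ y => b y - dx a y) :=
    elementwiseContinuous_of_continuousOn (hb.sub (continuousOn_dx ha)) hx.sub
  have e1 := ip_comb_left hx.le hq₁ hq₂ hrc c d
  have e2 := ip_comb_left hx.le (hA.mul hu₁) (hA.mul hu₂) hvc c d
  have e3 := ip_comb_left hx.le hu₁ hu₂ hrc' c d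
  have e4 := ip_comb_left hx.le hq₁ hq₂ hvc' c d
  have e5 := ip_comb_left hx.le (hac.mul hu₁) (hac.mul hu₂) hvc' c d
  have e6 : ip x (n + 1) (fun j y => (b y - dx a y) * (c * u₁ j y + d * u₂ j y)) v
      = ip x (n + 1) (fun j y => c * ((b y - dx a y) * u₁ j y)
        + d * ((b y - dx a y) * u₂ j y)) v :=
    ip_congr hx.le fun j _ y _ => by ring
  have e7 : ip x (n + 1) (fun j y => a y * (c * u₁ j y + d * u₂ j y)) (brokenDeriv v)
      = ip x (n + 1) (fun j y => c * (a y * u₁ j y) + d * (a y * u₂ j y)) (brokenDeriv v) :=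
    ip_congr hx.le fun j _ y _ => by ring
  have hsum : ∀ F₁ F₂ G : ℕ → ℝ, ∑ j ∈ Finset.Icc 1 n, (c * F₁ j + d * F₂ j) * G j
      = c * ∑ j ∈ Finset.Icc 1 n, F₁ j * G j + d * ∑ j ∈ Finset.Icc 1 n, F₂ j * G j := by
    intro F₁ F₂ G
    rw [Finset.mul_sum, Finset.mul_sum, ← Finset.sum_add_distrib]
    exact Finset.sum_congr rfl fun j _ => by ring
  have s1 := hsum (fun j => u₁ j (x j)) (fun j => u₂ j (x j))
    (fun j => r (j + 1) (x j) - r j (x j))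
  have s2 := hsum (fun j => q₁ (j + 1) (x j)) (fun j => q₂ (j + 1) (x j))
    (fun j => v (j + 1) (x j) - v j (x j))
  have s3 : ∑ j ∈ Finset.Icc 1 n, a (x j) * (c * u₁ j (x j) + d * u₂ j (x j))
      * (v (j + 1) (x j) - v j (x j))
      = c * ∑ j ∈ Finset.Icc 1 n, a (x j) * u₁ j (x j) * (v (j + 1) (x j) - v j (x j))
        + d * ∑ j ∈ Finset.Icc 1 n, a (x j) * u₂ j (x j) * (v (j + 1) (x j) - v j (x j)) := by
    rw [← hsum]
    exact Finset.sum_congr rfl fun j _ => by ring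
  rw [formB_eq, formB_eq, formB_eq, e1, e6, e2, e3, e4, e7, e5, s1, s2, s3]
  ring

end Form

/-! ### Coefficients -/

/-- The assumptions on the coefficients, with a bound `A` for all quantities derived from them. -/
structure CoeffBounds (a b : ℝ → ℝ) (α β A : ℝ) : Prop where
  contDiffOn : ContDiffOn ℝ 1 a (Icc 0 1)
  continuousOn : ContinuousOn b (Icc 0 1)
  alpha_pos : 0 < α
  beta_pos : 0 < β
  alpha_le : ∀ y ∈ Icc (0 : ℝ) 1, α ≤ a y
  beta_le : ∀ y ∈ Icc (0 : ℝ) 1, β ≤ b y - dx a y / 2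
  a_le : ∀ y ∈ Icc (0 : ℝ) 1, a y ≤ A
  abs_le : ∀ y ∈ Icc (0 : ℝ) 1, |b y - dx a y| ≤ A
  reaction_le : ∀ y ∈ Icc (0 : ℝ) 1, b y - dx a y / 2 ≤ A
  lipschitz : ∀ y ∈ Icc (0 : ℝ) 1, ∀ z ∈ Icc (0 : ℝ) 1, |a y - a z| ≤ A * |y - z|

theorem exists_coeffBounds {a b : ℝ → ℝ} {α β : ℝ} (ha : ContDiffOn ℝ 1 a (Icc 0 1))
    (hb : ContinuousOn b (Icc 0 1)) (hα : 0 < α) (hβ : 0 < β)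
    (haα : ∀ y ∈ Icc (0 : ℝ) 1, α ≤ a y) (hbβ : ∀ y ∈ Icc (0 : ℝ) 1, β ≤ b y - dx a y / 2) :
    ∃ A, CoeffBounds a b α β A := by
  have hda := continuousOn_dx ha
  obtain ⟨A₁, h₁⟩ := isCompact_Icc.exists_bound_of_continuousOn ha.continuousOn
  obtain ⟨A₂, h₂⟩ := isCompact_Icc.exists_bound_of_continuousOn (hb.sub hda)
  obtain ⟨A₃, h₃⟩ := isCompact_Icc.exists_bound_of_continuousOn (hb.sub (hda.div_const 2))
  obtain ⟨A₄, h₄⟩ := isCompact_Icc.exists_bound_of_continuousOn hda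
  have m1 : A₁ ≤ max (max A₁ A₂) (max A₃ A₄) := (le_max_left _ _).trans (le_max_left _ _)
  have m2 : A₂ ≤ max (max A₁ A₂) (max A₃ A₄) := (le_max_right _ _).trans (le_max_left _ _)
  have m3 : A₃ ≤ max (max A₁ A₂) (max A₃ A₄) := (le_max_left _ _).trans (le_max_right _ _)
  have m4 : A₄ ≤ max (max A₁ A₂) (max A₃ A₄) := (le_max_right _ _).trans (le_max_right _ _)
  refine ⟨max (max A₁ A₂) (max A₃ A₄), ha, hb, hα, hβ, haα, hbβ, fun y hy => ?_, fun y hy => ?_,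
    fun y hy => ?_, fun y hy z hz => ?_⟩
  · exact (le_abs_self _).trans ((h₁ y hy).trans m1)
  · exact (h₂ y hy).trans m2
  · exact (le_abs_self _).trans ((h₃ y hy).trans m3)
  · exact (convex_Icc (0 : ℝ) 1).norm_image_sub_le_of_norm_derivWithin_le
      (ha.differentiableOn one_ne_zero) (fun t ht => (h₄ t ht).trans m4) hz hy

namespace CoeffBounds

variable {x : ℕ → ℝ} {n k : ℕ} {ε : ℝ} {a b : ℝ → ℝ} {α β A : ℝ}

theorem bound_pos (hc : CoeffBounds a b α β A) : 0 < A :=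
  hc.alpha_pos.trans_le ((hc.alpha_le 0 (by simp)).trans (hc.a_le 0 (by simp)))

end CoeffBounds

/-! ### The energy norm -/

section Energy

variable {x : ℕ → ℝ} {n k : ℕ} {ε : ℝ} {a b : ℝ → ℝ} {α β A : ℝ}

theorem IsMesh.mem_left (hx : IsMesh x (n + 1)) {j : ℕ} (hj : j ∈ Finset.Icc 1 (n + 1)) :
    x (j - 1) ∈ Icc (0 : ℝ) 1 := hx.sub j hj (left_mem_Icc.2 (hx.le j hj))

theorem IsMesh.mem_right (hx : IsMesh x (n + 1)) {j : ℕ} (hj : j ∈ Finset.Icc 1 (n + 1)) :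
    x j ∈ Icc (0 : ℝ) 1 := hx.sub j hj (right_mem_Icc.2 (hx.le j hj))

theorem IsMesh.mem (hx : IsMesh x (n + 1)) {j : ℕ} (hj : j ∈ Finset.range (n + 1 + 1)) :
    x j ∈ Icc (0 : ℝ) 1 := by
  rw [Finset.mem_range] at hj
  rcases Nat.eq_zero_or_pos j with rfl | h
  · exact hx.mem_left (j := 1) (Finset.mem_Icc.2 ⟨le_rfl, by omega⟩)
  · exact hx.mem_right (Finset.mem_Icc.2 ⟨h, by omega⟩)

theorem IsMesh.penalty_nonneg (hx : IsMesh x (n + 1)) (hε : 0 < ε) : 0 ≤ penalty x (n + 1) ε :=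
  div_nonneg hε.le (sub_nonneg.2 (hx.le (n + 1) (Finset.mem_Icc.2 ⟨by omega, le_rfl⟩)))

theorem jump_terms_nonneg (hx : IsMesh x (n + 1)) (hc : CoeffBounds a b α β A) (u : Broken)
    {j : ℕ} (hj : j ∈ Finset.range (n + 1 + 1)) :
    0 ≤ 1 / 2 * a (x j) * jump x (n + 1) u j ^ 2 := by
  have := hc.alpha_pos.le.trans (hc.alpha_le _ (hx.mem hj))
  positivity

/-- The last bound controls the outflow trace through the jump at `x_N`, uniformly in `ε/h_N`; it
handles the boundary term left by the flux projection. -/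
theorem energySq_bounds (hx : IsMesh x (n + 1)) (hc : CoeffBounds a b α β A) (hε : 0 < ε)
    {u : Broken} (hu : ElementwiseContinuous x (n + 1) u) (q : Broken) :
    0 ≤ energySq x (n + 1) ε a b u q ∧
    ε⁻¹ * ip x (n + 1) q q ≤ energySq x (n + 1) ε a b u q ∧
    β * ip x (n + 1) u u ≤ energySq x (n + 1) ε a b u q ∧
    α / 2 * u (n + 1) (x (n + 1)) ^ 2 ≤ energySq x (n + 1) ε a b u q := by
  have hα := hc.alpha_pos
  have hβ := hc.beta_pos
  have h1 : 0 ≤ ε⁻¹ * ip x (n + 1) q q :=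
    mul_nonneg (inv_nonneg.2 hε.le) (ip_self_nonneg hx.le q)
  have h0 : 0 ≤ β * ip x (n + 1) u u := mul_nonneg hβ.le (ip_self_nonneg hx.le u)
  have hrc : ElementwiseContinuous x (n + 1) (fun _ y => b y - dx a y / 2) :=
    elementwiseContinuous_of_continuousOn
      (hc.continuousOn.sub ((continuousOn_dx hc.contDiffOn).div_const 2)) hx.sub
  have h2 : β * ip x (n + 1) u u ≤ ip x (n + 1) (fun j y => (b y - dx a y / 2) * u j y) u := by
    have e := ip_comb_left hx.le hu hu hu β 0
    simp only [zero_mul, add_zero] at e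
    rw [← e]
    refine ip_mono hx.le (hu.const_mul β) hu (hrc.mul hu) hu fun j hj y hy => ?_
    have := hc.beta_le y (hx.sub j hj hy)
    nlinarith [mul_self_nonneg (u j y)]
  have h3 : 0 ≤ ∑ j ∈ Finset.range (n + 1 + 1), 1 / 2 * a (x j) * jump x (n + 1) u j ^ 2 :=
    Finset.sum_nonneg fun j hj => jump_terms_nonneg hx hc u hj
  have h4 : 0 ≤ penalty x (n + 1) ε * jump x (n + 1) u (n + 1) ^ 2 :=
    mul_nonneg (hx.penalty_nonneg hε) (sq_nonneg _)
  have h5 : α / 2 * u (n + 1) (x (n + 1)) ^ 2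
      ≤ ∑ j ∈ Finset.range (n + 1 + 1), 1 / 2 * a (x j) * jump x (n + 1) u j ^ 2 := by
    have hm : n + 1 ∈ Finset.range (n + 1 + 1) := Finset.self_mem_range_succ _
    refine le_trans ?_ (Finset.single_le_sum
      (f := fun j => 1 / 2 * a (x j) * jump x (n + 1) u j ^ 2)
      (fun j hj => jump_terms_nonneg hx hc u hj) hm)
    have := hc.alpha_le _ (hx.mem hm)
    rw [jump_last, neg_sq]
    nlinarith [sq_nonneg (u (n + 1) (x (n + 1)))]
  unfold energySq
  refine ⟨?_, ?_, ?_, ?_⟩ <;> linarith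

theorem sq_energyNorm (hx : IsMesh x (n + 1)) (hc : CoeffBounds a b α β A) (hε : 0 < ε)
    {u : Broken} (hu : ElementwiseContinuous x (n + 1) u) (q : Broken) :
    energyNorm x (n + 1) ε a b u q ^ 2 = energySq x (n + 1) ε a b u q :=
  Real.sq_sqrt (energySq_bounds hx hc hε hu q).1

/-- The weighted form of `(u + v)² ≤ 2u² + 2v²`, obtained by adding the nonnegative square of `u -
v`. -/
theorem ip_add_sq_le (hx : IsMesh x (n + 1)) {w u v : Broken}
    (hw : ElementwiseContinuous x (n + 1) w) (hu : ElementwiseContinuous x (n + 1) u)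
    (hv : ElementwiseContinuous x (n + 1) v)
    (hpos : ∀ j ∈ Finset.Icc 1 (n + 1), ∀ y ∈ Icc (x (j - 1)) (x j), 0 ≤ w j y) :
    ip x (n + 1) (fun j y => w j y * (u j y + v j y)) (fun j y => u j y + v j y)
      ≤ 2 * (ip x (n + 1) (fun j y => w j y * u j y) u
        + ip x (n + 1) (fun j y => w j y * v j y) v) := by
  have key := ip_nonneg hx.le (u := fun j y => w j y * (u j y - v j y))
    (v := fun j y => u j y - v j y) fun j hj y hy => by
      have := hpos j hj y hy
      rw [mul_assoc]
      exact mul_nonneg this (mul_self_nonneg _)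
  have expand : ∀ s : ℝ, ip x (n + 1) (fun j y => w j y * (1 * u j y + s * v j y))
      (fun j y => 1 * u j y + s * v j y)
      = ip x (n + 1) (fun j y => w j y * u j y) u
        + 2 * s * ip x (n + 1) (fun j y => w j y * u j y) v
        + s ^ 2 * ip x (n + 1) (fun j y => w j y * v j y) v := by
    intro s
    have e1 : ip x (n + 1) (fun j y => w j y * (1 * u j y + s * v j y))
        (fun j y => 1 * u j y + s * v j y)
        = ip x (n + 1) (fun j y => 1 * (w j y * u j y) + s * (w j y * v j y))
          (fun j y => 1 * u j y + s * v j y) := ip_congr hx.le fun j _ y _ => by ring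
    have e2 : ip x (n + 1) (fun j y => w j y * v j y) u
        = ip x (n + 1) (fun j y => w j y * u j y) v := ip_congr hx.le fun j _ y _ => by ring
    rw [e1, ip_comb_left hx.le (hw.mul hu) (hw.mul hv) (hu.comb 1 s hv),
      ip_comb_right hx.le hu hv (hw.mul hu), ip_comb_right hx.le hu hv (hw.mul hv), e2]
    ring
  have h1 := expand 1
  have h2 := expand (-1)
  simp only [one_mul, neg_mul, ← sub_eq_add_neg] at h1 h2
  rw [h2] at key
  rw [h1]
  linarith

theorem jump_add (x : ℕ → ℝ) (N : ℕ) (u v : Broken) (j : ℕ) :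
    jump x N (fun j y => u j y + v j y) j = jump x N u j + jump x N v j := by
  unfold jump traceL traceR
  split_ifs <;> ring

theorem energySq_add_le (hx : IsMesh x (n + 1)) (hc : CoeffBounds a b α β A) (hε : 0 < ε)
    {u₁ u₂ q₁ q₂ : Broken} (hu₁ : ElementwiseContinuous x (n + 1) u₁)
    (hu₂ : ElementwiseContinuous x (n + 1) u₂) (hq₁ : ElementwiseContinuous x (n + 1) q₁)
    (hq₂ : ElementwiseContinuous x (n + 1) q₂) :
    energySq x (n + 1) ε a b (fun j y => u₁ j y + u₂ j y) (fun j y => q₁ j y + q₂ j y)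
      ≤ 2 * (energySq x (n + 1) ε a b u₁ q₁ + energySq x (n + 1) ε a b u₂ q₂) := by
  have hone : ElementwiseContinuous x (n + 1) (fun _ _ => (1 : ℝ)) :=
    fun _ _ => continuousOn_const
  have hrc : ElementwiseContinuous x (n + 1) (fun _ y => b y - dx a y / 2) :=
    elementwiseContinuous_of_continuousOn
      (hc.continuousOn.sub ((continuousOn_dx hc.contDiffOn).div_const 2)) hx.sub
  have h1 := ip_add_sq_le hx hone hq₁ hq₂ fun _ _ _ _ => zero_le_one
  simp only [one_mul] at h1
  have h1' := mul_le_mul_of_nonneg_left h1 (inv_nonneg.2 hε.le)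
  have h2 := ip_add_sq_le hx hrc hu₁ hu₂ fun j hj y hy =>
    hc.beta_pos.le.trans (hc.beta_le y (hx.sub j hj hy))
  have hsq : ∀ s t c : ℝ, 0 ≤ c → c * (s + t) ^ 2 ≤ 2 * (c * s ^ 2 + c * t ^ 2) := by
    intro s t c hc
    nlinarith [mul_nonneg hc (sq_nonneg (s - t))]
  have h3 : ∑ j ∈ Finset.range (n + 1 + 1),
        1 / 2 * a (x j) * jump x (n + 1) (fun j y => u₁ j y + u₂ j y) j ^ 2
      ≤ 2 * (∑ j ∈ Finset.range (n + 1 + 1), 1 / 2 * a (x j) * jump x (n + 1) u₁ j ^ 2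
        + ∑ j ∈ Finset.range (n + 1 + 1), 1 / 2 * a (x j) * jump x (n + 1) u₂ j ^ 2) := by
    rw [← Finset.sum_add_distrib, Finset.mul_sum]
    refine Finset.sum_le_sum fun j hj => ?_
    rw [jump_add]
    refine hsq _ _ _ ?_
    have := hc.alpha_pos.le.trans (hc.alpha_le _ (hx.mem hj))
    positivity
  have h4 := hsq (jump x (n + 1) u₁ (n + 1)) (jump x (n + 1) u₂ (n + 1)) _ (hx.penalty_nonneg hε)
  rw [← jump_add] at h4
  unfold energySq
  linarith

theorem l2norm_add_le (hx : IsMesh x (n + 1)) {u v : Broken}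
    (hu : ElementwiseContinuous x (n + 1) u) (hv : ElementwiseContinuous x (n + 1) v) :
    l2norm x (n + 1) (fun j y => u j y + v j y) ≤ l2norm x (n + 1) u + l2norm x (n + 1) v := by
  refine Real.sqrt_le_iff.2 ⟨add_nonneg (Real.sqrt_nonneg _) (Real.sqrt_nonneg _), ?_⟩
  have e := ip_comb_left hx.le hu hv (hu.comb 1 1 hv) 1 1
  rw [ip_comb_right hx.le hu hv hu, ip_comb_right hx.le hu hv hv, ip_comm v u] at e
  simp only [one_mul] at e
  have h := (le_abs_self _).trans (abs_ip_le hx.le hu hv)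
  rw [e, add_sq, sq_l2norm hx.le, sq_l2norm hx.le]
  linarith

end Energy

/-! ### The projection error in the bilinear form -/

section Projection

variable {x : ℕ → ℝ} {n k : ℕ} {ε : ℝ} {a b : ℝ → ℝ} {α β A : ℝ} {g p : ℝ → ℝ}

/-- The error of the projection with right nodes. -/
def errR (x : ℕ → ℝ) (k : ℕ) (g : ℝ → ℝ) : Broken := fun j y => g y - radauR x k g j y

/-- The error of the projection with left nodes. -/
def errL (x : ℕ → ℝ) (k : ℕ) (g : ℝ → ℝ) : Broken := fun j y => g y - radauL x k g j y

theorem errR_elementwiseContinuous {N : ℕ} (hx : IsMesh x N) (hg : ContinuousOn g (Icc 0 1)) :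
    ElementwiseContinuous x N (errR x k g) :=
  (elementwiseContinuous_of_continuousOn hg hx.sub).sub
    (isDiscrete_radauR x N k g).elementwiseContinuous

theorem errL_elementwiseContinuous {N : ℕ} (hx : IsMesh x N) (hg : ContinuousOn g (Icc 0 1)) :
    ElementwiseContinuous x N (errL x k g) :=
  (elementwiseContinuous_of_continuousOn hg hx.sub).sub
    (isDiscrete_radauL x N k g).elementwiseContinuous

theorem errR_node {j : ℕ} (h : x (j - 1) ≠ x j) : errR x k g j (x j) = 0 := by
  rw [errR, radauR, radauOn_eval_node h, sub_self]

theorem errL_node {j : ℕ} (h : x (j - 1) ≠ x j) : errL x k g j (x (j - 1)) = 0 := by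
  rw [errL, radauL, radauOn_eval_node h.symm, sub_self]

theorem integral_errR_mul {N : ℕ} (hx : IsMesh x N) (hg : ContinuousOn g (Icc 0 1)) {v : Broken}
    (hv : IsDiscrete N k v) {j : ℕ} (hj : j ∈ Finset.Icc 1 N) :
    ∫ y in (x (j - 1))..(x j), errR x k g j y * brokenDeriv v j y = 0 := by
  obtain ⟨p, hpk, -, hp⟩ := hv.exists_polynomial hj
  rw [hp]
  exact radauOn_orthogonal (hg.mono (by rw [uIcc_of_le (hx.le j hj)]; exact hx.sub j hj)) hpk

theorem integral_errL_mul {N : ℕ} (hx : IsMesh x N) (hg : ContinuousOn g (Icc 0 1)) {v : Broken}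
    (hv : IsDiscrete N k v) {j : ℕ} (hj : j ∈ Finset.Icc 1 N) :
    ∫ y in (x (j - 1))..(x j), errL x k g j y * brokenDeriv v j y = 0 := by
  obtain ⟨p, hpk, -, hp⟩ := hv.exists_polynomial hj
  rw [hp, intervalIntegral.integral_symm, neg_eq_zero]
  exact radauOn_orthogonal (hg.mono (by rw [uIcc_of_ge (hx.le j hj)]; exact hx.sub j hj)) hpk

/-- Interior traces taken by the fluxes vanish at the nodes of the projections, as do those of the
`u`-error at `x_N` and of the flux error at `x_0`; orthogonality removes the terms with derivatives.
The flux error at `x_N` is the only trace not interpolated. -/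
theorem formB_projection_error (hx : IsMesh x (n + 1))
    (hlt : ∀ j ∈ Finset.Icc 1 (n + 1), x (j - 1) < x j) (hc : CoeffBounds a b α β A)
    (hg : ContinuousOn g (Icc 0 1)) (hp : ContinuousOn p (Icc 0 1)) {v r : Broken}
    (hv : IsDiscrete (n + 1) k v) (hr : IsDiscrete (n + 1) k r) :
    formB x (n + 1) ε a b (errR x k g) (errL x k p) v r
      = ε⁻¹ * ip x (n + 1) (errL x k p) r
        + ip x (n + 1) (fun j y => (b y - dx a y) * errR x k g j y) v
        - errL x k p (n + 1) (x (n + 1)) * v (n + 1) (x (n + 1))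
        - ip x (n + 1) (fun j y => (a y - a (x j)) * errR x k g j y) (brokenDeriv v) := by
  have hN : n + 1 ∈ Finset.Icc 1 (n + 1) := Finset.mem_Icc.2 ⟨by omega, le_rfl⟩
  have e1 : ip x (n + 1) (errR x k g) (brokenDeriv r) = 0 :=
    Finset.sum_eq_zero fun j hj => integral_errR_mul hx hg hr hj
  have e2 : ip x (n + 1) (errL x k p) (brokenDeriv v) = 0 :=
    Finset.sum_eq_zero fun j hj => integral_errL_mul hx hp hv hj
  have hac : ElementwiseContinuous x (n + 1) (fun _ => a) :=
    elementwiseContinuous_of_continuousOn hc.contDiffOn.continuousOn hx.sub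
  have hgc : ElementwiseContinuous x (n + 1) (errR x k g) := errR_elementwiseContinuous hx hg
  have hvc' : ElementwiseContinuous x (n + 1) (brokenDeriv v) := hv.elementwiseContinuous_deriv
  have hmem : ∀ j ∈ Finset.Icc 1 n, j ∈ Finset.Icc 1 (n + 1) ∧ j + 1 ∈ Finset.Icc 1 (n + 1) := by
    intro j hj
    simp only [Finset.mem_Icc] at hj ⊢
    omega
  -- By orthogonality, a constant may be subtracted from `a` on each element; `a - a(x_j)` is of
  -- order `h_j`.
  have e3 : ip x (n + 1) (fun j y => a y * errR x k g j y) (brokenDeriv v)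
      = ip x (n + 1) (fun j y => (a y - a (x j)) * errR x k g j y) (brokenDeriv v) := by
    refine Finset.sum_congr rfl fun j hj => ?_
    have h1 := ((hac.mul hgc).mul hvc').intervalIntegrable hx.le hj
    have h2 := (hgc.mul hvc').intervalIntegrable hx.le hj
    have h3 : ∫ y in (x (j - 1))..(x j), (a y - a (x j)) * errR x k g j y * brokenDeriv v j y
        = (∫ y in (x (j - 1))..(x j), a y * errR x k g j y * brokenDeriv v j y)
          - ∫ y in (x (j - 1))..(x j), a (x j) * (errR x k g j y * brokenDeriv v j y) := by
      rw [← intervalIntegral.integral_sub h1 (h2.const_mul _)]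
      congr 1
      ext y
      ring
    rw [h3, intervalIntegral.integral_const_mul, integral_errR_mul hx hg hv hj, mul_zero, sub_zero]
  have s1 : ∀ c : ℕ → ℝ, ∑ j ∈ Finset.Icc 1 n, errR x k g j (x j) * c j = 0 := fun c =>
    Finset.sum_eq_zero fun j hj => by rw [errR_node (hlt j (hmem j hj).1).ne, zero_mul]
  have s2 : ∀ c : ℕ → ℝ, ∑ j ∈ Finset.Icc 1 n, errL x k p (j + 1) (x j) * c j = 0 := fun c =>
    Finset.sum_eq_zero fun j hj => by
      have := errL_node (k := k) (g := p) (hlt (j + 1) (hmem j hj).2).ne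
      rw [Nat.add_sub_cancel] at this
      rw [this, zero_mul]
  have s3 : ∀ c : ℕ → ℝ, ∑ j ∈ Finset.Icc 1 n, a (x j) * errR x k g j (x j) * c j = 0 := fun c =>
    Finset.sum_eq_zero fun j hj => by rw [errR_node (hlt j (hmem j hj).1).ne]; ring
  have t1 : errR x k g (n + 1) (x (n + 1)) = 0 := errR_node (hlt _ hN).ne
  have t2 : errL x k p 1 (x 0) = 0 :=
    errL_node (j := 1) (hlt 1 (Finset.mem_Icc.2 ⟨le_rfl, by omega⟩)).ne
  rw [formB_eq, e1, e2, e3, s1, s2, s3, t1, t2]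
  ring

/-- The inverse inequality, weighted with the local mesh size. -/
theorem exists_inverse_inequality (k : ℕ) : ∃ B : ℝ, 0 ≤ B ∧
    ∀ (x : ℕ → ℝ) (N : ℕ), (∀ j ∈ Finset.Icc 1 N, x (j - 1) < x j) → ∀ v, IsDiscrete N k v →
      l2norm x N (fun j y => (x j - x (j - 1)) * brokenDeriv v j y) ≤ B * l2norm x N v := by
  obtain ⟨B, hB, h⟩ := polynomial_derivative_bound k
  refine ⟨Real.sqrt B, Real.sqrt_nonneg _, fun x N hx v hv => ?_⟩
  rw [l2norm, l2norm, ← Real.sqrt_mul hB]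
  refine Real.sqrt_le_sqrt ?_
  rw [ip, ip, Finset.mul_sum]
  refine Finset.sum_le_sum fun j hj => ?_
  obtain ⟨p, hpk, h1, h2⟩ := hv.exists_polynomial hj
  have := h (x (j - 1)) (x j) p (hx j hj) hpk
  rw [h1, h2]
  have e1 : ∫ y in (x (j - 1))..(x j), (x j - x (j - 1)) * (derivative p).eval y
      * ((x j - x (j - 1)) * (derivative p).eval y)
      = (x j - x (j - 1)) ^ 2 * ∫ y in (x (j - 1))..(x j), (derivative p).eval y ^ 2 := by
    rw [← intervalIntegral.integral_const_mul]
    congr 1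
    ext y
    ring
  simp only [← sq] at e1 ⊢
  rw [e1]
  exact this

/-- The constant is fixed before the mesh and `ε`, which is the uniformity claimed in the theorem.
-/
theorem exists_formB_projection_bound (k : ℕ) (α β A : ℝ) (hα : 0 < α) (hβ : 0 < β) (hA : 0 ≤ A) :
    ∃ C : ℝ, 0 ≤ C ∧ ∀ (a b : ℝ → ℝ) (x : ℕ → ℝ) (n : ℕ) (ε : ℝ) (g p : ℝ → ℝ) (v r : Broken)
      (R : ℝ), CoeffBounds a b α β A → IsMesh x (n + 1) → x 0 = 0 → x (n + 1) = 1 →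
      (∀ j ∈ Finset.Icc 1 (n + 1), x (j - 1) < x j) → 0 < ε →
      ContinuousOn g (Icc 0 1) → ContinuousOn p (Icc 0 1) →
      IsDiscrete (n + 1) k v → IsDiscrete (n + 1) k r → 0 ≤ R →
      (∀ j ∈ Finset.Icc 1 (n + 1), ∀ y ∈ Icc (x (j - 1)) (x j), |errR x k g j y| ≤ R) →
      |errL x k p (n + 1) (x (n + 1))| ≤ R →
      ε⁻¹ * ip x (n + 1) (errL x k p) (errL x k p) ≤ R ^ 2 →
      |formB x (n + 1) ε a b (errR x k g) (errL x k p) v r|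
        ≤ C * R * energyNorm x (n + 1) ε a b v r := by
  obtain ⟨B, hB, hinv⟩ := exists_inverse_inequality k
  -- The summands belong to the bounds `t1` to `t4` below: flux, reaction, outflow trace, variable
  -- convection.
  refine ⟨1 + A * Real.sqrt β⁻¹ + Real.sqrt (2 / α) + A * B * Real.sqrt β⁻¹, by positivity, ?_⟩
  intro a b x n ε g p v r R hc hx hx0 hx1 hlt hε hg hp hv hr hR h1 h2 h3
  have hvc : ElementwiseContinuous x (n + 1) v := hv.elementwiseContinuous
  have hrc : ElementwiseContinuous x (n + 1) r := hr.elementwiseContinuous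
  have hvc' : ElementwiseContinuous x (n + 1) (brokenDeriv v) := hv.elementwiseContinuous_deriv
  have hgc : ElementwiseContinuous x (n + 1) (errR x k g) := errR_elementwiseContinuous hx hg
  have hpc : ElementwiseContinuous x (n + 1) (errL x k p) := errL_elementwiseContinuous hx hp
  have hac : ElementwiseContinuous x (n + 1) (fun _ => a) :=
    elementwiseContinuous_of_continuousOn hc.contDiffOn.continuousOn hx.sub
  have hbc : ElementwiseContinuous x (n + 1) (fun _ y => b y - dx a y) :=
    elementwiseContinuous_of_continuousOn (hc.continuousOn.sub (continuousOn_dx hc.contDiffOn))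
      hx.sub
  have h01 : x (n + 1) - x 0 ≤ 1 := by rw [hx0, hx1, sub_zero]
  obtain ⟨-, b1, b2, b3⟩ := energySq_bounds hx hc hε hvc r
  set Y := energyNorm x (n + 1) ε a b v r with hY
  have hY0 : 0 ≤ Y := Real.sqrt_nonneg _
  rw [← sq_energyNorm hx hc hε hvc, ← hY] at b1 b2 b3
  -- norms of the test functions
  have v1 : l2norm x (n + 1) v ≤ Real.sqrt β⁻¹ * Y := by
    refine Real.sqrt_le_iff.2 ⟨by positivity, ?_⟩
    rw [mul_pow, Real.sq_sqrt (by positivity), inv_mul_eq_div, le_div_iff₀ hβ]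
    linarith
  have v2 : |v (n + 1) (x (n + 1))| ≤ Real.sqrt (2 / α) * Y := by
    refine abs_le_of_sq_le_sq ?_ (by positivity)
    rw [mul_pow, Real.sq_sqrt (by positivity), div_mul_eq_mul_div, le_div_iff₀ hα]
    linarith
  -- the four terms
  have t1 : |ε⁻¹ * ip x (n + 1) (errL x k p) r| ≤ R * Y := by
    refine abs_le_of_sq_le_sq ?_ (by positivity)
    have hcs := abs_ip_le hx.le hpc hrc
    have hcs2 : ip x (n + 1) (errL x k p) r ^ 2
        ≤ ip x (n + 1) (errL x k p) (errL x k p) * ip x (n + 1) r r := by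
      rw [← sq_abs, ← sq_l2norm hx.le, ← sq_l2norm hx.le, ← mul_pow]
      exact pow_le_pow_left₀ (abs_nonneg _) hcs 2
    calc (ε⁻¹ * ip x (n + 1) (errL x k p) r) ^ 2
        = ε⁻¹ ^ 2 * ip x (n + 1) (errL x k p) r ^ 2 := by ring
      _ ≤ ε⁻¹ ^ 2 * (ip x (n + 1) (errL x k p) (errL x k p) * ip x (n + 1) r r) := by gcongr
      _ = (ε⁻¹ * ip x (n + 1) (errL x k p) (errL x k p)) * (ε⁻¹ * ip x (n + 1) r r) := by ring
      _ ≤ R ^ 2 * Y ^ 2 := mul_le_mul h3 b1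
          (mul_nonneg (inv_nonneg.2 hε.le) (ip_self_nonneg hx.le r)) (sq_nonneg _)
      _ = (R * Y) ^ 2 := by ring
  have t2 : |ip x (n + 1) (fun j y => (b y - dx a y) * errR x k g j y) v|
      ≤ A * Real.sqrt β⁻¹ * R * Y := by
    have h4 : l2norm x (n + 1) (fun j y => (b y - dx a y) * errR x k g j y) ≤ A * R := by
      refine l2norm_le_of_sup hx.le h01 (hbc.mul hgc) (by positivity) fun j hj y hy => ?_
      rw [abs_mul]
      exact mul_le_mul (hc.abs_le y (hx.sub j hj hy)) (h1 j hj y hy) (abs_nonneg _) hA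
    refine (abs_ip_le hx.le (hbc.mul hgc) hvc).trans ?_
    refine (mul_le_mul h4 v1 (Real.sqrt_nonneg _) (by positivity)).trans (le_of_eq ?_)
    ring
  have t3 : |errL x k p (n + 1) (x (n + 1)) * v (n + 1) (x (n + 1))|
      ≤ Real.sqrt (2 / α) * R * Y := by
    rw [abs_mul]
    refine (mul_le_mul h2 v2 (abs_nonneg _) hR).trans (le_of_eq ?_)
    ring
  have t4 : |ip x (n + 1) (fun j y => (a y - a (x j)) * errR x k g j y) (brokenDeriv v)|
      ≤ A * B * Real.sqrt β⁻¹ * R * Y := by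
    have hac2 : ElementwiseContinuous x (n + 1)
        (fun j y => (x j - x (j - 1))⁻¹ * (a y - a (x j))) := fun j hj =>
      continuousOn_const.mul ((hac j hj).sub continuousOn_const)
    have hdc : ElementwiseContinuous x (n + 1)
        (fun j y => (x j - x (j - 1)) * brokenDeriv v j y) := fun j hj =>
      continuousOn_const.mul (hvc' j hj)
    -- A factor `h_j` is shifted to the derivative: the Lipschitz bound of `a` supplies it, the
    -- inverse inequality consumes it.
    have e : ip x (n + 1) (fun j y => (a y - a (x j)) * errR x k g j y) (brokenDeriv v)
        = ip x (n + 1) (fun j y => ((x j - x (j - 1))⁻¹ * (a y - a (x j))) * errR x k g j y)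
          (fun j y => (x j - x (j - 1)) * brokenDeriv v j y) := by
      refine ip_congr hx.le fun j hj y _ => ?_
      have : x j - x (j - 1) ≠ 0 := (sub_pos.2 (hlt j hj)).ne'
      field_simp
    have h4 : l2norm x (n + 1)
        (fun j y => ((x j - x (j - 1))⁻¹ * (a y - a (x j))) * errR x k g j y) ≤ A * R := by
      refine l2norm_le_of_sup hx.le h01 (hac2.mul hgc) (by positivity) fun j hj y hy => ?_
      have hpos := sub_pos.2 (hlt j hj)
      rw [abs_mul]
      refine mul_le_mul ?_ (h1 j hj y hy) (abs_nonneg _) hA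
      rw [abs_mul, abs_inv, abs_of_pos hpos, inv_mul_le_iff₀ hpos]
      refine (hc.lipschitz y (hx.sub j hj hy) _ (hx.mem_right hj)).trans ?_
      rw [mul_comm]
      refine mul_le_mul_of_nonneg_right ?_ hA
      rw [abs_sub_comm, abs_of_nonneg (sub_nonneg.2 hy.2)]
      linarith [hy.1]
    rw [e]
    refine (abs_ip_le hx.le (hac2.mul hgc) hdc).trans ?_
    refine (mul_le_mul h4 ((hinv x (n + 1) hlt v hv).trans (mul_le_mul_of_nonneg_left v1 hB))
      (Real.sqrt_nonneg _) (by positivity)).trans (le_of_eq ?_)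
    ring
  rw [formB_projection_error hx hlt hc hg hp hv hr]
  rw [abs_le] at t1 t2 t3 t4 ⊢
  constructor <;> linarith [t1.1, t1.2, t2.1, t2.2, t3.1, t3.2, t4.1, t4.2]

/-- The energy norm of the projection error. -/
theorem energySq_projection_error_le (hx : IsMesh x (n + 1)) (hx0 : x 0 = 0) (hx1 : x (n + 1) = 1)
    (hlt : ∀ j ∈ Finset.Icc 1 (n + 1), x (j - 1) < x j) (hc : CoeffBounds a b α β A)
    (hg : ContinuousOn g (Icc 0 1)) {R S : ℝ} (hR : 0 ≤ R)
    (h1 : ∀ j ∈ Finset.Icc 1 (n + 1), ∀ y ∈ Icc (x (j - 1)) (x j), |errR x k g j y| ≤ R)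
    (h2 : ∑ j ∈ Finset.Icc 1 (n + 1), errR x k g j (x (j - 1)) ^ 2 ≤ S)
    (h3 : ε⁻¹ * ip x (n + 1) (errL x k p) (errL x k p) ≤ R ^ 2) :
    energySq x (n + 1) ε a b (errR x k g) (errL x k p) ≤ (1 + A) * R ^ 2 + A * S := by
  have hA := hc.bound_pos
  have hgc : ElementwiseContinuous x (n + 1) (errR x k g) := errR_elementwiseContinuous hx hg
  have hrc : ElementwiseContinuous x (n + 1) (fun _ y => b y - dx a y / 2) :=
    elementwiseContinuous_of_continuousOn
      (hc.continuousOn.sub ((continuousOn_dx hc.contDiffOn).div_const 2)) hx.sub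
  have hN : n + 1 ∈ Finset.Icc 1 (n + 1) := Finset.mem_Icc.2 ⟨by omega, le_rfl⟩
  -- The error vanishes at right nodes, so the penalty term drops out and each interior jump reduces
  -- to the value at the left end of the next element.
  have t1 : errR x k g (n + 1) (x (n + 1)) = 0 := errR_node (hlt _ hN).ne
  have e1 : ip x (n + 1) (fun j y => (b y - dx a y / 2) * errR x k g j y) (errR x k g)
      ≤ A * R ^ 2 := by
    have h4 : ip x (n + 1) (fun j y => (b y - dx a y / 2) * errR x k g j y) (errR x k g)
        ≤ A * ip x (n + 1) (errR x k g) (errR x k g) := by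
      have e := ip_comb_left hx.le hgc hgc hgc A 0
      simp only [zero_mul, add_zero] at e
      rw [← e]
      refine ip_mono hx.le (hrc.mul hgc) hgc (hgc.const_mul A) hgc fun j hj y hy => ?_
      have := hc.reaction_le y (hx.sub j hj hy)
      nlinarith [mul_self_nonneg (errR x k g j y)]
    refine h4.trans (mul_le_mul_of_nonneg_left ?_ hA.le)
    rw [← sq_l2norm hx.le]
    exact pow_le_pow_left₀ (Real.sqrt_nonneg _)
      (l2norm_le_of_sup hx.le (by rw [hx0, hx1, sub_zero]) hgc hR h1) 2
  have e2 : ∑ j ∈ Finset.range (n + 1 + 1), 1 / 2 * a (x j) * jump x (n + 1) (errR x k g) j ^ 2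
      ≤ A * S := by
    have hS : A * ∑ j ∈ Finset.Icc 1 (n + 1), errR x k g j (x (j - 1)) ^ 2 ≤ A * S :=
      mul_le_mul_of_nonneg_left h2 hA.le
    refine le_trans ?_ hS
    rw [sum_jump_sq_eq, t1, Finset.mul_sum,
      sum_Icc_eq_first (fun j => A * errR x k g j (x (j - 1)) ^ 2)]
    have hhalf : ∀ y ∈ Icc (0 : ℝ) 1, ∀ s : ℝ, 1 / 2 * a y * s ^ 2 ≤ A * s ^ 2 := by
      intro y hy s
      have h5 := hc.a_le y hy
      have : 1 / 2 * a y ≤ A := by linarith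
      exact mul_le_mul_of_nonneg_right this (sq_nonneg s)
    have hsum : ∑ j ∈ Finset.Icc 1 n,
        1 / 2 * a (x j) * (errR x k g (j + 1) (x j) - errR x k g j (x j)) ^ 2
        ≤ ∑ j ∈ Finset.Icc 1 n, A * errR x k g (j + 1) (x (j + 1 - 1)) ^ 2 := by
      refine Finset.sum_le_sum fun j hj => ?_
      have hj' : j ∈ Finset.Icc 1 (n + 1) := by
        simp only [Finset.mem_Icc] at hj ⊢
        omega
      rw [errR_node (hlt j hj').ne, sub_zero, Nat.add_sub_cancel]
      exact hhalf _ (hx.mem_right hj') _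
    have h0 := hhalf (x 0) (by rw [hx0]; simp) (errR x k g 1 (x 0))
    simp only [Nat.sub_self]
    linarith
  unfold energySq
  rw [jump_last, t1]
  linarith

end Projection

end

/-! ### Smooth functions on the space-time box -/

/-- `F` is smooth on `[0,1] × [0,T]`. -/
def SmoothOnBox (T : ℝ) (F : ℝ → ℝ → ℝ) : Prop :=
  ContDiffOn ℝ (⊤ : ℕ∞) (fun z : ℝ × ℝ => F z.1 z.2) (Icc 0 1 ×ˢ Icc 0 T)

/-- The space derivative on the box. -/
def boxDx (F : ℝ → ℝ → ℝ) : ℝ → ℝ → ℝ := fun x t => derivWithin (fun y => F y t) (Icc 0 1) x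

/-- The time derivative on the box. -/
def boxDt (T : ℝ) (F : ℝ → ℝ → ℝ) : ℝ → ℝ → ℝ := fun x t => derivWithin (F x) (Icc 0 T) t

section Box

variable {T : ℝ} {F G : ℝ → ℝ → ℝ}

theorem uniqueDiffOn_box (hT : 0 < T) : UniqueDiffOn ℝ (Icc (0 : ℝ) 1 ×ˢ Icc (0 : ℝ) T) :=
  (uniqueDiffOn_Icc zero_lt_one).prod (uniqueDiffOn_Icc hT)

namespace SmoothOnBox

theorem congr (hF : SmoothOnBox T F)
    (h : ∀ x ∈ Icc (0 : ℝ) 1, ∀ t ∈ Icc (0 : ℝ) T, G x t = F x t) : SmoothOnBox T G :=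
  ContDiffOn.congr hF fun z hz => h z.1 hz.1 z.2 hz.2

theorem add (hF : SmoothOnBox T F) (hG : SmoothOnBox T G) :
    SmoothOnBox T (fun x t => F x t + G x t) :=
  ContDiffOn.add hF hG

theorem space (hF : SmoothOnBox T F) {t : ℝ} (ht : t ∈ Icc (0 : ℝ) T) :
    ContDiffOn ℝ (⊤ : ℕ∞) (fun y => F y t) (Icc 0 1) :=
  ContDiffOn.comp (g := fun z : ℝ × ℝ => F z.1 z.2) (f := fun y : ℝ => (y, t)) hF
    (by fun_prop) fun _ hy => ⟨hy, ht⟩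

theorem time (hF : SmoothOnBox T F) {x : ℝ} (hx : x ∈ Icc (0 : ℝ) 1) :
    ContDiffOn ℝ (⊤ : ℕ∞) (F x) (Icc 0 T) :=
  ContDiffOn.comp (g := fun z : ℝ × ℝ => F z.1 z.2) (f := fun t : ℝ => (x, t)) hF
    (by fun_prop) fun _ ht => ⟨hx, ht⟩

theorem hasFDerivWithinAt (hF : SmoothOnBox T F) {z : ℝ × ℝ}
    (hz : z ∈ Icc (0 : ℝ) 1 ×ˢ Icc (0 : ℝ) T) :
    HasFDerivWithinAt (fun z : ℝ × ℝ => F z.1 z.2)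
      (fderivWithin ℝ (fun z : ℝ × ℝ => F z.1 z.2) (Icc 0 1 ×ˢ Icc 0 T) z)
      (Icc 0 1 ×ˢ Icc 0 T) z :=
  (ContDiffOn.differentiableOn hF (by simp) z hz).hasFDerivWithinAt

/-- One-sided partial derivatives become values of one Fréchet derivative within the box; joint
smoothness and symmetry follow from this. -/
theorem boxDx_eq (hF : SmoothOnBox T F) {x t : ℝ} (hx : x ∈ Icc (0 : ℝ) 1)
    (ht : t ∈ Icc (0 : ℝ) T) :
    boxDx F x t
      = fderivWithin ℝ (fun z : ℝ × ℝ => F z.1 z.2) (Icc 0 1 ×ˢ Icc 0 T) (x, t) (1, 0) := by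
  have h1 : HasDerivWithinAt (fun y : ℝ => (y, t)) ((1 : ℝ), (0 : ℝ)) (Icc 0 1) x :=
    (hasDerivWithinAt_id x _).prodMk (hasDerivWithinAt_const x _ t)
  have h2 := HasFDerivWithinAt.comp_hasDerivWithinAt (f := fun y : ℝ => (y, t)) x
    (hF.hasFDerivWithinAt (z := (x, t)) ⟨hx, ht⟩) h1 fun _ hy => ⟨hy, ht⟩
  exact h2.derivWithin (uniqueDiffOn_Icc zero_lt_one x hx)

theorem boxDt_eq (hF : SmoothOnBox T F) (hT : 0 < T) {x t : ℝ} (hx : x ∈ Icc (0 : ℝ) 1)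
    (ht : t ∈ Icc (0 : ℝ) T) :
    boxDt T F x t
      = fderivWithin ℝ (fun z : ℝ × ℝ => F z.1 z.2) (Icc 0 1 ×ˢ Icc 0 T) (x, t) (0, 1) := by
  have h1 : HasDerivWithinAt (fun s : ℝ => (x, s)) ((0 : ℝ), (1 : ℝ)) (Icc 0 T) t :=
    (hasDerivWithinAt_const t _ x).prodMk (hasDerivWithinAt_id t _)
  have h2 := HasFDerivWithinAt.comp_hasDerivWithinAt (f := fun s : ℝ => (x, s)) t
    (hF.hasFDerivWithinAt (z := (x, t)) ⟨hx, ht⟩) h1 fun _ hs => ⟨hx, hs⟩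
  exact h2.derivWithin (uniqueDiffOn_Icc hT t ht)

theorem fderivWithin_apply (hF : SmoothOnBox T F) (hT : 0 < T) (v : ℝ × ℝ) :
    SmoothOnBox T (fun x t =>
      fderivWithin ℝ (fun z : ℝ × ℝ => F z.1 z.2) (Icc 0 1 ×ˢ Icc 0 T) (x, t) v) := by
  have h := ContDiffOn.fderivWithin (m := (⊤ : ℕ∞)) hF (uniqueDiffOn_box hT) (by simp)
  exact h.clm_apply contDiffOn_const

theorem dx (hF : SmoothOnBox T F) (hT : 0 < T) : SmoothOnBox T (boxDx F) :=
  (hF.fderivWithin_apply hT (1, 0)).congr fun _ hx _ ht => hF.boxDx_eq hx ht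

theorem dt (hF : SmoothOnBox T F) (hT : 0 < T) : SmoothOnBox T (boxDt T F) :=
  (hF.fderivWithin_apply hT (0, 1)).congr fun _ hx _ ht => hF.boxDt_eq hT hx ht

/-- Symmetry of the second derivative within a set requires the point to lie in the closure of the
interior, which the box satisfies up to its boundary. -/
theorem comm (hF : SmoothOnBox T F) (hT : 0 < T) {x t : ℝ} (hx : x ∈ Icc (0 : ℝ) 1)
    (ht : t ∈ Icc (0 : ℝ) T) : boxDt T (boxDx F) x t = boxDx (boxDt T F) x t := by
  set s := Icc (0 : ℝ) 1 ×ˢ Icc (0 : ℝ) T with hs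
  set f : ℝ × ℝ → ℝ := fun z => F z.1 z.2 with hf
  have hu : UniqueDiffOn ℝ s := uniqueDiffOn_box hT
  have hz : ((x, t) : ℝ × ℝ) ∈ s := ⟨hx, ht⟩
  have hcl : ((x, t) : ℝ × ℝ) ∈ closure (interior s) := by
    rw [hs, interior_prod_eq, closure_prod_eq, interior_Icc, interior_Icc,
      closure_Ioo zero_ne_one, closure_Ioo hT.ne]
    exact hz
  have hsymm : IsSymmSndFDerivWithinAt ℝ f s (x, t) :=
    ContDiffWithinAt.isSymmSndFDerivWithinAt (ContDiffOn.contDiffWithinAt hF hz)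
      (by
        rw [minSmoothness_of_isRCLikeNormedField]
        exact WithTop.coe_le_coe.2 (le_top : (2 : ℕ∞) ≤ ⊤)) hu hcl hz
  have hd : DifferentiableWithinAt ℝ (fderivWithin ℝ f s) s (x, t) :=
    (ContDiffOn.fderivWithin (m := (⊤ : ℕ∞)) hF hu (by simp)).differentiableOn (by simp) _ hz
  have hsnd : ∀ v w : ℝ × ℝ, fderivWithin ℝ (fun z => fderivWithin ℝ f s z v) s (x, t) w
      = fderivWithin ℝ (fderivWithin ℝ f s) s (x, t) w v := by
    intro v w
    rw [fderivWithin_clm_apply (hu _ hz) hd (differentiableWithinAt_const v)]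
    simp [fderivWithin_const_apply]
  have e1 : fderivWithin ℝ (fun z : ℝ × ℝ => boxDx F z.1 z.2) s (x, t)
      = fderivWithin ℝ (fun z => fderivWithin ℝ f s z (1, 0)) s (x, t) :=
    fderivWithin_congr (fun z hz => hF.boxDx_eq hz.1 hz.2) (hF.boxDx_eq hx ht)
  have e2 : fderivWithin ℝ (fun z : ℝ × ℝ => boxDt T F z.1 z.2) s (x, t)
      = fderivWithin ℝ (fun z => fderivWithin ℝ f s z (0, 1)) s (x, t) :=
    fderivWithin_congr (fun z hz => hF.boxDt_eq hT hz.1 hz.2) (hF.boxDt_eq hT hx ht)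
  rw [(hF.dx hT).boxDt_eq hT hx ht, (hF.dt hT).boxDx_eq hx ht, ← hs, e1, e2, hsnd, hsnd]
  exact hsymm.eq _ _

theorem iterate_dx (hF : SmoothOnBox T F) (hT : 0 < T) (j : ℕ) : SmoothOnBox T (boxDx^[j] F) := by
  induction j with
  | zero => exact hF
  | succ j ih =>
    rw [Function.iterate_succ_apply']
    exact ih.dx hT

theorem iterate_comm (hF : SmoothOnBox T F) (hT : 0 < T) (j : ℕ) {x t : ℝ}
    (hx : x ∈ Icc (0 : ℝ) 1) (ht : t ∈ Icc (0 : ℝ) T) :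
    boxDt T (boxDx^[j] F) x t = boxDx^[j] (boxDt T F) x t := by
  induction j generalizing x with
  | zero => rfl
  | succ j ih =>
    rw [Function.iterate_succ_apply', Function.iterate_succ_apply',
      (hF.iterate_dx hT j).comm hT hx ht]
    exact derivWithin_congr (fun y hy => ih hy) (ih hx)

end SmoothOnBox

theorem iteratedDerivWithin_space (F : ℝ → ℝ → ℝ) (j : ℕ) {x t : ℝ}
    (hx : x ∈ Icc (0 : ℝ) 1) :
    iteratedDerivWithin j (fun y => F y t) (Icc 0 1) x = boxDx^[j] F x t := by
  induction j generalizing x with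
  | zero => simp
  | succ j ih =>
    rw [iteratedDerivWithin_succ, Function.iterate_succ_apply']
    exact derivWithin_congr (fun y hy => ih hy) (ih hx)

theorem mixedDeriv_zero_right (j : ℕ) (F : ℝ → ℝ → ℝ) (x t : ℝ) :
    mixedDeriv T j 0 F x t = iteratedDerivWithin j (fun y => F y t) (Icc 0 1) x := by
  simp [mixedDeriv]

theorem mixedDeriv_one_right (j : ℕ) (F : ℝ → ℝ → ℝ) (x t : ℝ) :
    mixedDeriv T j 1 F x t = iteratedDerivWithin j (fun y => boxDt T F y t) (Icc 0 1) x := by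
  simp [mixedDeriv, iteratedDerivWithin_one, boxDt]

theorem mixedDeriv_zero_left (m : ℕ) (F : ℝ → ℝ → ℝ) (x t : ℝ) :
    mixedDeriv T 0 m F x t = iteratedDerivWithin m (F x) (Icc 0 T) t := by
  simp [mixedDeriv]

/-- The space derivatives of a difference quotient in time are bounded by the mixed derivatives. -/
theorem SmoothOnBox.abs_diff_quotient_le (hF : SmoothOnBox T F) (hT : 0 < T) (j : ℕ) {x A : ℝ}
    (hx : x ∈ Icc (0 : ℝ) 1) (hA : ∀ t ∈ Icc (0 : ℝ) T, |mixedDeriv T j 1 F x t| ≤ A)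
    {t₀ t₁ : ℝ} (h₀ : t₀ ∈ Icc (0 : ℝ) T) (h₁ : t₁ ∈ Icc (0 : ℝ) T) (h : t₀ < t₁) :
    |iteratedDerivWithin j (fun y => (t₁ - t₀)⁻¹ * F y t₁ - (t₁ - t₀)⁻¹ * F y t₀) (Icc 0 1) x|
      ≤ A := by
  have hu : UniqueDiffOn ℝ (Icc (0 : ℝ) 1) := uniqueDiffOn_Icc zero_lt_one
  have hc : ∀ t ∈ Icc (0 : ℝ) T, ContDiffWithinAt ℝ j (fun y => F y t) (Icc 0 1) x := fun t ht =>
    ((hF.space ht).of_le (by exact_mod_cast le_top)).contDiffWithinAt hx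
  have e := iteratedDerivWithin_sub hx hu
    (contDiffWithinAt_const (c := (t₁ - t₀)⁻¹) |>.mul (hc t₁ h₁))
    (contDiffWithinAt_const (c := (t₁ - t₀)⁻¹) |>.mul (hc t₀ h₀))
  rw [Pi.sub_def] at e
  rw [e, iteratedDerivWithin_const_mul hx hu _ (hc t₁ h₁),
    iteratedDerivWithin_const_mul hx hu _ (hc t₀ h₀), iteratedDerivWithin_space F j hx,
    iteratedDerivWithin_space F j hx, ← mul_sub, abs_mul, abs_of_pos (inv_pos.2 (sub_pos.2 h)),
    inv_mul_le_iff₀ (sub_pos.2 h)]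
  -- Mean value inequality in time for `∂_x^j F(x, ·)`; the derivatives have to be interchanged to
  -- match the order in `mixedDeriv`.
  have hm := (convex_Icc (0 : ℝ) T).norm_image_sub_le_of_norm_derivWithin_le
    (((hF.iterate_dx hT j).time hx).differentiableOn (by simp)) (C := A) (fun t ht => by
      have h2 := hA t ht
      rw [mixedDeriv_one_right, iteratedDerivWithin_space _ j hx,
        ← hF.iterate_comm hT j hx ht] at h2
      exact h2) h₀ h₁
  rw [Real.norm_eq_abs, Real.norm_eq_abs, abs_of_pos (sub_pos.2 h)] at hm
  linarith

end Box

/-! ### Truncation error in time -/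

/-- Both cases apply the mean value inequality to an auxiliary function of time whose increment over
the step is the quadrature error; the constant is not sharp. -/
theorem abs_theta_truncation_le {T A θ t₀ t₁ : ℝ} {h : ℝ → ℝ} (hT : 0 < T)
    (hh : ContDiffOn ℝ (⊤ : ℕ∞) h (Icc 0 T))
    (h2 : ∀ t ∈ Icc (0 : ℝ) T, |iteratedDerivWithin 2 h (Icc 0 T) t| ≤ A)
    (h3 : ∀ t ∈ Icc (0 : ℝ) T, |iteratedDerivWithin 3 h (Icc 0 T) t| ≤ A)
    (h₀ : t₀ ∈ Icc (0 : ℝ) T) (h₁ : t₁ ∈ Icc (0 : ℝ) T) (hlt : t₀ < t₁)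
    (hθ0 : 0 ≤ θ) (hθ1 : θ ≤ 1) :
    |(t₁ - t₀)⁻¹ * h t₁ - (t₁ - t₀)⁻¹ * h t₀
        - (θ * derivWithin h (Icc 0 T) t₁ + (1 - θ) * derivWithin h (Icc 0 T) t₀)|
      ≤ A * (t₁ - t₀) ^ (if θ = 1 / 2 then 2 else 1) := by
  have hu : UniqueDiffOn ℝ (Icc (0 : ℝ) T) := uniqueDiffOn_Icc hT
  have hA : 0 ≤ A := (abs_nonneg _).trans (h2 t₀ h₀)
  have hsub : Icc t₀ t₁ ⊆ Icc 0 T := Icc_subset_Icc h₀.1 h₁.2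
  have hΔ : 0 < t₁ - t₀ := sub_pos.2 hlt
  have hm0 : t₀ ∈ Icc t₀ t₁ := left_mem_Icc.2 hlt.le
  have hm1 : t₁ ∈ Icc t₀ t₁ := right_mem_Icc.2 hlt.le
  have hder : ∀ (i : ℕ) (S : Set ℝ), S ⊆ Icc 0 T → ∀ t ∈ S,
      HasDerivWithinAt (iteratedDerivWithin i h (Icc 0 T))
        (iteratedDerivWithin (i + 1) h (Icc 0 T) t) S t := by
    intro i S hS t ht
    have h4 := hh.differentiableOn_iteratedDerivWithin (m := i)
      (by exact_mod_cast WithTop.coe_lt_top i) hu t (hS ht)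
    rw [iteratedDerivWithin_succ]
    exact h4.hasDerivWithinAt.mono hS
  have h1e : derivWithin h (Icc 0 T) = iteratedDerivWithin 1 h (Icc 0 T) :=
    iteratedDerivWithin_one.symm
  have h0e : h = iteratedDerivWithin 0 h (Icc 0 T) := iteratedDerivWithin_zero.symm
  set d : ℕ → ℝ → ℝ := fun i => iteratedDerivWithin i h (Icc 0 T) with hd
  have hmv : ∀ (f f' : ℝ → ℝ) (S : Set ℝ) (B : ℝ), Convex ℝ S → (∀ t ∈ S, HasDerivWithinAt f (f' t) S t) →
      (∀ t ∈ S, |f' t| ≤ B) → ∀ r ∈ S, ∀ s ∈ S, |f s - f r| ≤ B * |s - r| :=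
    fun f f' S B hS hf hb r hr s hs => hS.norm_image_sub_le_of_norm_hasDerivWithin_le hf hb hr hs
  have hdist : ∀ r ∈ Icc t₀ t₁, ∀ s ∈ Icc t₀ t₁, |s - r| ≤ t₁ - t₀ := by
    intro r hr s hs
    rw [abs_le]
    constructor <;> linarith [hr.1, hr.2, hs.1, hs.2]
  have hlip : ∀ i, (∀ t ∈ Icc (0 : ℝ) T, |d (i + 1) t| ≤ A) → ∀ r ∈ Icc t₀ t₁, ∀ s ∈ Icc t₀ t₁,
      |d i s - d i r| ≤ A * (t₁ - t₀) := by
    intro i hi r hr s hs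
    refine (hmv (d i) (d (i + 1)) _ A (convex_Icc t₀ t₁) (hder i _ hsub)
      (fun t ht => hi t (hsub ht)) r hr s hs).trans ?_
    exact mul_le_mul_of_nonneg_left (hdist r hr s hs) hA
  have hfac : ∀ c : ℝ, (t₁ - t₀)⁻¹ * h t₁ - (t₁ - t₀)⁻¹ * h t₀ - c
      = (t₁ - t₀)⁻¹ * (h t₁ - h t₀ - (t₁ - t₀) * c) := by
    intro c
    field_simp
  rw [hfac, abs_mul, abs_of_pos (inv_pos.2 hΔ), inv_mul_le_iff₀ hΔ, h1e]
  change |h t₁ - h t₀ - (t₁ - t₀) * (θ * d 1 t₁ + (1 - θ) * d 1 t₀)| ≤ _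
  have h0' : ∀ t, h t = d 0 t := fun t => congrFun h0e t
  rw [h0', h0']
  split_ifs with hθ
  · -- the trapezoidal rule
    subst hθ
    -- This is the trapezoidal error on `[t₀, s]`. Its derivative is `½ (h'(s) - h'(t₀) - (s - t₀)
    -- h''(s))`, of second order by the bound on `h'''`.
    have hG : ∀ s ∈ Icc t₀ t₁, HasDerivWithinAt
        (fun s => d 0 s - (s - t₀) * (1 / 2 * d 1 s + 1 / 2 * d 1 t₀))
        (d 1 s - (1 * (1 / 2 * d 1 s + 1 / 2 * d 1 t₀) + (s - t₀) * (1 / 2 * d 2 s)))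
        (Icc t₀ t₁) s := by
      intro s hs
      refine (hder 0 _ hsub s hs).sub (HasDerivWithinAt.mul ?_ ?_)
      · exact (hasDerivWithinAt_id s _).sub_const t₀
      · exact ((hder 1 _ hsub s hs).const_mul (1 / 2)).add_const _
    have hGb : ∀ s ∈ Icc t₀ t₁,
        |d 1 s - (1 * (1 / 2 * d 1 s + 1 / 2 * d 1 t₀) + (s - t₀) * (1 / 2 * d 2 s))|
        ≤ A * (t₁ - t₀) * (t₁ - t₀) := by
      intro s hs
      have h5 := hmv (fun r => d 1 r - r * d 2 s) (fun r => d 2 r - 1 * d 2 s) (Icc t₀ t₁)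
        (A * (t₁ - t₀)) (convex_Icc t₀ t₁)
        (fun r hr => (hder 1 _ hsub r hr).sub ((hasDerivWithinAt_id r _).mul_const _))
        (fun r hr => by rw [one_mul]; exact hlip 2 h3 s hs r hr) t₀ hm0 s hs
      have h6 := h5.trans (mul_le_mul_of_nonneg_left (hdist t₀ hm0 s hs) (by positivity))
      have h7 : d 1 s - (1 * (1 / 2 * d 1 s + 1 / 2 * d 1 t₀) + (s - t₀) * (1 / 2 * d 2 s))
          = 1 / 2 * (d 1 s - s * d 2 s - (d 1 t₀ - t₀ * d 2 s)) := by ring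
      rw [h7, abs_mul, abs_of_pos (by norm_num : (0 : ℝ) < 1 / 2)]
      have h8 : 0 ≤ A * (t₁ - t₀) * (t₁ - t₀) := by positivity
      linarith
    have h9 := hmv _ _ _ _ (convex_Icc t₀ t₁) hG hGb t₀ hm0 t₁ hm1
    rw [abs_of_pos hΔ] at h9
    have e : d 0 t₁ - d 0 t₀ - (t₁ - t₀) * (1 / 2 * d 1 t₁ + (1 - 1 / 2) * d 1 t₀)
        = d 0 t₁ - (t₁ - t₀) * (1 / 2 * d 1 t₁ + 1 / 2 * d 1 t₀)
          - (d 0 t₀ - (t₀ - t₀) * (1 / 2 * d 1 t₀ + 1 / 2 * d 1 t₀)) := by ring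
    rw [e]
    refine h9.trans (le_of_eq ?_)
    ring
  -- For other `θ`, `c` is an average of end point slopes, so `h'(s) - c` is of first order
  -- throughout the step.
  · set c := θ * d 1 t₁ + (1 - θ) * d 1 t₀ with hc
    have hb : ∀ s ∈ Icc t₀ t₁, |d 1 s - 1 * c| ≤ A * (t₁ - t₀) := by
      intro s hs
      have h5 := hlip 1 h2 t₁ hm1 s hs
      have h6 := hlip 1 h2 t₀ hm0 s hs
      have h7 : d 1 s - 1 * c = θ * (d 1 s - d 1 t₁) + (1 - θ) * (d 1 s - d 1 t₀) := by
        rw [hc]; ring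
      rw [h7]
      refine (abs_add_le _ _).trans ?_
      rw [abs_mul, abs_mul, abs_of_nonneg hθ0, abs_of_nonneg (sub_nonneg.2 hθ1)]
      nlinarith
    have h8 := hmv (fun s => d 0 s - s * c) (fun s => d 1 s - 1 * c) _ _ (convex_Icc t₀ t₁)
      (fun r hr => (hder 0 _ hsub r hr).sub ((hasDerivWithinAt_id r _).mul_const _)) hb t₀ hm0 t₁ hm1
    rw [abs_of_pos hΔ] at h8
    have e : d 0 t₁ - d 0 t₀ - (t₁ - t₀) * c = d 0 t₁ - t₁ * c - (d 0 t₀ - t₀ * c) := by ring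
    rw [e]
    refine h8.trans (le_of_eq ?_)
    ring

/-! ### Consequences of the decomposition of the solution -/

section Solution

variable {ε α T κ : ℝ} {K : ℕ → ℕ → ℝ} {u f : ℝ → ℝ → ℝ} {n : ℕ}

theorem HasLayerDecomposition.smoothOnBox (h : HasLayerDecomposition ε α T K u) :
    SmoothOnBox T u := by
  obtain ⟨S, E, hS, hE, hb⟩ := h
  exact (SmoothOnBox.add hS hE).congr fun x hx t ht => (hb x hx t ht).1

theorem layer_bound_mono {j m : ℕ} {z y : ℝ} (hε : 0 < ε) (hK : K j m ≤ κ)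
    (hz : |z| ≤ K j m * (ε ^ j)⁻¹ * Real.exp (-α * (1 - y) / ε)) :
    |z| ≤ κ * (ε ^ j)⁻¹ * Real.exp (-α * (1 - y) / ε) := by
  refine hz.trans ?_
  gcongr

theorem HasLayerDecomposition.hasSplit (h : HasLayerDecomposition ε α T K u) (hε : 0 < ε)
    (hκ : ∀ j ≤ n, K j 0 ≤ κ) {t : ℝ} (ht : t ∈ Icc (0 : ℝ) T) :
    HasSplit n ε α κ κ (fun y => u y t) := by
  obtain ⟨S, E, hS, hE, hb⟩ := h
  have hn : ((n : ℕ∞) : WithTop ℕ∞) ≤ ((⊤ : ℕ∞) : WithTop ℕ∞) := by exact_mod_cast le_top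
  refine ⟨fun y => S y t, fun y => E y t, (SmoothOnBox.space hS ht).of_le hn,
    (SmoothOnBox.space hE ht).of_le hn, fun y hy => ⟨(hb y hy t ht).1, fun j hj => ?_⟩⟩
  obtain ⟨h1, h2⟩ := (hb y hy t ht).2 j 0
  rw [mixedDeriv_zero_right] at h1 h2
  exact ⟨h1.trans (hκ j hj), layer_bound_mono hε (hκ j hj) h2⟩

/-- Interpolation estimates thus apply to the quotient itself, without a negative power of the time
step. -/
theorem HasLayerDecomposition.hasSplit_diff_quotient (h : HasLayerDecomposition ε α T K u)
    (hε : 0 < ε) (hT : 0 < T) (hκ : ∀ j ≤ n, K j 1 ≤ κ) {t₀ t₁ : ℝ} (h₀ : t₀ ∈ Icc (0 : ℝ) T)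
    (h₁ : t₁ ∈ Icc (0 : ℝ) T) (hlt : t₀ < t₁) :
    HasSplit n ε α κ κ (fun y => (t₁ - t₀)⁻¹ * u y t₁ - (t₁ - t₀)⁻¹ * u y t₀) := by
  obtain ⟨S, E, hS, hE, hb⟩ := h
  have hn : ((n : ℕ∞) : WithTop ℕ∞) ≤ ((⊤ : ℕ∞) : WithTop ℕ∞) := by exact_mod_cast le_top
  have hcd : ∀ F : ℝ → ℝ → ℝ, SmoothOnBox T F →
      ContDiffOn ℝ n (fun y => (t₁ - t₀)⁻¹ * F y t₁ - (t₁ - t₀)⁻¹ * F y t₀) (Icc 0 1) := fun F hF =>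
    (contDiffOn_const.mul ((hF.space h₁).of_le hn)).sub
      (contDiffOn_const.mul ((hF.space h₀).of_le hn))
  refine ⟨_, _, hcd S hS, hcd E hE, fun y hy => ⟨?_, fun j hj => ⟨?_, ?_⟩⟩⟩
  · beta_reduce
    rw [(hb y hy t₁ h₁).1, (hb y hy t₀ h₀).1]
    ring
  · exact SmoothOnBox.abs_diff_quotient_le hS hT j hy
      (fun t ht => ((hb y hy t ht).2 j 1).1.trans (hκ j hj)) h₀ h₁ hlt
  · exact SmoothOnBox.abs_diff_quotient_le hE hT j hy
      (fun t ht => layer_bound_mono hε (hκ j hj) ((hb y hy t ht).2 j 1).2) h₀ h₁ hlt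

theorem HasLayerDecomposition.abs_truncation_le (h : HasLayerDecomposition ε α T K u)
    (hε : 0 < ε) (hα : 0 < α) (hT : 0 < T) (hκ2 : K 0 2 ≤ κ) (hκ3 : K 0 3 ≤ κ) {t₀ t₁ θ y : ℝ}
    (hy : y ∈ Icc (0 : ℝ) 1) (h₀ : t₀ ∈ Icc (0 : ℝ) T) (h₁ : t₁ ∈ Icc (0 : ℝ) T) (hlt : t₀ < t₁)
    (hθ0 : 0 ≤ θ) (hθ1 : θ ≤ 1) :
    |(t₁ - t₀)⁻¹ * u y t₁ - (t₁ - t₀)⁻¹ * u y t₀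
        - (θ * boxDt T u y t₁ + (1 - θ) * boxDt T u y t₀)|
      ≤ 2 * κ * (t₁ - t₀) ^ (if θ = 1 / 2 then 2 else 1) := by
  have hu := h.smoothOnBox
  obtain ⟨S, E, hS, hE, hb⟩ := h
  have hbound : ∀ m, K 0 m ≤ κ → ∀ t ∈ Icc (0 : ℝ) T,
      |iteratedDerivWithin m (u y) (Icc 0 T) t| ≤ 2 * κ := by
    intro m hm t ht
    obtain ⟨h1, h2⟩ := (hb y hy t ht).2 0 m
    rw [mixedDeriv_zero_left] at h1 h2
    have hmt : ((m : ℕ∞) : WithTop ℕ∞) ≤ ((⊤ : ℕ∞) : WithTop ℕ∞) := by exact_mod_cast le_top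
    have e : iteratedDerivWithin m (u y) (Icc 0 T) t
        = iteratedDerivWithin m (S y) (Icc 0 T) t + iteratedDerivWithin m (E y) (Icc 0 T) t := by
      rw [← iteratedDerivWithin_fun_add ht (uniqueDiffOn_Icc hT)
        (((SmoothOnBox.time hS hy).of_le hmt).contDiffWithinAt ht)
        (((SmoothOnBox.time hE hy).of_le hmt).contDiffWithinAt ht)]
      exact iteratedDerivWithin_congr (fun s hs => (hb y hy s hs).1) ht
    have hexp : Real.exp (-α * (1 - y) / ε) ≤ 1 := by
      rw [Real.exp_le_one_iff, neg_mul, neg_div, neg_nonpos]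
      exact div_nonneg (mul_nonneg hα.le (by linarith [hy.2])) hε.le
    have hK : 0 ≤ K 0 m := (abs_nonneg _).trans h1
    rw [pow_zero, inv_one, mul_one] at h2
    have h3 := h2.trans (mul_le_of_le_one_right hK hexp)
    rw [e]
    exact (abs_add_le _ _).trans (by linarith)
  exact abs_theta_truncation_le hT (hu.time hy) (hbound 2 hκ2) (hbound 3 hκ3) h₀ h₁ hlt hθ0 hθ1

variable {a b u₀ : ℝ → ℝ}

/-- Equation and boundary values are given for `t > 0` only, while the error equation of the first
step involves the level `t = 0`; continuity in time closes the gap. -/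
theorem eq_on_Icc_of_eq_on_Ioc {F G : ℝ → ℝ} (hT : 0 < T) (hF : ContinuousOn F (Icc 0 T))
    (hG : ContinuousOn G (Icc 0 T)) (h : ∀ t ∈ Ioc (0 : ℝ) T, F t = G t) :
    ∀ t ∈ Icc (0 : ℝ) T, F t = G t := by
  have hcl : closure (Ioc (0 : ℝ) T) = Icc 0 T := closure_Ioc hT.ne
  exact EqOn.of_subset_closure (s := Ioc (0 : ℝ) T) (t := Icc 0 T) h hF hG Ioc_subset_Icc_self
    hcl.ge

theorem IsSolution.boundary_Icc (hs : IsSolution ε T a b f u₀ u) (hu : SmoothOnBox T u)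
    (hT : 0 < T) {t : ℝ} (ht : t ∈ Icc (0 : ℝ) T) : u 0 t = 0 ∧ u 1 t = 0 :=
  ⟨eq_on_Icc_of_eq_on_Ioc hT (hu.time (by simp)).continuousOn continuousOn_const
      (fun t ht => (hs.boundary t ht).1) t ht,
    eq_on_Icc_of_eq_on_Ioc hT (hu.time (by simp)).continuousOn continuousOn_const
      (fun t ht => (hs.boundary t ht).2) t ht⟩

theorem IsSolution.pde_Icc (hs : IsSolution ε T a b f u₀ u) (hu : SmoothOnBox T u)
    (hT : 0 < T) {y t : ℝ} (hy : y ∈ Ioo (0 : ℝ) 1) (ht : t ∈ Icc (0 : ℝ) T) :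
    boxDt T u y t - ε * dx (dx fun z => u z t) y + a y * dx (fun z => u z t) y + b y * u y t
      = f y t := by
  have hy' := Ioo_subset_Icc_self hy
  have c0 : ContinuousOn (fun t => u y t) (Icc 0 T) := (hu.time hy').continuousOn
  have c1 : ContinuousOn (fun t => boxDt T u y t) (Icc 0 T) :=
    ((hu.dt hT).time hy').continuousOn
  have c2 : ContinuousOn (fun t => dx (fun z => u z t) y) (Icc 0 T) :=
    ((hu.dx hT).time hy').continuousOn
  have c3 : ContinuousOn (fun t => dx (dx fun z => u z t) y) (Icc 0 T) :=
    (((hu.dx hT).dx hT).time hy').continuousOn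
  have cf : ContinuousOn (fun t => f y t) (Icc 0 T) :=
    hs.continuousOn_rhs.comp (f := fun t : ℝ => (y, t)) (by fun_prop) fun _ ht => ⟨hy', ht⟩
  refine eq_on_Icc_of_eq_on_Ioc (F := fun t => boxDt T u y t - ε * dx (dx fun z => u z t) y
    + a y * dx (fun z => u z t) y + b y * u y t) hT
    (((c1.sub (continuousOn_const.mul c3)).add (continuousOn_const.mul c2)).add
      (continuousOn_const.mul c0)) cf (fun t ht => ?_) t ht
  have h := hs.pde y hy t ht
  rw [mixedDeriv_one_right, mixedDeriv_zero_right, mixedDeriv_zero_right, iteratedDerivWithin_zero,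
    iteratedDerivWithin_one, iteratedDerivWithin_succ'] at h
  have e : iteratedDerivWithin 1 (derivWithin (fun y => u y t) (Icc 0 1)) (Icc 0 1) y
      = dx (dx fun z => u z t) y := congrFun iteratedDerivWithin_one y
  rw [e] at h
  exact h

end Solution

/-! ### The energy argument -/

/-- Young's inequality `2RY ≤ R² + Y²` absorbs half of the coercive term; the `L²` norms telescope
with no growth factor. -/
theorem energy_recursion {M : ℕ} {X Y : ℕ → ℝ} {Δ R : ℝ} (hΔ : 0 ≤ Δ)
    (h : ∀ m ∈ Finset.Icc 1 M, X m ^ 2 - X (m - 1) ^ 2 + 2 * Δ * Y m ^ 2 ≤ 2 * Δ * (R * Y m)) :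
    X M ^ 2 + Δ * ∑ m ∈ Finset.Icc 1 M, Y m ^ 2 ≤ X 0 ^ 2 + M * Δ * R ^ 2 := by
  have h1 : ∀ m ∈ Finset.Icc 1 M,
      (X m ^ 2 - X (m - 1) ^ 2) + Δ * Y m ^ 2 ≤ Δ * R ^ 2 := by
    intro m hm
    nlinarith [h m hm, mul_nonneg hΔ (sq_nonneg (R - Y m))]
  have h2 := Finset.sum_le_sum h1
  rw [Finset.sum_add_distrib, LayerMesh.sum_telescope (fun m => X m ^ 2), ← Finset.mul_sum,
    Finset.sum_const, Nat.card_Icc, nsmul_eq_mul, Nat.add_sub_cancel] at h2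
  linarith

theorem energy_bounds {M : ℕ} {X Y : ℕ → ℝ} {T R : ℝ} (hT : 0 < T) (hM : 1 ≤ M) (hR : 0 ≤ R)
    (hX0 : 0 ≤ X 0) (hX0R : X 0 ≤ R)
    (h : ∀ m ∈ Finset.Icc 1 M,
      X m ^ 2 - X (m - 1) ^ 2 + 2 * (T / M) * Y m ^ 2 ≤ 2 * (T / M) * (R * Y m)) :
    X M ≤ R * (1 + T) ∧ T / M * ∑ m ∈ Finset.Icc 1 M, Y m ≤ R * (1 + T) := by
  have hM0 : (0 : ℝ) < M := by exact_mod_cast hM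
  have hΔ : 0 ≤ T / M := by positivity
  have hMΔ : M * (T / M) = T := by field_simp
  have h1 := energy_recursion hΔ h
  rw [hMΔ] at h1
  have hS : 0 ≤ T / M * ∑ m ∈ Finset.Icc 1 M, Y m ^ 2 :=
    mul_nonneg hΔ (Finset.sum_nonneg fun _ _ => sq_nonneg _)
  have h2 : X 0 ^ 2 ≤ R ^ 2 := pow_le_pow_left₀ hX0 hX0R 2
  have h3 : 0 ≤ R * (1 + T) := by positivity
  have h4 : R ^ 2 + T * R ^ 2 ≤ (R * (1 + T)) ^ 2 := by
    nlinarith [mul_nonneg hT.le (sq_nonneg R), mul_nonneg (sq_nonneg T) (sq_nonneg R)]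
  refine ⟨abs_le_of_sq_le_sq (a := X M) ?_ h3 |> fun h => (le_abs_self _).trans h,
    abs_le_of_sq_le_sq ?_ h3 |> fun h => (le_abs_self _).trans h⟩
  · linarith
  -- Cauchy–Schwarz in time passes from the sum of squares to the sum, at the cost of the factor `M
  -- (T/M) = T`.
  · have hcs := sq_sum_le_card_mul_sum_sq (s := Finset.Icc 1 M) (f := Y)
    rw [Nat.card_Icc, Nat.add_sub_cancel] at hcs
    calc (T / M * ∑ m ∈ Finset.Icc 1 M, Y m) ^ 2
        = (T / M) ^ 2 * (∑ m ∈ Finset.Icc 1 M, Y m) ^ 2 := by ring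
      _ ≤ (T / M) ^ 2 * (M * ∑ m ∈ Finset.Icc 1 M, Y m ^ 2) := by gcongr
      _ = M * (T / M) * (T / M * ∑ m ∈ Finset.Icc 1 M, Y m ^ 2) := by ring
      _ = T * (T / M * ∑ m ∈ Finset.Icc 1 M, Y m ^ 2) := by rw [hMΔ]
      _ ≤ T * (R ^ 2 + T * R ^ 2) := by
        refine mul_le_mul_of_nonneg_left ?_ hT.le
        linarith [sq_nonneg (X M)]
      _ ≤ (R * (1 + T)) ^ 2 := by
        nlinarith [mul_nonneg hT.le (sq_nonneg R), mul_nonneg (sq_nonneg T) (sq_nonneg R)]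

theorem energySq_comb_le {x : ℕ → ℝ} {n : ℕ} {ε : ℝ} {a b : ℝ → ℝ} {α β A : ℝ}
    (hx : IsMesh x (n + 1)) (hc : CoeffBounds a b α β A) (hε : 0 < ε)
    {u₁ u₂ q₁ q₂ : Broken} (hu₁ : ElementwiseContinuous x (n + 1) u₁)
    (hu₂ : ElementwiseContinuous x (n + 1) u₂) (hq₁ : ElementwiseContinuous x (n + 1) q₁)
    (hq₂ : ElementwiseContinuous x (n + 1) q₂) {θ : ℝ} (h0 : 0 ≤ θ) (h1 : θ ≤ 1) :
    energySq x (n + 1) ε a b (fun j y => θ * u₁ j y + (1 - θ) * u₂ j y)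
        (fun j y => θ * q₁ j y + (1 - θ) * q₂ j y)
      ≤ 2 * (energySq x (n + 1) ε a b u₁ q₁ + energySq x (n + 1) ε a b u₂ q₂) := by
  have hscale : ∀ (c : ℝ) (u q : Broken), energySq x (n + 1) ε a b (fun j y => c * u j y)
      (fun j y => c * q j y) = c ^ 2 * energySq x (n + 1) ε a b u q := by
    intro c u q
    have hip : ∀ (w : ℝ → ℝ) (v : Broken),
        ip x (n + 1) (fun j y => w y * (c * v j y)) (fun j y => c * v j y)
          = c ^ 2 * ip x (n + 1) (fun j y => w y * v j y) v := by
      intro w v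
      rw [ip, ip, Finset.mul_sum]
      refine Finset.sum_congr rfl fun j _ => ?_
      rw [← intervalIntegral.integral_const_mul]
      congr 1
      ext y
      ring
    have hj : ∀ j, jump x (n + 1) (fun j y => c * u j y) j = c * jump x (n + 1) u j := by
      intro j
      unfold jump traceL traceR
      split_ifs <;> ring
    have h1 := hip (fun _ => 1) q
    simp only [one_mul] at h1
    simp only [energySq, h1, hip, hj]
    rw [mul_add, mul_add, mul_add, Finset.mul_sum]
    congr 1
    · congr 1
      · ring
      · exact Finset.sum_congr rfl fun j _ => by ring
    · ring
  have hle : ∀ (c : ℝ), 0 ≤ c → c ≤ 1 → ∀ u q : Broken, ElementwiseContinuous x (n + 1) u →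
      energySq x (n + 1) ε a b (fun j y => c * u j y) (fun j y => c * q j y)
        ≤ energySq x (n + 1) ε a b u q := by
    intro c hc0 hc1 u q hu
    rw [hscale]
    exact mul_le_of_le_one_left (energySq_bounds hx hc hε hu q).1 (pow_le_one₀ hc0 hc1)
  have e1 := energySq_add_le hx hc hε (hu₁.const_mul θ) (hu₂.const_mul (1 - θ))
    (hq₁.const_mul θ) (hq₂.const_mul (1 - θ))
  have e2 := hle θ h0 h1 u₁ q₁ hu₁
  have e3 := hle (1 - θ) (by linarith) (by linarith) u₂ q₂ hu₂
  linarith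

/-! ### The error equation -/

section Scheme

/-- The flux `ε u_x` at a time level. -/
def fluxAt (ε T : ℝ) (M : ℕ) (u : ℝ → ℝ → ℝ) (m : ℕ) : ℝ → ℝ :=
  fun y => ε * dx (fun z => u z (timePt T M m)) y

/-- The discrete error in the primal variable. -/
def discErrU (x : ℕ → ℝ) (k : ℕ) (T : ℝ) (M : ℕ) (u : ℝ → ℝ → ℝ) (U : ℕ → Broken) (m : ℕ) :
    Broken :=
  fun j y => radauR x k (fun z => u z (timePt T M m)) j y - U m j y

/-- The discrete error in the flux. -/
def discErrQ (x : ℕ → ℝ) (k : ℕ) (ε T : ℝ) (M : ℕ) (u : ℝ → ℝ → ℝ) (Q : ℕ → Broken) (m : ℕ) :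
    Broken :=
  fun j y => radauL x k (fluxAt ε T M u m) j y - Q m j y

variable {x : ℕ → ℝ} {n k M : ℕ} {ε T θ α β A : ℝ} {a b : ℝ → ℝ} {f : ℝ → ℝ → ℝ} {u₀ : ℝ → ℝ}
  {u : ℝ → ℝ → ℝ} {U Q : ℕ → Broken}

theorem timePt_mem (hT : 0 < T) (hM : 1 ≤ M) {m : ℕ} (hm : m ≤ M) :
    timePt T M m ∈ Icc (0 : ℝ) T := by
  have hM0 : (0 : ℝ) < M := by exact_mod_cast hM
  have hm' : (m : ℝ) ≤ M := by exact_mod_cast hm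
  unfold timePt
  refine ⟨by positivity, ?_⟩
  rw [mul_div_assoc', div_le_iff₀ hM0, mul_comm]
  gcongr

theorem timePt_sub {m : ℕ} (hm : 1 ≤ m) : timePt T M m - timePt T M (m - 1) = T / M := by
  unfold timePt
  rw [Nat.cast_sub hm, Nat.cast_one]
  ring

theorem isDiscrete_discErrU {N : ℕ} (hU : ∀ m ≤ M, IsDiscrete N k (U m)) {m : ℕ} (hm : m ≤ M) :
    IsDiscrete N k (discErrU x k T M u U m) :=
  (isDiscrete_radauR x N k _).sub (hU m hm)

theorem isDiscrete_discErrQ {N : ℕ} (hQ : ∀ m ≤ M, IsDiscrete N k (Q m)) {m : ℕ} (hm : m ≤ M) :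
    IsDiscrete N k (discErrQ x k ε T M u Q m) :=
  (isDiscrete_radauL x N k _).sub (hQ m hm)

theorem contDiffOn_slice (hu : SmoothOnBox T u) {t : ℝ} (ht : t ∈ Icc (0 : ℝ) T) :
    ContDiffOn ℝ 2 (fun z => u z t) (Icc 0 1) :=
  (hu.space ht).of_le (WithTop.coe_le_coe.2 (le_top : (2 : ℕ∞) ≤ ⊤))

theorem contDiffOn_flux (hu : SmoothOnBox T u) {t : ℝ} (ht : t ∈ Icc (0 : ℝ) T) (ε : ℝ) :
    ContDiffOn ℝ 1 (fun y => ε * dx (fun z => u z t) y) (Icc 0 1) :=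
  contDiffOn_const.mul ((contDiffOn_slice hu ht).derivWithin (uniqueDiffOn_Icc zero_lt_one)
    (by norm_num))

/-- Consistency of the spatial form at a fixed time. -/
theorem formB_solution (hx : IsMesh x (n + 1)) (hx0 : x 0 = 0) (hx1 : x (n + 1) = 1)
    (hc : CoeffBounds a b α β A) (hε : 0 < ε) (hT : 0 < T) (hu : SmoothOnBox T u)
    (hs : IsSolution ε T a b f u₀ u) {t : ℝ} (ht : t ∈ Icc (0 : ℝ) T) {v r : Broken}
    (hv : IsDiscrete (n + 1) k v) (hr : IsDiscrete (n + 1) k r) :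
    formB x (n + 1) ε a b (fun _ y => u y t) (fun _ y => ε * dx (fun z => u z t) y) v r
      = ip x (n + 1) (fun _ y => f y t) v - ip x (n + 1) (fun _ y => boxDt T u y t) v := by
  have hbd := hs.boundary_Icc hu hT ht
  have hg1 : ContDiffOn ℝ 1 (fun z => u z t) (Icc 0 1) :=
    (contDiffOn_slice hu ht).of_le (by norm_num)
  have hp := contDiffOn_flux hu ht ε
  have hd2 : DifferentiableOn ℝ (dx fun z => u z t) (Icc 0 1) :=
    (((contDiffOn_slice hu ht).derivWithin (m := 1) (uniqueDiffOn_Icc zero_lt_one)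
      (by norm_num)).differentiableOn one_ne_zero)
  have hfc : ElementwiseContinuous x (n + 1) (fun _ y => f y t) :=
    elementwiseContinuous_of_continuousOn (hs.continuousOn_rhs.comp (f := fun y : ℝ => (y, t))
      (by fun_prop) fun _ hy => ⟨hy, ht⟩) hx.sub
  have htc : ElementwiseContinuous x (n + 1) (fun _ y => boxDt T u y t) :=
    elementwiseContinuous_of_continuousOn ((hu.dt hT).space ht).continuousOn hx.sub
  rw [formB_smooth hx hx0 hx1 hε.ne' hc.contDiffOn hc.continuousOn hg1 hp (fun _ _ => rfl)
    hbd.1 hbd.2 hv hr, ← ip_sub_left hx.le hfc htc hv.elementwiseContinuous]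
  refine ip_congr_ae hx.le fun j hj y hy => ?_
  have hy' := hx.subset_Ioo hj hy
  have e1 : dx (fun y => ε * dx (fun z => u z t) y) y = ε * dx (dx fun z => u z t) y :=
    derivWithin_const_mul ε (hd2 y (Ioo_subset_Icc_self hy'))
  have e2 := hs.pde_Icc hu hT hy' ht
  rw [e1, ← e2]
  ring

/-- The error equation of the fully discrete scheme. -/
theorem error_equation (hx : IsMesh x (n + 1)) (hx0 : x 0 = 0) (hx1 : x (n + 1) = 1)
    (hc : CoeffBounds a b α β A) (hε : 0 < ε) (hT : 0 < T) (hM : 1 ≤ M) (hu : SmoothOnBox T u)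
    (hs : IsSolution ε T a b f u₀ u) (hW : IsThetaScheme x (n + 1) k M ε T θ a b f u₀ U Q)
    {m : ℕ} (hm : m ∈ Finset.Icc 1 M) {v r : Broken} (hv : IsDiscrete (n + 1) k v)
    (hr : IsDiscrete (n + 1) k r) :
    (T / M)⁻¹ * (ip x (n + 1) (discErrU x k T M u U m) v
        - ip x (n + 1) (discErrU x k T M u U (m - 1)) v)
      + formB x (n + 1) ε a b (thetaAvg θ (discErrU x k T M u U) m)
        (thetaAvg θ (discErrQ x k ε T M u Q) m) v r
      = ip x (n + 1) (fun _ y => (T / M)⁻¹ * u y (timePt T M m)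
            - (T / M)⁻¹ * u y (timePt T M (m - 1))
            - (θ * boxDt T u y (timePt T M m) + (1 - θ) * boxDt T u y (timePt T M (m - 1)))) v
        - ip x (n + 1) (errR x k fun y => (T / M)⁻¹ * u y (timePt T M m)
            - (T / M)⁻¹ * u y (timePt T M (m - 1))) v
        - (θ * formB x (n + 1) ε a b (errR x k fun z => u z (timePt T M m))
              (errL x k (fluxAt ε T M u m)) v r
          + (1 - θ) * formB x (n + 1) ε a b (errR x k fun z => u z (timePt T M (m - 1)))
              (errL x k (fluxAt ε T M u (m - 1))) v r) := by
  have hm' := Finset.mem_Icc.1 hm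
  have hm0 : m - 1 ≤ M := by omega
  have hvc : ElementwiseContinuous x (n + 1) v := hv.elementwiseContinuous
  have hUc : ∀ i ≤ M, ElementwiseContinuous x (n + 1) (U i) :=
    fun i hi => (hW.discrete i hi).1.elementwiseContinuous
  have hQc : ∀ i ≤ M, ElementwiseContinuous x (n + 1) (Q i) :=
    fun i hi => (hW.discrete i hi).2.elementwiseContinuous
  have huc : ∀ i ≤ M, ContinuousOn (fun y => u y (timePt T M i)) (Icc 0 1) :=
    fun i hi => (hu.space (timePt_mem hT hM hi)).continuousOn
  have hqc : ∀ i ≤ M, ContinuousOn (fluxAt ε T M u i) (Icc 0 1) :=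
    fun i hi => (contDiffOn_flux hu (timePt_mem hT hM hi) ε).continuousOn
  have hub : ∀ i ≤ M, ElementwiseContinuous x (n + 1) (fun _ y => u y (timePt T M i)) :=
    fun i hi => elementwiseContinuous_of_continuousOn (huc i hi) hx.sub
  have hqb : ∀ i ≤ M, ElementwiseContinuous x (n + 1) (fun _ => fluxAt ε T M u i) :=
    fun i hi => elementwiseContinuous_of_continuousOn (hqc i hi) hx.sub
  have htb : ∀ i ≤ M, ElementwiseContinuous x (n + 1) (fun _ y => boxDt T u y (timePt T M i)) :=
    fun i hi => elementwiseContinuous_of_continuousOn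
      ((hu.dt hT).space (timePt_mem hT hM hi)).continuousOn hx.sub
  have hfb : ∀ i ≤ M, ElementwiseContinuous x (n + 1) (fun _ y => f y (timePt T M i)) :=
    fun i hi => elementwiseContinuous_of_continuousOn (hs.continuousOn_rhs.comp
      (f := fun y : ℝ => (y, timePt T M i)) (by fun_prop)
      fun _ hy => ⟨hy, timePt_mem hT hM hi⟩) hx.sub
  have heR : ∀ i ≤ M, ElementwiseContinuous x (n + 1) (errR x k fun z => u z (timePt T M i)) :=
    fun i hi => errR_elementwiseContinuous hx (huc i hi)
  have heL : ∀ i ≤ M, ElementwiseContinuous x (n + 1) (errL x k (fluxAt ε T M u i)) :=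
    fun i hi => errL_elementwiseContinuous hx (hqc i hi)
  have hξU : ∀ i ≤ M, ElementwiseContinuous x (n + 1) (discErrU x k T M u U i) := fun i hi =>
    (isDiscrete_discErrU (fun i hi => (hW.discrete i hi).1) hi).elementwiseContinuous
  have hξQ : ∀ i ≤ M, ElementwiseContinuous x (n + 1) (discErrQ x k ε T M u Q i) := fun i hi =>
    (isDiscrete_discErrQ (fun i hi => (hW.discrete i hi).2) hi).elementwiseContinuous
  have hlin := fun (u₁ u₂ q₁ q₂ : Broken) (h₁ : ElementwiseContinuous x (n + 1) u₁)
    (h₂ : ElementwiseContinuous x (n + 1) u₂) (h₃ : ElementwiseContinuous x (n + 1) q₁)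
    (h₄ : ElementwiseContinuous x (n + 1) q₂) (c d : ℝ) =>
    formB_comb (ε := ε) hx hc.contDiffOn hc.continuousOn h₁ h₂ h₃ h₄ hv hr c d
  -- the form applied to the discrete error at one time level
  have hξ : ∀ i ≤ M, formB x (n + 1) ε a b (discErrU x k T M u U i) (discErrQ x k ε T M u Q i) v r
      = ip x (n + 1) (fun _ y => f y (timePt T M i)) v
        - ip x (n + 1) (fun _ y => boxDt T u y (timePt T M i)) v
        - formB x (n + 1) ε a b (errR x k fun z => u z (timePt T M i))
          (errL x k (fluxAt ε T M u i)) v r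
        - formB x (n + 1) ε a b (U i) (Q i) v r := by
    intro i hi
    have e1 := hlin _ _ _ _ (hub i hi) (heR i hi) (hqb i hi) (heL i hi) 1 (-1)
    have e2 := hlin _ _ _ _ ((hub i hi).comb 1 (-1) (heR i hi)) (hUc i hi)
      ((hqb i hi).comb 1 (-1) (heL i hi)) (hQc i hi) 1 (-1)
    have e3 : discErrU x k T M u U i = fun j y => 1 * (1 * u y (timePt T M i)
        + -1 * errR x k (fun z => u z (timePt T M i)) j y) + -1 * U i j y := by
      funext j y
      simp only [discErrU, errR]
      ring
    have e4 : discErrQ x k ε T M u Q i = fun j y => 1 * (1 * fluxAt ε T M u i y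
        + -1 * errL x k (fluxAt ε T M u i) j y) + -1 * Q i j y := by
      funext j y
      simp only [discErrQ, errL]
      ring
    have e5 := formB_solution hx hx0 hx1 hc hε hT hu hs (timePt_mem hT hM hi) hv hr
    rw [e3, e4, e2, e1]
    change formB x (n + 1) ε a b (fun _ y => u y (timePt T M i)) (fun _ => fluxAt ε T M u i) v r
      = _ at e5
    rw [e5]
    ring
  have hstep := hW.step m hm v r hv hr
  have g1 : formB x (n + 1) ε a b (thetaAvg θ (discErrU x k T M u U) m)
      (thetaAvg θ (discErrQ x k ε T M u Q) m) v r = _ :=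
    hlin _ _ _ _ (hξU m hm'.2) (hξU _ hm0) (hξQ m hm'.2) (hξQ _ hm0) θ (1 - θ)
  have g2 : formB x (n + 1) ε a b (thetaAvg θ U m) (thetaAvg θ Q m) v r = _ :=
    hlin _ _ _ _ (hUc m hm'.2) (hUc _ hm0) (hQc m hm'.2) (hQc _ hm0) θ (1 - θ)
  have g3 : ip x (n + 1) (thetaAvg θ (atTime T M f) m) v = _ :=
    ip_comb_left hx.le (hfb m hm'.2) (hfb _ hm0) hvc θ (1 - θ)
  have g4 : ip x (n + 1) (fun j y => (U m j y - U (m - 1) j y) / (T / M)) v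
      = (T / M)⁻¹ * ip x (n + 1) (U m) v + -(T / M)⁻¹ * ip x (n + 1) (U (m - 1)) v := by
    rw [← ip_comb_left hx.le (hUc m hm'.2) (hUc _ hm0) hvc]
    exact ip_congr hx.le fun j _ y _ => by rw [div_eq_inv_mul]; ring
  -- the time difference
  have g5 : ip x (n + 1) (fun _ y => (T / M)⁻¹ * u y (timePt T M m)
            - (T / M)⁻¹ * u y (timePt T M (m - 1))
            - (θ * boxDt T u y (timePt T M m) + (1 - θ) * boxDt T u y (timePt T M (m - 1)))) v
      = ((T / M)⁻¹ * ip x (n + 1) (fun _ y => u y (timePt T M m)) v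
          + -(T / M)⁻¹ * ip x (n + 1) (fun _ y => u y (timePt T M (m - 1))) v)
        - (θ * ip x (n + 1) (fun _ y => boxDt T u y (timePt T M m)) v
          + (1 - θ) * ip x (n + 1) (fun _ y => boxDt T u y (timePt T M (m - 1))) v) := by
    rw [← ip_comb_left hx.le (hub m hm'.2) (hub _ hm0) hvc,
      ← ip_comb_left hx.le (htb m hm'.2) (htb _ hm0) hvc,
      ← ip_sub_left hx.le ((hub m hm'.2).comb _ _ (hub _ hm0))
        ((htb m hm'.2).comb _ _ (htb _ hm0)) hvc]
    exact ip_congr hx.le fun j _ y _ => by ring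
  -- By linearity, the quotient of the projection errors is the projection error of the quotient.
  have g6 : ip x (n + 1) (errR x k fun y => (T / M)⁻¹ * u y (timePt T M m)
            - (T / M)⁻¹ * u y (timePt T M (m - 1))) v
      = (T / M)⁻¹ * ip x (n + 1) (errR x k fun y => u y (timePt T M m)) v
        + -(T / M)⁻¹ * ip x (n + 1) (errR x k fun y => u y (timePt T M (m - 1))) v := by
    rw [← ip_comb_left hx.le (heR m hm'.2) (heR _ hm0) hvc]
    refine ip_congr hx.le fun j hj y _ => ?_
    have hsub : uIcc (x (j - 1)) (x j) ⊆ Icc 0 1 := by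
      rw [uIcc_of_le (hx.le j hj)]
      exact hx.sub j hj
    have h1 := radauOn_linear (e := x (j - 1)) (z := x j) ((huc m hm'.2).mono hsub)
      ((huc _ hm0).mono hsub) k (T / M)⁻¹ (-(T / M)⁻¹) y
    have h2 : (fun y => (T / M)⁻¹ * u y (timePt T M m) - (T / M)⁻¹ * u y (timePt T M (m - 1)))
        = fun y => (T / M)⁻¹ * u y (timePt T M m)
          + -(T / M)⁻¹ * u y (timePt T M (m - 1)) := by
      funext y
      ring
    simp only [errR, radauR]
    rw [h2, h1]
    ring
  have g7 : ∀ i ≤ M, ip x (n + 1) (discErrU x k T M u U i) v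
      = ip x (n + 1) (fun _ y => u y (timePt T M i)) v
        - ip x (n + 1) (errR x k fun y => u y (timePt T M i)) v - ip x (n + 1) (U i) v := by
    intro i hi
    rw [← ip_sub_left hx.le (hub i hi) (heR i hi) hvc,
      ← ip_sub_left hx.le ((hub i hi).sub (heR i hi)) (hUc i hi) hvc]
    refine ip_congr hx.le fun j _ y _ => ?_
    simp only [discErrU, errR]
    ring
  rw [g1, hξ m hm'.2, hξ _ hm0, g5, g6, g7 m hm'.2, g7 _ hm0]
  rw [g2, g3, g4] at hstep
  linear_combination -hstep

/-- One step of the energy estimate. -/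
theorem energy_step (hx : IsMesh x (n + 1)) (hx0 : x 0 = 0) (hx1 : x (n + 1) = 1)
    (hc : CoeffBounds a b α β A) (hε : 0 < ε) (hT : 0 < T) (hM : 1 ≤ M) (hu : SmoothOnBox T u)
    (hs : IsSolution ε T a b f u₀ u) (hW : IsThetaScheme x (n + 1) k M ε T θ a b f u₀ U Q)
    (hθ : 1 / 2 ≤ θ) (hθ1 : θ ≤ 1) {m : ℕ} (hm : m ∈ Finset.Icc 1 M) {R τ D : ℝ}
    (hR : 0 ≤ R) (hτ : 0 ≤ τ)
    (htrunc : ∀ y ∈ Icc (0 : ℝ) 1, |(T / M)⁻¹ * u y (timePt T M m)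
            - (T / M)⁻¹ * u y (timePt T M (m - 1))
            - (θ * boxDt T u y (timePt T M m) + (1 - θ) * boxDt T u y (timePt T M (m - 1)))| ≤ τ)
    (hquot : ∀ j ∈ Finset.Icc 1 (n + 1), ∀ y ∈ Icc (x (j - 1)) (x j),
      |errR x k (fun y => (T / M)⁻¹ * u y (timePt T M m)
            - (T / M)⁻¹ * u y (timePt T M (m - 1))) j y| ≤ R)
    (hform : ∀ i ≤ M, ∀ v r, IsDiscrete (n + 1) k v → IsDiscrete (n + 1) k r →
      |formB x (n + 1) ε a b (errR x k fun z => u z (timePt T M i))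
        (errL x k (fluxAt ε T M u i)) v r| ≤ D * energyNorm x (n + 1) ε a b v r) :
    l2norm x (n + 1) (discErrU x k T M u U m) ^ 2
        - l2norm x (n + 1) (discErrU x k T M u U (m - 1)) ^ 2
        + 2 * (T / M) * energyNorm x (n + 1) ε a b (thetaAvg θ (discErrU x k T M u U) m)
          (thetaAvg θ (discErrQ x k ε T M u Q) m) ^ 2
      ≤ 2 * (T / M) * (((τ + R) * Real.sqrt β⁻¹ + D)
        * energyNorm x (n + 1) ε a b (thetaAvg θ (discErrU x k T M u U) m)
          (thetaAvg θ (discErrQ x k ε T M u Q) m)) := by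
  have hβ := hc.beta_pos
  have hm' := Finset.mem_Icc.1 hm
  have hm0 : m - 1 ≤ M := by omega
  have hM0 : (0 : ℝ) < M := by exact_mod_cast hM
  have hΔ : 0 < T / M := by positivity
  set ξ := discErrU x k T M u U with hξ
  set ζ := discErrQ x k ε T M u Q with hζ
  have d1 : ∀ i ≤ M, IsDiscrete (n + 1) k (ξ i) := fun i hi =>
    isDiscrete_discErrU (fun i hi => (hW.discrete i hi).1) hi
  have d2 : ∀ i ≤ M, IsDiscrete (n + 1) k (ζ i) := fun i hi =>
    isDiscrete_discErrQ (fun i hi => (hW.discrete i hi).2) hi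
  have hv : IsDiscrete (n + 1) k (thetaAvg θ ξ m) := (d1 m hm'.2).comb (d1 _ hm0) θ (1 - θ)
  have hr : IsDiscrete (n + 1) k (thetaAvg θ ζ m) := (d2 m hm'.2).comb (d2 _ hm0) θ (1 - θ)
  have hvc : ElementwiseContinuous x (n + 1) (thetaAvg θ ξ m) := hv.elementwiseContinuous
  have c1 : ElementwiseContinuous x (n + 1) (ξ m) := (d1 m hm'.2).elementwiseContinuous
  have c0 : ElementwiseContinuous x (n + 1) (ξ (m - 1)) := (d1 _ hm0).elementwiseContinuous
  -- The test functions are the `θ`-averages of the discrete errors, so coercivity applies to the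
  -- form.
  have heq := error_equation hx hx0 hx1 hc hε hT hM hu hs hW hm hv hr
  rw [formB_self hx hc.contDiffOn hc.continuousOn hv hr, ← sq_energyNorm hx hc hε hvc] at heq
  set Y := energyNorm x (n + 1) ε a b (thetaAvg θ ξ m) (thetaAvg θ ζ m) with hY
  have hY0 : 0 ≤ Y := Real.sqrt_nonneg _
  -- the time derivative part
  have q1 : ip x (n + 1) (ξ m) (thetaAvg θ ξ m)
      = θ * ip x (n + 1) (ξ m) (ξ m) + (1 - θ) * ip x (n + 1) (ξ m) (ξ (m - 1)) :=
    ip_comb_right hx.le c1 c0 c1 θ (1 - θ)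
  have q0 : ip x (n + 1) (ξ (m - 1)) (thetaAvg θ ξ m)
      = θ * ip x (n + 1) (ξ (m - 1)) (ξ m) + (1 - θ) * ip x (n + 1) (ξ (m - 1)) (ξ (m - 1)) :=
    ip_comb_right hx.le c1 c0 c0 θ (1 - θ)
  have q2 : 0 ≤ ip x (n + 1) (ξ m) (ξ m) - 2 * ip x (n + 1) (ξ m) (ξ (m - 1))
      + ip x (n + 1) (ξ (m - 1)) (ξ (m - 1)) := by
    have h := ip_self_nonneg hx.le (fun j y => 1 * ξ m j y + -1 * ξ (m - 1) j y)
    rw [ip_comb_left hx.le c1 c0 (c1.comb 1 (-1) c0), ip_comb_right hx.le c1 c0 c1,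
      ip_comb_right hx.le c1 c0 c0, ip_comm (ξ (m - 1)) (ξ m)] at h
    linarith
  -- The right side exceeds the left by `(2θ - 1) ‖ξ^m - ξ^(m-1)‖²`; here `θ ≥ 1/2` enters.
  have q3 : ip x (n + 1) (ξ m) (ξ m) - ip x (n + 1) (ξ (m - 1)) (ξ (m - 1))
      ≤ 2 * (ip x (n + 1) (ξ m) (thetaAvg θ ξ m)
        - ip x (n + 1) (ξ (m - 1)) (thetaAvg θ ξ m)) := by
    rw [q1, q0, ip_comm (ξ (m - 1)) (ξ m)]
    nlinarith [mul_nonneg (by linarith : 0 ≤ 2 * θ - 1) q2]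
  -- the right-hand side
  have hvY : l2norm x (n + 1) (thetaAvg θ ξ m) ≤ Real.sqrt β⁻¹ * Y := by
    refine Real.sqrt_le_iff.2 ⟨by positivity, ?_⟩
    obtain ⟨-, -, b2, -⟩ := energySq_bounds hx hc hε hvc (thetaAvg θ ζ m)
    rw [← sq_energyNorm hx hc hε hvc, ← hY] at b2
    rw [mul_pow, Real.sq_sqrt (by positivity), inv_mul_eq_div, le_div_iff₀ hβ]
    linarith
  have h01 : x (n + 1) - x 0 ≤ 1 := by rw [hx0, hx1, sub_zero]
  have huc : ∀ i ≤ M, ContinuousOn (fun y => u y (timePt T M i)) (Icc 0 1) :=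
    fun i hi => (hu.space (timePt_mem hT hM hi)).continuousOn
  have htc : ∀ i ≤ M, ContinuousOn (fun y => boxDt T u y (timePt T M i)) (Icc 0 1) :=
    fun i hi => ((hu.dt hT).space (timePt_mem hT hM hi)).continuousOn
  have hdq : ContinuousOn (fun y => (T / M)⁻¹ * u y (timePt T M m)
            - (T / M)⁻¹ * u y (timePt T M (m - 1))) (Icc 0 1) :=
    (continuousOn_const.mul (huc m hm'.2)).sub (continuousOn_const.mul (huc _ hm0))
  have r1 : |ip x (n + 1) (fun _ y => (T / M)⁻¹ * u y (timePt T M m)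
            - (T / M)⁻¹ * u y (timePt T M (m - 1))
            - (θ * boxDt T u y (timePt T M m) + (1 - θ) * boxDt T u y (timePt T M (m - 1))))
        (thetaAvg θ ξ m)| ≤ τ * (Real.sqrt β⁻¹ * Y) := by
    have hcont := elementwiseContinuous_of_continuousOn (x := x) (N := n + 1)
      (hdq.sub ((continuousOn_const (c := θ)).mul (htc m hm'.2) |>.add
        ((continuousOn_const (c := 1 - θ)).mul (htc _ hm0)))) hx.sub
    refine (abs_ip_le hx.le hcont hvc).trans ?_
    exact mul_le_mul (l2norm_le_of_sup hx.le h01 hcont hτ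
      fun j hj y hy => htrunc y (hx.sub j hj hy)) hvY (Real.sqrt_nonneg _) hτ
  have r2 : |ip x (n + 1) (errR x k fun y => (T / M)⁻¹ * u y (timePt T M m)
            - (T / M)⁻¹ * u y (timePt T M (m - 1))) (thetaAvg θ ξ m)|
      ≤ R * (Real.sqrt β⁻¹ * Y) := by
    have hcont := errR_elementwiseContinuous (k := k) hx hdq
    refine (abs_ip_le hx.le hcont hvc).trans ?_
    exact mul_le_mul (l2norm_le_of_sup hx.le h01 hcont hR hquot) hvY (Real.sqrt_nonneg _) hR
  have r3 := hform m hm'.2 _ _ hv hr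
  have r4 := hform (m - 1) hm0 _ _ hv hr
  rw [← hY] at r3 r4
  have r5 := (neg_abs_le _).trans' (neg_le_neg r3)
  have r6 := (neg_abs_le _).trans' (neg_le_neg r4)
  have hrhs : (T / M)⁻¹ * (ip x (n + 1) (ξ m) (thetaAvg θ ξ m)
        - ip x (n + 1) (ξ (m - 1)) (thetaAvg θ ξ m)) + Y ^ 2
      ≤ ((τ + R) * Real.sqrt β⁻¹ + D) * Y := by
    rw [heq]
    have r7 := mul_le_mul_of_nonneg_left r5 (by linarith : (0 : ℝ) ≤ θ)
    have r8 := mul_le_mul_of_nonneg_left r6 (by linarith : (0 : ℝ) ≤ 1 - θ)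
    have r9 := (le_abs_self _).trans r1
    have r10 := (neg_abs_le _).trans' (neg_le_neg r2)
    linarith
  have hmul := mul_le_mul_of_nonneg_left hrhs (by linarith : 0 ≤ 2 * (T / M))
  have hcancel : 2 * (T / M) * ((T / M)⁻¹ * (ip x (n + 1) (ξ m) (thetaAvg θ ξ m)
        - ip x (n + 1) (ξ (m - 1)) (thetaAvg θ ξ m)) + Y ^ 2)
      = 2 * (ip x (n + 1) (ξ m) (thetaAvg θ ξ m)
        - ip x (n + 1) (ξ (m - 1)) (thetaAvg θ ξ m)) + 2 * (T / M) * Y ^ 2 := by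
    field_simp
  rw [hcancel] at hmul
  rw [sq_l2norm hx.le, sq_l2norm hx.le]
  linarith

/-- The discrete error at the initial time. -/
theorem initial_error_le (hx : IsMesh x (n + 1)) (hx0 : x 0 = 0) (hx1 : x (n + 1) = 1)
    (hT : 0 < T) (hM : 1 ≤ M) (hu : SmoothOnBox T u)
    (hs : IsSolution ε T a b f u₀ u) (hW : IsThetaScheme x (n + 1) k M ε T θ a b f u₀ U Q)
    {R : ℝ} (hR : 0 ≤ R) (herr : ∀ j ∈ Finset.Icc 1 (n + 1), ∀ y ∈ Icc (x (j - 1)) (x j),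
      |errR x k (fun y => u y (timePt T M 0)) j y| ≤ R) :
    l2norm x (n + 1) (discErrU x k T M u U 0) ≤ R := by
  have ht0 : timePt T M 0 = 0 := by simp [timePt]
  have huc : ContinuousOn (fun y => u y (timePt T M 0)) (Icc 0 1) :=
    (hu.space (timePt_mem hT hM (Nat.zero_le _))).continuousOn
  have hub := elementwiseContinuous_of_continuousOn huc hx.sub
  have heR := errR_elementwiseContinuous (k := k) hx huc
  have hd : IsDiscrete (n + 1) k (discErrU x k T M u U 0) :=
    isDiscrete_discErrU (fun i hi => (hW.discrete i hi).1) (Nat.zero_le _)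
  set ξ := discErrU x k T M u U 0 with hξ
  have hc : ElementwiseContinuous x (n + 1) ξ := hd.elementwiseContinuous
  have hUc : ElementwiseContinuous x (n + 1) (U 0) := hW.initial.1.elementwiseContinuous
  -- `ξ` is discrete, so the `L²` projection may be replaced by `u₀`. Then `‖ξ‖²` is minus the inner
  -- product of the Gauss–Radau error with `ξ`.
  have e1 : ip x (n + 1) (U 0) ξ = ip x (n + 1) (fun _ y => u y (timePt T M 0)) ξ := by
    refine Finset.sum_congr rfl fun j hj => ?_
    rw [hW.initial.2 ξ hd j hj]
    refine intervalIntegral.integral_congr fun y hy => ?_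
    rw [uIcc_of_le (hx.le j hj)] at hy
    simp only [ht0, hs.initial y (hx.sub j hj hy)]
  have e2 : ip x (n + 1) ξ ξ = -ip x (n + 1) (errR x k fun y => u y (timePt T M 0)) ξ := by
    have h1 : ip x (n + 1) ξ ξ = ip x (n + 1) (fun _ y => u y (timePt T M 0)) ξ
        - ip x (n + 1) (errR x k fun y => u y (timePt T M 0)) ξ - ip x (n + 1) (U 0) ξ := by
      rw [← ip_sub_left hx.le hub heR hc, ← ip_sub_left hx.le (hub.sub heR) hUc hc]
      refine ip_congr hx.le fun j _ y _ => ?_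
      simp only [hξ, discErrU, errR]
      ring
    rw [h1, e1]
    ring
  have h2 : l2norm x (n + 1) (errR x k fun y => u y (timePt T M 0)) ≤ R :=
    l2norm_le_of_sup hx.le (by rw [hx0, hx1, sub_zero]) heR hR herr
  have h3 : l2norm x (n + 1) ξ ^ 2 ≤ R * l2norm x (n + 1) ξ := by
    rw [sq_l2norm hx.le, e2]
    refine (neg_le_abs _).trans ((abs_ip_le hx.le heR hc).trans ?_)
    exact mul_le_mul_of_nonneg_right h2 (Real.sqrt_nonneg _)
  have h4 : 0 ≤ l2norm x (n + 1) ξ := Real.sqrt_nonneg _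
  by_contra! hcon
  nlinarith

end Scheme

/-! ### Error bounds in terms of the projection errors -/

section Scheme

variable {x : ℕ → ℝ} {n k M : ℕ} {ε T θ α β A : ℝ} {a b : ℝ → ℝ} {f : ℝ → ℝ → ℝ} {u₀ : ℝ → ℝ}
  {u : ℝ → ℝ → ℝ} {U Q : ℕ → Broken}

/-- The errors of the fully discrete scheme in terms of bounds `R`, `S` of the projection errors
and a bound `τ` of the truncation error in time. -/
theorem scheme_error_le (hx : IsMesh x (n + 1)) (hx0 : x 0 = 0) (hx1 : x (n + 1) = 1)
    (hlt : ∀ j ∈ Finset.Icc 1 (n + 1), x (j - 1) < x j)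
    (hc : CoeffBounds a b α β A) (hε : 0 < ε) (hT : 0 < T) (hM : 1 ≤ M) (hu : SmoothOnBox T u)
    (hs : IsSolution ε T a b f u₀ u) (hW : IsThetaScheme x (n + 1) k M ε T θ a b f u₀ U Q)
    (hθ : 1 / 2 ≤ θ) (hθ1 : θ ≤ 1) {R S τ D B e : ℝ} (hR : 0 ≤ R) (hτ : 0 ≤ τ)
    (htrunc : ∀ m ∈ Finset.Icc 1 M, ∀ y ∈ Icc (0 : ℝ) 1, |(T / M)⁻¹ * u y (timePt T M m)
            - (T / M)⁻¹ * u y (timePt T M (m - 1))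
            - (θ * boxDt T u y (timePt T M m) + (1 - θ) * boxDt T u y (timePt T M (m - 1)))| ≤ τ)
    (hquot : ∀ m ∈ Finset.Icc 1 M, ∀ j ∈ Finset.Icc 1 (n + 1), ∀ y ∈ Icc (x (j - 1)) (x j),
      |errR x k (fun y => (T / M)⁻¹ * u y (timePt T M m)
            - (T / M)⁻¹ * u y (timePt T M (m - 1))) j y| ≤ R)
    (hform : ∀ i ≤ M, ∀ v r, IsDiscrete (n + 1) k v → IsDiscrete (n + 1) k r →
      |formB x (n + 1) ε a b (errR x k fun z => u z (timePt T M i))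
        (errL x k (fluxAt ε T M u i)) v r| ≤ D * energyNorm x (n + 1) ε a b v r)
    (hsup : ∀ i ≤ M, ∀ j ∈ Finset.Icc 1 (n + 1), ∀ y ∈ Icc (x (j - 1)) (x j),
      |errR x k (fun y => u y (timePt T M i)) j y| ≤ R)
    (hjump : ∀ i ≤ M, ∑ j ∈ Finset.Icc 1 (n + 1),
      errR x k (fun y => u y (timePt T M i)) j (x (j - 1)) ^ 2 ≤ S)
    (hflux : ∀ i ≤ M, ε⁻¹ * ip x (n + 1) (errL x k (fluxAt ε T M u i))
      (errL x k (fluxAt ε T M u i)) ≤ R ^ 2)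
    (hB : (τ + R) * Real.sqrt β⁻¹ + D ≤ B) (hRB : R ≤ B) (he : 0 ≤ e)
    (hSe : 4 * ((1 + A) * R ^ 2 + A * S) ≤ e ^ 2) :
    l2norm x (n + 1) (fun j y => u y T - U M j y) ≤ R + B * (1 + T) ∧
    T / M * ∑ m ∈ Finset.Icc 1 M, energyNorm x (n + 1) ε a b
        (thetaAvg θ (fun n j y => u y (timePt T M n) - U n j y) m)
        (thetaAvg θ (fun n j y => ε * dx (fun z => u z (timePt T M n)) y - Q n j y) m)
      ≤ 2 * (T * e + B * (1 + T)) := by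
  have hM0 : (0 : ℝ) < M := by exact_mod_cast hM
  have hΔ : 0 < T / M := by positivity
  have huc : ∀ i ≤ M, ContinuousOn (fun y => u y (timePt T M i)) (Icc 0 1) :=
    fun i hi => (hu.space (timePt_mem hT hM hi)).continuousOn
  have hqc : ∀ i ≤ M, ContinuousOn (fluxAt ε T M u i) (Icc 0 1) :=
    fun i hi => (contDiffOn_flux hu (timePt_mem hT hM hi) ε).continuousOn
  have heR : ∀ i ≤ M, ElementwiseContinuous x (n + 1) (errR x k fun z => u z (timePt T M i)) :=
    fun i hi => errR_elementwiseContinuous hx (huc i hi)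
  have heL : ∀ i ≤ M, ElementwiseContinuous x (n + 1) (errL x k (fluxAt ε T M u i)) :=
    fun i hi => errL_elementwiseContinuous hx (hqc i hi)
  have hξU : ∀ i ≤ M, ElementwiseContinuous x (n + 1) (discErrU x k T M u U i) := fun i hi =>
    (isDiscrete_discErrU (fun i hi => (hW.discrete i hi).1) hi).elementwiseContinuous
  have hξQ : ∀ i ≤ M, ElementwiseContinuous x (n + 1) (discErrQ x k ε T M u Q i) := fun i hi =>
    (isDiscrete_discErrQ (fun i hi => (hW.discrete i hi).2) hi).elementwiseContinuous
  have hX := energy_bounds (X := fun m => l2norm x (n + 1) (discErrU x k T M u U m))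
    (Y := fun m => energyNorm x (n + 1) ε a b (thetaAvg θ (discErrU x k T M u U) m)
          (thetaAvg θ (discErrQ x k ε T M u Q) m)) hT hM (hR.trans hRB) (Real.sqrt_nonneg _)
    ((initial_error_le hx hx0 hx1 hT hM hu hs hW hR (hsup 0 (Nat.zero_le _))).trans hRB)
    fun m hm => (energy_step hx hx0 hx1 hc hε hT hM hu hs hW hθ hθ1 hm hR hτ (htrunc m hm)
      (hquot m hm) hform).trans (mul_le_mul_of_nonneg_left
        (mul_le_mul_of_nonneg_right hB (Real.sqrt_nonneg _)) (by positivity))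
  obtain ⟨hX1, hX2⟩ := hX
  refine ⟨?_, ?_⟩
  · have htM : timePt T M M = T := by
      unfold timePt
      field_simp
    have h1 : (fun j y => u y T - U M j y) = fun j y =>
        errR x k (fun z => u z (timePt T M M)) j y + discErrU x k T M u U M j y := by
      funext j y
      simp only [errR, discErrU, htM]
      ring
    rw [h1]
    refine (l2norm_add_le hx (heR M le_rfl) (hξU M le_rfl)).trans (add_le_add ?_ hX1)
    exact l2norm_le_of_sup hx.le (by rw [hx0, hx1, sub_zero]) (heR M le_rfl) hR (hsup M le_rfl)
  · have hstep : ∀ m ∈ Finset.Icc 1 M, energyNorm x (n + 1) ε a b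
        (thetaAvg θ (fun n j y => u y (timePt T M n) - U n j y) m)
        (thetaAvg θ (fun n j y => ε * dx (fun z => u z (timePt T M n)) y - Q n j y) m)
        ≤ 2 * (e + energyNorm x (n + 1) ε a b (thetaAvg θ (discErrU x k T M u U) m)
          (thetaAvg θ (discErrQ x k ε T M u Q) m)) := by
      intro m hm
      have hm' := Finset.mem_Icc.1 hm
      have hm0 : m - 1 ≤ M := by omega
      have hv : ElementwiseContinuous x (n + 1) (thetaAvg θ (discErrU x k T M u U) m) :=
        (hξU m hm'.2).comb θ (1 - θ) (hξU _ hm0)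
      have hr : ElementwiseContinuous x (n + 1) (thetaAvg θ (discErrQ x k ε T M u Q) m) :=
        (hξQ m hm'.2).comb θ (1 - θ) (hξQ _ hm0)
      have h1 : thetaAvg θ (fun n j y => u y (timePt T M n) - U n j y) m = fun j y =>
          (θ * errR x k (fun z => u z (timePt T M m)) j y
            + (1 - θ) * errR x k (fun z => u z (timePt T M (m - 1))) j y)
          + thetaAvg θ (discErrU x k T M u U) m j y := by
        funext j y
        simp only [errR, discErrU, thetaAvg]
        ring
      have h2 : thetaAvg θ (fun n j y => ε * dx (fun z => u z (timePt T M n)) y - Q n j y) m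
          = fun j y => (θ * errL x k (fluxAt ε T M u m) j y
            + (1 - θ) * errL x k (fluxAt ε T M u (m - 1)) j y)
          + thetaAvg θ (discErrQ x k ε T M u Q) m j y := by
        funext j y
        simp only [errL, discErrQ, thetaAvg, fluxAt]
        ring
      have h3 := energySq_add_le hx hc hε
        ((heR m hm'.2).comb θ (1 - θ) (heR _ hm0)) hv ((heL m hm'.2).comb θ (1 - θ) (heL _ hm0)) hr
      have h4 := energySq_comb_le hx hc hε (heR m hm'.2) (heR _ hm0) (heL m hm'.2) (heL _ hm0)
        (by linarith : 0 ≤ θ) hθ1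
      have h5 := energySq_projection_error_le (ε := ε) hx hx0 hx1 hlt hc (huc m hm'.2) hR
        (hsup m hm'.2) (hjump m hm'.2) (hflux m hm'.2)
      have h6 := energySq_projection_error_le (ε := ε) hx hx0 hx1 hlt hc (huc _ hm0) hR
        (hsup _ hm0) (hjump _ hm0) (hflux _ hm0)
      rw [← sq_energyNorm hx hc hε hv] at h3
      have h7 : 0 ≤ energyNorm x (n + 1) ε a b (thetaAvg θ (discErrU x k T M u U) m)
          (thetaAvg θ (discErrQ x k ε T M u Q) m) := Real.sqrt_nonneg _
      rw [h1, h2, energyNorm_eq]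
      refine Real.sqrt_le_iff.2 ⟨by positivity, h3.trans ?_⟩
      -- With `Y` the energy norm of the discrete error, `h4` to `h6` and `hSe` bound the averaged
      -- projection part by `e²`; then `2(e² + Y²) ≤ (2(e + Y))²`.
      nlinarith [mul_nonneg he h7]
    calc _ ≤ T / M * ∑ m ∈ Finset.Icc 1 M, 2 * (e + energyNorm x (n + 1) ε a b
          (thetaAvg θ (discErrU x k T M u U) m) (thetaAvg θ (discErrQ x k ε T M u Q) m)) :=
          mul_le_mul_of_nonneg_left (Finset.sum_le_sum hstep) hΔ.le
      _ = 2 * (T * e + T / M * ∑ m ∈ Finset.Icc 1 M, energyNorm x (n + 1) ε a b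
          (thetaAvg θ (discErrU x k T M u U) m) (thetaAvg θ (discErrQ x k ε T M u Q) m)) := by
        rw [← Finset.mul_sum, Finset.sum_add_distrib, Finset.sum_const, Nat.card_Icc,
          nsmul_eq_mul, Nat.add_sub_cancel]
        field_simp
      _ ≤ _ := by linarith

end Scheme

/-! ### Projection errors on layer-adapted meshes -/

/-- The constant in the bounds of the projection errors. -/
def projConst (k : ℕ) (σ α C₀ : ℝ) : ℝ :=
  2 * interpConst k σ α C₀ + Real.sqrt (fluxInterpConst k σ α C₀)

section Projection

variable {k n : ℕ} {σ α ε δ C₀ κ : ℝ} {x : ℕ → ℝ} {g : ℝ → ℝ}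

theorem interpConst_nonneg (hσ : (k : ℝ) + 2 ≤ σ) (hα : 0 < α) (hC₀ : 0 ≤ C₀) :
    0 ≤ interpConst k σ α C₀ := by
  have h1 := radauConst_nonneg k
  have h2 := layerConst_nonneg hσ hα
  unfold interpConst
  positivity

theorem fluxInterpConst_nonneg (hσ : (k : ℝ) + 2 ≤ σ) (hα : 0 < α) :
    0 ≤ fluxInterpConst k σ α C₀ := by
  have hσ0 : 0 < σ := by linarith [Nat.cast_nonneg (α := ℝ) k]
  have h2 := layerConst_nonneg hσ hα
  unfold fluxInterpConst fluxConst
  positivity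

theorem LayerMesh.isMesh {ω : ℝ} {N : ℕ} (hx : LayerMesh x N ω δ C₀) : IsMesh x N :=
  ⟨fun j hj => (hx.lt j hj).le, fun _ hj => hx.Icc_subset hj⟩

theorem LayerMesh.errR_sup (hx : LayerMesh x (n + 1) (α / (σ * ε)) δ C₀) (hσ : (k : ℝ) + 2 ≤ σ)
    (hα : 0 < α) (hε : 0 < ε) (hκ : 0 ≤ κ) (hg : HasSplit (k + 1) ε α κ κ g) :
    ∀ j ∈ Finset.Icc 1 (n + 1), ∀ y ∈ Icc (x (j - 1)) (x j),
      |errR x k g j y| ≤ projConst k σ α C₀ * κ * δ ^ (k + 1) := by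
  intro j hj y hy
  have hδ := hx.delta_pos
  refine (hx.interp_sup hσ hα hε hg le_rfl le_rfl hj hy).1.trans ?_
  have : 2 * interpConst k σ α C₀ ≤ projConst k σ α C₀ :=
    le_add_of_nonneg_right (Real.sqrt_nonneg _)
  gcongr

theorem LayerMesh.errL_flux (hx : LayerMesh x (n + 1) (α / (σ * ε)) δ C₀) (hσ : (k : ℝ) + 2 ≤ σ)
    (hα : 0 < α) (hε : 0 < ε) (hε1 : ε ≤ 1) (hκ : 0 ≤ κ)
    (hg : HasSplit (k + 1) ε α (ε * κ) κ g) :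
    |errL x k g (n + 1) (x (n + 1))| ≤ projConst k σ α C₀ * κ * δ ^ (k + 1) ∧
    ε⁻¹ * ip x (n + 1) (errL x k g) (errL x k g)
      ≤ (projConst k σ α C₀ * κ * δ ^ (k + 1)) ^ 2 := by
  have hδ := hx.delta_pos
  have hN : n + 1 ∈ Finset.Icc 1 (n + 1) := Finset.mem_Icc.2 ⟨by omega, le_rfl⟩
  have hI := interpConst_nonneg hσ hα (hx.const_nonneg (Nat.succ_le_succ (Nat.zero_le n)))
  have hF := fluxInterpConst_nonneg (C₀ := C₀) hσ hα
  constructor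
  · refine (hx.interp_sup hσ hα hε hg (mul_le_of_le_one_left hκ hε1) le_rfl hN
      ⟨(hx.lt _ hN).le, le_rfl⟩).2.trans ?_
    have : 2 * interpConst k σ α C₀ ≤ projConst k σ α C₀ :=
      le_add_of_nonneg_right (Real.sqrt_nonneg _)
    gcongr
  · have h1 := hx.interp_flux hσ hα hε hε1 hg
    have h2 : fluxInterpConst k σ α C₀ ≤ projConst k σ α C₀ ^ 2 := by
      rw [← Real.sq_sqrt hF]
      exact pow_le_pow_left₀ (Real.sqrt_nonneg _) (le_add_of_nonneg_left (by positivity)) 2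
    calc ε⁻¹ * ip x (n + 1) (errL x k g) (errL x k g)
        = ε⁻¹ * ∑ j ∈ Finset.Icc 1 (n + 1),
            ∫ y in (x (j - 1))..(x j), (g y - radauL x k g j y) ^ 2 := by
          simp only [ip, errL, sq]
      _ ≤ _ := h1
      _ ≤ projConst k σ α C₀ ^ 2 * κ ^ 2 * δ ^ (2 * k + 2) := by gcongr
      _ = _ := by ring

end Projection

/-- A common bound for the derivatives of the solution that enter the error estimate. -/
theorem exists_derivative_bound (K : ℕ → ℕ → ℝ) (n : ℕ) :
    ∃ κ : ℝ, 0 ≤ κ ∧ (∀ j ≤ n, K j 0 ≤ κ ∧ K j 1 ≤ κ) ∧ K 0 2 ≤ κ ∧ K 0 3 ≤ κ := by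
  refine ⟨∑ j ∈ Finset.range (n + 1), (|K j 0| + |K j 1|) + (|K 0 2| + |K 0 3|), by positivity,
    fun j hj => ?_, ?_, ?_⟩
  · have h1 := Finset.single_le_sum (f := fun j => |K j 0| + |K j 1|)
      (fun j _ => by positivity) (Finset.mem_range.2 (Nat.lt_succ_of_le hj))
    constructor <;> linarith [le_abs_self (K j 0), le_abs_self (K j 1), abs_nonneg (K j 0),
      abs_nonneg (K j 1), abs_nonneg (K 0 2), abs_nonneg (K 0 3)]
  all_goals
    have h2 : 0 ≤ ∑ j ∈ Finset.range (n + 1), (|K j 0| + |K j 1|) := by positivity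
    linarith [le_abs_self (K 0 2), le_abs_self (K 0 3), abs_nonneg (K 0 2), abs_nonneg (K 0 3)]

/-- The error bounds on a layer-adapted mesh. -/
theorem exists_layerMesh_error_bound (k : ℕ) (a b : ℝ → ℝ) (α β σ C₀ : ℝ) (K : ℕ → ℕ → ℝ)
    (ha : ContDiffOn ℝ 1 a (Icc 0 1)) (hb : ContinuousOn b (Icc 0 1)) (hα : 0 < α) (hβ : 0 < β)
    (haα : ∀ x ∈ Icc (0 : ℝ) 1, α ≤ a x) (hbβ : ∀ x ∈ Icc (0 : ℝ) 1, β ≤ b x - dx a x / 2)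
    (hσ : (k : ℝ) + 2 ≤ σ) (hC₀ : 0 ≤ C₀) :
    ∃ C : ℝ, 0 < C ∧ ∀ (ε δ : ℝ) (n : ℕ) (x : ℕ → ℝ) (T : ℝ) (M : ℕ) (θ : ℝ)
      (f : ℝ → ℝ → ℝ) (u₀ : ℝ → ℝ) (u : ℝ → ℝ → ℝ) (U Q : ℕ → Broken),
      0 < ε → ε ≤ 1 → LayerMesh x (n + 1) (α / (σ * ε)) δ C₀ →
      0 < T → 1 ≤ M → 1 / 2 ≤ θ → θ ≤ 1 → IsSolution ε T a b f u₀ u →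
      HasLayerDecomposition ε α T K u → IsThetaScheme x (n + 1) k M ε T θ a b f u₀ U Q →
      l2norm x (n + 1) (fun j y => u y T - U M j y)
        ≤ C * (1 + T) * ((T / M) ^ (if θ = 1 / 2 then 2 else 1) + δ ^ (k + 1)) ∧
      T / M * ∑ m ∈ Finset.Icc 1 M, energyNorm x (n + 1) ε a b
          (thetaAvg θ (fun n j y => u y (timePt T M n) - U n j y) m)
          (thetaAvg θ (fun n j y => ε * dx (fun z => u z (timePt T M n)) y - Q n j y) m)
        ≤ C * (1 + T) * ((T / M) ^ (if θ = 1 / 2 then 2 else 1) + δ ^ ((k : ℝ) + 1 / 2)) := by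
  obtain ⟨A, hc⟩ := exists_coeffBounds ha hb hα hβ haα hbβ
  have hA := hc.bound_pos
  obtain ⟨B, hB, hform⟩ := exists_formB_projection_bound k α β A hα hβ hA.le
  -- Interpolation uses `k + 1` derivatives, and the flux has already spent one.
  obtain ⟨κ, hκ, hKκ, hK2, hK3⟩ := exists_derivative_bound K (k + 2)
  set I := interpConst k σ α C₀ with hI
  set G := projConst k σ α C₀ with hG
  have hI0 : 0 ≤ I := interpConst_nonneg hσ hα hC₀
  have hG0 : 0 ≤ G := add_nonneg (by positivity) (Real.sqrt_nonneg _)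
  set s := Real.sqrt β⁻¹ with hs
  have hs0 : 0 ≤ s := Real.sqrt_nonneg _
  -- Collects `(τ + R) √β⁻¹ + D` for `τ = 2κ (Δt)^ν`, `R = Gκ δ^(k+1)` and `D = B R`; the last
  -- summand ensures `R ≤ C₁ ((Δt)^ν + δ^(k+1))`. `C₂` comes from the energy norm of the projection
  -- error.
  set C₁ := (2 * κ + G * κ) * s + B * (G * κ) + G * κ with hC₁
  set C₂ := Real.sqrt (4 * ((1 + A) * (G * κ) ^ 2 + A * (4 * I ^ 2 * κ ^ 2))) with hC₂
  have hC₁0 : 0 ≤ C₁ := by positivity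
  have hC₂0 : 0 ≤ C₂ := Real.sqrt_nonneg _
  refine ⟨G * κ + 2 * C₁ + 2 * C₂ + 1, by positivity, ?_⟩
  intro ε δ n x T M θ f u₀ u U Q hε hε1 hx hT hM hθ hθ1 hsol hdec hW
  have hM0 : (0 : ℝ) < M := by exact_mod_cast hM
  have hΔ : 0 < T / M := by positivity
  have hδ := hx.delta_pos
  have hu := hdec.smoothOnBox
  set P := δ ^ (k + 1) with hP
  set Δν := (T / M) ^ (if θ = 1 / 2 then 2 else 1) with hΔν
  have hP0 : 0 < P := by positivity
  have hΔν0 : 0 < Δν := by positivity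
  have hsp : ∀ i ≤ M, HasSplit (k + 1) ε α κ κ (fun y => u y (timePt T M i)) := fun i hi =>
    hdec.hasSplit hε (fun j hj => (hKκ j (by omega)).1) (timePt_mem hT hM hi)
  have hfl : ∀ i ≤ M, HasSplit (k + 1) ε α (ε * κ) κ (fluxAt ε T M u i) := fun i hi =>
    (hdec.hasSplit hε (fun j hj => (hKκ j hj).1) (timePt_mem hT hM hi)).scaled_dx hε
  have htl : ∀ m ∈ Finset.Icc 1 M, timePt T M (m - 1) ∈ Icc (0 : ℝ) T ∧
      timePt T M m ∈ Icc (0 : ℝ) T ∧ timePt T M (m - 1) < timePt T M m ∧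
      timePt T M m - timePt T M (m - 1) = T / M := by
    intro m hm
    have hm' := Finset.mem_Icc.1 hm
    have h := timePt_sub (T := T) (M := M) hm'.1
    exact ⟨timePt_mem hT hM (by omega), timePt_mem hT hM hm'.2, by linarith, h⟩
  set R := G * κ * P with hR
  have hR0 : 0 ≤ R := by positivity
  set e := C₂ * δ ^ ((k : ℝ) + 1 / 2) with he
  have hδr : (δ ^ ((k : ℝ) + 1 / 2)) ^ 2 = δ ^ (2 * k + 1) := by
    rw [← Real.rpow_natCast, ← Real.rpow_mul hδ.le, ← Real.rpow_natCast]
    congr 1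
    push_cast
    ring
  -- This needs `δ ≤ 1`, which is why `δ` is capped at `1` in `layerMesh_meshPt`.
  have hPr : P ≤ δ ^ ((k : ℝ) + 1 / 2) := by
    rw [hP, ← Real.rpow_natCast]
    refine Real.rpow_le_rpow_of_exponent_ge hδ hx.delta_le_one ?_
    push_cast
    linarith
  have hmain := scheme_error_le (R := R) (S := 4 * I ^ 2 * κ ^ 2 * δ ^ (2 * k + 1))
    (τ := 2 * κ * Δν) (D := B * R) (B := C₁ * (Δν + P)) (e := e)
    hx.isMesh hx.left hx.right hx.lt hc hε hT hM hu hsol hW hθ hθ1 hR0 (by positivity)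
    (fun m hm y hy => ?_) (fun m hm => ?_) (fun i hi v r hv hr => ?_)
    (fun i hi => hx.errR_sup hσ hα hε hκ (hsp i hi))
    (fun i hi => hx.interp_jump hσ hα hε (hsp i hi) le_rfl le_rfl)
    (fun i hi => (hx.errL_flux hσ hα hε hε1 hκ (hfl i hi)).2) ?_ ?_ (by positivity) ?_
  · obtain ⟨h1, h2⟩ := hmain
    have hT1 : 0 < 1 + T := by linarith
    have h3 : R ≤ G * κ * (1 + T) * (Δν + P) := by
      have h0 : 0 ≤ (1 + T) * Δν + T * P := by positivity
      have : P ≤ (1 + T) * (Δν + P) := by linear_combination h0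
      calc R = G * κ * P := rfl
        _ ≤ G * κ * ((1 + T) * (Δν + P)) := by gcongr
        _ = _ := by ring
    have hr0 : 0 < δ ^ ((k : ℝ) + 1 / 2) := Real.rpow_pos_of_pos hδ _
    constructor
    · refine h1.trans ?_
      have h4 : 0 ≤ (C₁ + 2 * C₂ + 1) * ((1 + T) * (Δν + P)) := by positivity
      linear_combination h3 + h4
    · refine h2.trans ?_
      set r := δ ^ ((k : ℝ) + 1 / 2) with hr
      have h4 : C₁ * (Δν + P) * (1 + T) ≤ C₁ * (Δν + r) * (1 + T) := by gcongr
      have h5 : T * e ≤ C₂ * (1 + T) * (Δν + r) := by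
        have h0 : 0 ≤ (1 + T) * Δν + r := by positivity
        have : T * r ≤ (1 + T) * (Δν + r) := by linear_combination h0
        calc T * e = C₂ * (T * r) := by rw [he]; ring
          _ ≤ C₂ * ((1 + T) * (Δν + r)) := by gcongr
          _ = _ := by ring
      have h6 : 0 ≤ (G * κ + 1) * ((1 + T) * (Δν + r)) := by positivity
      linear_combination 2 * h4 + 2 * h5 + h6
  · obtain ⟨t0, t1, t2, t3⟩ := htl m hm
    have := hdec.abs_truncation_le hε hα hT hK2 hK3 hy t0 t1 t2 (by linarith : 0 ≤ θ) hθ1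
    rwa [t3] at this
  · obtain ⟨t0, t1, t2, t3⟩ := htl m hm
    have := hdec.hasSplit_diff_quotient (n := k + 1) hε hT
      (fun j hj => (hKκ j (by omega)).2) t0 t1 t2
    rw [t3] at this
    exact hx.errR_sup hσ hα hε hκ this
  · have h1 := hx.errL_flux hσ hα hε hε1 hκ (hfl i hi)
    exact hform a b x n ε _ _ v r R hc hx.isMesh hx.left hx.right hx.lt hε
      (hsp i hi).contDiffOn.continuousOn (hfl i hi).contDiffOn.continuousOn hv hr hR0
      (hx.errR_sup hσ hα hε hκ (hsp i hi)) h1.1 h1.2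
  · have h1 : 0 ≤ (G * κ * s + B * (G * κ) + G * κ) * Δν := by positivity
    have h2 : 0 ≤ (2 * κ * s + G * κ) * P := by positivity
    rw [hC₁, hR]
    linear_combination h1 + h2
  · have h1 : 0 ≤ C₁ * Δν := by positivity
    have h2 : 0 ≤ ((2 * κ + G * κ) * s + B * (G * κ)) * P := by positivity
    rw [hC₁] at h1 ⊢
    rw [hR]
    linear_combination h1 + h2
  · have h1 : R ^ 2 ≤ (G * κ) ^ 2 * δ ^ (2 * k + 1) := by
      have : P ^ 2 ≤ δ ^ (2 * k + 1) := by
        rw [hP, ← pow_mul]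
        exact pow_le_pow_of_le_one hδ.le hx.delta_le_one (by omega)
      rw [hR, mul_pow]
      gcongr
    have h2 : e ^ 2 = 4 * ((1 + A) * (G * κ) ^ 2 + A * (4 * I ^ 2 * κ ^ 2)) * δ ^ (2 * k + 1) := by
      rw [he, mul_pow C₂, hδr, hC₂, Real.sq_sqrt (by positivity)]
    rw [h2]
    calc 4 * ((1 + A) * R ^ 2 + A * (4 * I ^ 2 * κ ^ 2 * δ ^ (2 * k + 1)))
        ≤ 4 * ((1 + A) * ((G * κ) ^ 2 * δ ^ (2 * k + 1))
          + A * (4 * I ^ 2 * κ ^ 2 * δ ^ (2 * k + 1))) := by gcongr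
      _ = _ := by ring

end LDG

end

theorem mainTheorem4 (k : ℕ) (a b : ℝ → ℝ) (α β σ : ℝ) (K : ℕ → ℕ → ℝ)
    (ha : ContDiffOn ℝ 1 a (Set.Icc 0 1)) (hb : ContinuousOn b (Set.Icc 0 1))
    (hα : 0 < α) (hβ : 0 < β)
    (haα : ∀ x ∈ Set.Icc (0 : ℝ) 1, α ≤ a x)
    (hbβ : ∀ x ∈ Set.Icc (0 : ℝ) 1, β ≤ b x - LDG.dx a x / 2)
    (hσ : (k : ℝ) + 2 ≤ σ) :
    ∃ C : ℝ, 0 < C ∧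
      ∀ (ε : ℝ) (N : ℕ) (φ : ℝ → ℝ) (T : ℝ) (M : ℕ) (θ : ℝ)
        (f : ℝ → ℝ → ℝ) (u₀ : ℝ → ℝ) (u : ℝ → ℝ → ℝ) (U Q : ℕ → LDG.Broken),
        2 ≤ N → Even N → 0 < ε → ε ≤ (N : ℝ)⁻¹ →
        LDG.IsMeshGenerating φ →
        (φ (1 / 2) = Real.log N ∨ φ (1 / 2) = Real.log (1 / ε)) →
        σ * ε / α * φ (1 / 2) ≤ 1 / 2 →
        0 < T → 1 ≤ M → 1 / 2 ≤ θ → θ ≤ 1 →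
        LDG.IsSolution ε T a b f u₀ u →
        LDG.HasLayerDecomposition ε α T K u →
        LDG.IsThetaScheme (LDG.meshPt σ ε α φ N) N k M ε T θ a b f u₀ U Q →
        LDG.l2norm (LDG.meshPt σ ε α φ N) N (fun j y => u y T - U M j y)
            ≤ C * (1 + T) * ((T / M) ^ (if θ = 1 / 2 then 2 else 1)
                + ((N : ℝ)⁻¹ * LDG.maxPsi' φ) ^ (k + 1)) ∧
        T / M * ∑ m ∈ Finset.Icc 1 M,
            LDG.energyNorm (LDG.meshPt σ ε α φ N) N ε a b
              (LDG.thetaAvg θ (fun n j y => u y (LDG.timePt T M n) - U n j y) m)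
              (LDG.thetaAvg θ
                (fun n j y => ε * LDG.dx (fun z => u z (LDG.timePt T M n)) y - Q n j y) m)
            ≤ C * (1 + T) * ((T / M) ^ (if θ = 1 / 2 then 2 else 1)
                + ((N : ℝ)⁻¹ * LDG.maxPsi' φ) ^ ((k : ℝ) + 1 / 2)) := by
  have hσ0 : 0 < σ := by linarith [Nat.cast_nonneg (α := ℝ) k]
  obtain ⟨C, hC, h⟩ := LDG.exists_layerMesh_error_bound k a b α β σ (2 + 2 * σ / α) K ha hb hα hβ
    haα hbβ hσ (by positivity)
  refine ⟨C, hC, ?_⟩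
  intro ε N φ T M θ f u₀ u U Q hN hNe hε hεN hφ hφN hτ hT hM hθ hθ1 hs hd hW
  have hN2 : (2 : ℝ) ≤ N := by exact_mod_cast hN
  have hε1 : ε ≤ 1 := hεN.trans (inv_le_one_of_one_le₀ (by linarith))
  have hx := LDG.layerMesh_meshPt hσ0 hα hN hNe hε hεN hφ hφN hτ
  obtain ⟨n, rfl⟩ : ∃ n, N = n + 1 := ⟨N - 1, by omega⟩
  obtain ⟨h1, h2⟩ := h ε _ n _ T M θ f u₀ u U Q hε hε1 hx hT hM hθ hθ1 hs hd hW
  have hδ := hx.delta_pos.le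
  -- Removes the cap at `1`, since the bounds increase with `δ`.
  have hle := min_le_right 1 (((n + 1 : ℕ) : ℝ)⁻¹ * LDG.maxPsi' φ)
  refine ⟨h1.trans ?_, h2.trans ?_⟩
  · have := pow_le_pow_left₀ hδ hle (k + 1)
    gcongr
  · have := Real.rpow_le_rpow hδ hle (by positivity : (0 : ℝ) ≤ (k : ℝ) + 1 / 2)
    gcongr
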